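/- Work in ZFC; "class" means a class that is first-order definable in the language of set theory with set parameters, so that each statement below is an axiom schema, and the equivalence is asserted in every model $(V,\in)$ of ZFC (no form of definable global choice, such as $V=\mathrm{HOD}$, is assumed). A language is a set of relation symbols with finite arities; structures have nonempty domain; an ordinal $\mathcal L$-structure is an $\mathcal L$-structure whose domain is an ordinal. Let $\mathcal L_{\mathrm{std}}$ be the language with one binary relation symbol $\epsilon$ and one unary relation symbol $R$. For a class $A$ and an ordinal $\eta$, a cardinal $\alpha<\eta$ is called $\eta$-extendible for $A$ if there are an ordinal $\zeta$ and an elementary embedding $$j:\langle V_\eta,\in,A\cap V_\eta\rangle\to\langle V_\zeta,\in,A\cap V_\zeta\rangle$$ with critical point $\alpha$ and $j(\alpha)>\eta$; a cardinal $\alpha$ is $A$-extendible if it is $\eta$-extendible for $A$ for all ordinals $\eta>\alpha$. The following are equivalent. 1. (Vopěnka's Principle) For every proper class of $\mathcal L_{\mathrm{std}}$-structures there are distinct members $\mathcal M\neq\mathcal N$ of the class with an $\mathcal L_{\mathrm{std}}$-elementary embedding $j:\mathcal M\to\mathcal N$. 2. For every proper class $A$ there is an $A$-extendible cardinal. 3.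 For every proper class $A$ of ordinal $\mathcal L_{\mathrm{std}}$-structures there are $\mathcal M,\mathcal N\in A$ of different cardinalities with an elementary embedding $j:\mathcal M\to\mathcal N$. 4. For every language $\mathcal L$ and every proper class $A$ of ordinal $\mathcal L$-structures there are $\mathcal M,\mathcal N\in A$ of different cardinalities with an elementary embedding $j:\mathcal M\to\mathcal N$. -/

import Mathlib

/-! Set theory is developed inside an arbitrary model `M` of ZFC (possibly ill-founded).  Every
notion below that concerns elements of `M` (ordinal, function, structure, formula, satisfaction,
elementary embedding, ...) is the internal one, with quantifiers ranging over `M`.  The classes of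
`M` are its first-order definable subsets, with parameters. -/

universe u

namespace SetModel

/-- The relation symbols of the language of set theory: one binary symbol. -/
inductive SetRel : ℕ → Type
  | mem : SetRel 2

/-- The first-order language of set theory. -/
def LSet : FirstOrder.Language.{0, 0} := ⟨fun _ => Empty, SetRel⟩

variable {M : Type u} [LSet.Structure M]

/-- The membership relation of a structure for the language of set theory. -/
def Mem (x y : M) : Prop :=
  FirstOrder.Language.Structure.RelMap (L := LSet) SetRel.mem ![x, y]

infix:50 " ∊ " => Mem

/-! ### Basic notions -/

def IsEmptySet (x : M) : Prop := ∀ z, ¬ z ∊ x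

def IsSubset (x y : M) : Prop := ∀ z, z ∊ x → z ∊ y

/-- `s = x ∪ {x}`. -/
def IsSucc (s x : M) : Prop := ∀ z, z ∊ s ↔ z ∊ x ∨ z = x

/-- `p = {x, y}`. -/
def IsUPair (p x y : M) : Prop := ∀ z, z ∊ p ↔ z = x ∨ z = y

/-- `p = ⟨x, y⟩ = {{x}, {x, y}}`. -/
def IsOPair (p x y : M) : Prop := ∃ a b, IsUPair a x x ∧ IsUPair b x y ∧ IsUPair p a b

/-- `X` contains the empty set and is closed under successors. -/
def IsInductive (X : M) : Prop :=
  (∀ e, IsEmptySet e → e ∊ X) ∧ ∀ x s, x ∊ X → IsSucc s x → s ∊ X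

/-! ### The axioms of ZFC -/

/-- Definable subsets of `M`, arbitrary parameters from `M` being allowed. -/
def IsClass (A : Set M) : Prop := (Set.univ : Set M).Definable₁ LSet A

/-- Definable binary relations on `M`, arbitrary parameters from `M` being allowed. -/
def IsClassRel (R : Set (M × M)) : Prop := (Set.univ : Set M).Definable₂ LSet R

variable (M) in
/-- `M` is a model of ZFC. -/
structure IsModelZFC : Prop where
  extensionality : ∀ x y : M, (∀ z, z ∊ x ↔ z ∊ y) → x = y
  foundation : ∀ x : M, (∃ y, y ∊ x) → ∃ y, y ∊ x ∧ ∀ z, z ∊ x → ¬ z ∊ y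
  pairing : ∀ x y : M, ∃ p, IsUPair p x y
  union : ∀ x : M, ∃ s, ∀ z, z ∊ s ↔ ∃ y, y ∊ x ∧ z ∊ y
  powerset : ∀ x : M, ∃ p, ∀ z, z ∊ p ↔ IsSubset z x
  infinity : ∃ X : M, IsInductive X
  separation : ∀ A : Set M, IsClass A → ∀ x, ∃ y, ∀ z, z ∊ y ↔ z ∊ x ∧ z ∈ A
  replacement : ∀ R : Set (M × M), IsClassRel R → ∀ x,
    (∀ a, a ∊ x → ∃! b, (a, b) ∈ R) → ∃ y, ∀ b, b ∊ y ↔ ∃ a, a ∊ x ∧ (a, b) ∈ R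
  /-- Every family of nonempty pairwise disjoint sets has a transversal. -/
  choice : ∀ x : M, (∀ y, y ∊ x → ∃ z, z ∊ y) →
    (∀ y y', y ∊ x → y' ∊ x → y ≠ y' → ∀ z, ¬ (z ∊ y ∧ z ∊ y')) →
    ∃ c, ∀ y, y ∊ x → ∃! z, z ∊ y ∧ z ∊ c

/-- A proper class: a definable class that is not the extension of a set. -/
def IsProperClass (A : Set M) : Prop := IsClass A ∧ ¬ ∃ a, ∀ x, x ∊ a ↔ x ∈ A

/-! ### Functions, ordinals, cardinals, the hierarchy `V_η` -/

/-- `⟨x, y⟩ ∈ f`, that is, `f(x) = y` if `f` is a function. -/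
def App (f x y : M) : Prop := ∃ p, IsOPair p x y ∧ p ∊ f

/-- `f` is a function with domain `a`. -/
def IsFunOn (f a : M) : Prop :=
  (∀ p, p ∊ f → ∃ x y, x ∊ a ∧ IsOPair p x y) ∧ ∀ x, x ∊ a → ∃! y, App f x y

/-- `f` is a function from `a` to `b`. -/
def IsFun (f a b : M) : Prop := IsFunOn f a ∧ ∀ x y, App f x y → y ∊ b

def IsBijection (f a b : M) : Prop := IsFun f a b ∧ ∀ y, y ∊ b → ∃! x, App f x y

def SameCard (a b : M) : Prop := ∃ f, IsBijection f a b

def IsTransitiveSet (x : M) : Prop := ∀ y, y ∊ x → IsSubset y x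

def IsOrdinal (x : M) : Prop := IsTransitiveSet x ∧ ∀ y, y ∊ x → IsTransitiveSet y

/-- A cardinal: an ordinal that is not equinumerous with any of its elements. -/
def IsCardinal (x : M) : Prop := IsOrdinal x ∧ ∀ y, y ∊ x → ¬ SameCard y x

/-- `n` is a natural number of `M` (it may be nonstandard). -/
def IsNat (n : M) : Prop := ∀ X, IsInductive X → n ∊ X

def IsOmega (w : M) : Prop := ∀ n, n ∊ w ↔ IsNat n

/-- `x` is the numeral `k` of `M`. -/
def IsNumeral : ℕ → M → Prop
  | 0, x => IsEmptySet x
  | k + 1, x => ∃ y, IsNumeral k y ∧ IsSucc x y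

/-- `v = V_η`, where `V_β = ⋃_{γ < β} P(V_γ)`; the witness `f` is `β ↦ V_β` for `β ≤ η`. -/
def IsV (η v : M) : Prop :=
  ∃ s f, IsSucc s η ∧ IsFunOn f s ∧
    (∀ β y, App f β y → ∀ x, x ∊ y ↔ ∃ γ z, γ ∊ β ∧ App f γ z ∧ IsSubset x z) ∧ App f η v

/-! ### Languages and structures

A (relational, set-sized) language is coded by its arity function. -/

/-- `L` is a language: a function from a set of relation symbols to `ω`. -/
def IsLanguage (L : M) : Prop := ∃ S w, IsOmega w ∧ IsFun L S w

/-- `L` is the language with one binary relation symbol `ε` (coded by `0`) and one unary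
relation symbol `R` (coded by `1`), that is, `L = {⟨0, 2⟩, ⟨1, 1⟩}`. -/
def IsLStd (L : M) : Prop :=
  ∀ p, p ∊ L ↔ ∃ r n, IsOPair p r n ∧
    ((IsNumeral 0 r ∧ IsNumeral 2 n) ∨ (IsNumeral 1 r ∧ IsNumeral 1 n))

/-- `D` is a nonempty set and `I` assigns to every symbol `r` of `L`, of arity `n` say, a set of
`n`-tuples of elements of `D`, an `n`-tuple being a function from `n` to `D`. -/
def IsStructureOn (L D I : M) : Prop :=
  (∃ x, x ∊ D) ∧
    ∃ S, IsFunOn L S ∧ IsFunOn I S ∧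
      ∀ r n R, App L r n → App I r R → ∀ t, t ∊ R → IsFun t n D

/-- `N` is an `L`-structure `⟨D, I⟩`. -/
def IsStructure (L N : M) : Prop := ∃ D I, IsOPair N D I ∧ IsStructureOn L D I

/-- `N` is an `L`-structure whose domain is an ordinal. -/
def IsOrdStructure (L N : M) : Prop :=
  ∃ D I, IsOPair N D I ∧ IsStructureOn L D I ∧ IsOrdinal D

/-! ### Formulas and satisfaction

Formulas of `L` are coded by sets, with variables `v_i` for `i ∈ ω`:
`⟨0, ⟨i, j⟩⟩` is `v_i = v_j`; `⟨1, ⟨r, t⟩⟩` is the atomic formula `r(v_{t(0)}, …, v_{t(n-1)})`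
for an `n`-ary symbol `r` and `t : n → ω`; `⟨2, ⟨φ, φ⟩⟩` is `¬ φ`; `⟨3, ⟨φ, ψ⟩⟩` is `φ ∧ ψ`;
`⟨4, ⟨i, φ⟩⟩` is `∃ v_i φ`. -/

/-- `c = ⟨k, ⟨a, b⟩⟩`. -/
def IsCode (k : ℕ) (c a b : M) : Prop := ∃ m q, IsNumeral k m ∧ IsOPair q a b ∧ IsOPair c m q

/-- `⟨r, t⟩` is an atomic formula with the symbol `r`: `t` is a function from its arity to `ω`. -/
def IsVarTuple (L r t : M) : Prop := ∃ n w, App L r n ∧ IsOmega w ∧ IsFun t n w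

/-- `X` contains the atomic formulas and is closed under the formation of formulas. -/
def FormulaClosed (L X : M) : Prop :=
  (∀ i j c, IsNat i → IsNat j → IsCode 0 c i j → c ∊ X) ∧
  (∀ r t c, IsVarTuple L r t → IsCode 1 c r t → c ∊ X) ∧
  (∀ a c, a ∊ X → IsCode 2 c a a → c ∊ X) ∧
  (∀ a b c, a ∊ X → b ∊ X → IsCode 3 c a b → c ∊ X) ∧
  (∀ i a c, IsNat i → a ∊ X → IsCode 4 c i a → c ∊ X)

/-- `φ` is (the code of) a formula of `L`. -/
def IsFormula (L φ : M) : Prop := ∀ X, FormulaClosed L X → φ ∊ X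

/-- `s` is an assignment of elements of `D` to the variables: a function from `ω` to `D`. -/
def IsAssignment (s D : M) : Prop := ∃ w, IsOmega w ∧ IsFun s w D

/-- The set `T` of pairs `⟨φ, s⟩` obeys Tarski's truth definition for the structure `⟨D, I⟩`. -/
def IsTruth (L D I T : M) : Prop :=
  ∀ s, IsAssignment s D →
    (∀ i j c, IsNat i → IsNat j → IsCode 0 c i j →
      (App T c s ↔ ∃ x, App s i x ∧ App s j x)) ∧
    (∀ r t c, IsVarTuple L r t → IsCode 1 c r t →
      (App T c s ↔ ∃ R u, App I r R ∧ u ∊ R ∧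
        ∀ k x, App u k x ↔ ∃ i, App t k i ∧ App s i x)) ∧
    (∀ a c, IsFormula L a → IsCode 2 c a a → (App T c s ↔ ¬ App T a s)) ∧
    (∀ a b c, IsFormula L a → IsFormula L b → IsCode 3 c a b →
      (App T c s ↔ App T a s ∧ App T b s)) ∧
    (∀ i a c, IsNat i → IsFormula L a → IsCode 4 c i a →
      (App T c s ↔ ∃ s', IsAssignment s' D ∧ App T a s' ∧
        ∀ k x, k ≠ i → (App s' k x ↔ App s k x)))

/-- `⟨D, I⟩ ⊨ φ[s]`. -/
def Sat (L D I φ s : M) : Prop := ∃ T, IsTruth L D I T ∧ App T φ s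

/-- `j` is an `L`-elementary embedding of `⟨D, I⟩` into `⟨D', I'⟩`. -/
def IsElementary (L D I D' I' j : M) : Prop :=
  IsFun j D D' ∧
    ∀ φ s s', IsFormula L φ → IsAssignment s D → IsAssignment s' D' →
      (∀ i x y, App s i x → App j x y → App s' i y) →
      (Sat L D I φ s ↔ Sat L D' I' φ s')

/-- There is an `L`-elementary embedding of the structure `N` into the structure `N'`. -/
def ElemEmbeds (L N N' : M) : Prop :=
  ∃ D I D' I' j, IsOPair N D I ∧ IsOPair N' D' I' ∧ IsElementary L D I D' I' j

/-- The structures `N` and `N'` have the same cardinality. -/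
def SameCardStructures (N N' : M) : Prop :=
  ∃ D I D' I', IsOPair N D I ∧ IsOPair N' D' I' ∧ SameCard D D'

/-! ### Vopěnka's Principle and `A`-extendible cardinals -/

variable (M) in
/-- Vopěnka's Principle for definable classes of structures in the language `{ε, R}`. -/
def VopenkaPrinciple : Prop :=
  ∀ L : M, IsLStd L → ∀ A : Set M, IsProperClass A → (∀ N ∈ A, IsStructure L N) →
    ∃ N ∈ A, ∃ N' ∈ A, N ≠ N' ∧ ElemEmbeds L N N'

/-- `⟨D, I⟩` is the structure `⟨V_η, ∈, A ∩ V_η⟩` in the language `L = {ε, R}`. -/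
def IsVStructure (A : Set M) (L η D I : M) : Prop :=
  IsV η D ∧ IsStructureOn L D I ∧
    (∀ r E, IsNumeral 0 r → App I r E →
      ∀ t, t ∊ E ↔ ∃ n zero one x y, IsNumeral 2 n ∧ IsFun t n D ∧
        IsNumeral 0 zero ∧ IsNumeral 1 one ∧ App t zero x ∧ App t one y ∧ x ∊ y) ∧
    (∀ r P, IsNumeral 1 r → App I r P →
      ∀ t, t ∊ P ↔ ∃ n zero x, IsNumeral 1 n ∧ IsFun t n D ∧
        IsNumeral 0 zero ∧ App t zero x ∧ x ∈ A)

/-- `α` is the critical point of `j`: the least ordinal moved by `j`. -/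
def IsCriticalPoint (j α : M) : Prop :=
  IsOrdinal α ∧ (∀ β, β ∊ α → App j β β) ∧ ∃ γ, App j α γ ∧ γ ≠ α

/-- The cardinal `α < η` is `η`-extendible for `A`: there are an ordinal `ζ` and an elementary
embedding `j : ⟨V_η, ∈, A ∩ V_η⟩ → ⟨V_ζ, ∈, A ∩ V_ζ⟩` with critical point `α` and `j(α) > η`. -/
def IsExtendibleTo (A : Set M) (η α : M) : Prop :=
  IsCardinal α ∧ IsOrdinal η ∧ α ∊ η ∧
    ∃ L ζ D I D' I' j, IsLStd L ∧ IsOrdinal ζ ∧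
      IsVStructure A L η D I ∧ IsVStructure A L ζ D' I' ∧
      IsElementary L D I D' I' j ∧ IsCriticalPoint j α ∧ ∃ γ, App j α γ ∧ η ∊ γ

/-- `α` is an `A`-extendible cardinal. -/
def IsExtendibleFor (A : Set M) (α : M) : Prop :=
  IsCardinal α ∧ ∀ η, IsOrdinal η → α ∊ η → IsExtendibleTo A η α

variable (M) in
/-- For every proper class `A` there is an `A`-extendible cardinal. -/
def ExtendiblePrinciple : Prop := ∀ A : Set M, IsProperClass A → ∃ α, IsExtendibleFor A α

/-- Every proper class of ordinal `L`-structures has two members of different cardinalities with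
an elementary embedding of the first into the second. -/
def OrdinalVopenka (L : M) : Prop :=
  ∀ A : Set M, IsProperClass A → (∀ N ∈ A, IsOrdStructure L N) →
    ∃ N ∈ A, ∃ N' ∈ A, ¬ SameCardStructures N N' ∧ ElemEmbeds L N N'

end SetModel

/-! The implications proved are 1 → 2 → 4 → 3 → 1; 4 → 3 is immediate because `{ε, R}` is a
language.

1 → 2. Suppose that no cardinal is `A`-extendible. Each ordinal `α` then has a least `η > α`, called
`extBound A α`, for which `α` is not `η`-extendible. To every ordinal `ξ` attach `⟨V_θ, ∈, P_ξ⟩`,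
where `θ` is a limit above `ξ` and above `extBound A α` for all `α ≤ ξ`, and `P_ξ` codes `ξ`, truth
in `⟨V_η, ∈, A⟩` and the map `extBound A`. Vopěnka's Principle gives an embedding `j` between two of
these structures that moves `ξ`, so it has a critical point `κ ≤ ξ`. If `κ` is closed under
`extBound A`, so is `j(κ)`; hence `η = extBound A κ` is below `j(κ)`, and `j` restricted to `V_η`
makes `κ` `η`-extendible, a contradiction. Otherwise some `α < κ` has `extBound A α ≥ κ`. That
ordinal is fixed by `j` because `α` is; it differs from `κ`, which is moved, and so lies above `κ`.
A Kunen-type argument, `ClassEmb.not_crit_mem`, excludes this: a set fixed by `j` cannot contain the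
critical point. It rests on `exists_covers`, a variant of the Erdős–Hajnal theorem on ω-Jónsson
functions.

2 → 4. Take `κ` extendible for a class coding `A`, satisfaction for `L`, and an ordinal `ξ` with `L
∈ V_ξ`. The code forces `j(ξ) = ξ`, whence `ξ < κ` and `j` fixes all formulas of `L`. For a member
of `A` with domain `D ≥ κ`, and `η` large, `j` restricts to an elementary embedding of it into its
image, again a member of `A`. Since `D < η < j(κ) ≤ j(D)` and no smaller ordinal maps onto `j(κ)`,
the cardinalities differ.

3 → 1. Without definable global choice a structure cannot be replaced by one chosen copy on an
ordinal, so all such copies of all members of the class are used. If they form a proper class, 3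
applies to it; if they form a set, two distinct members have the same copies and are isomorphic.

Two devices keep this elementary. Comprehension and replacement need definability over `M`, which
instance search supplies (`Dfn`, `DTm` and the classes after them). And the predicate `R` codes
several classes at once by tagged pairs, each evaluated in all of `M` and not in `V_θ`; an embedding
therefore respects notions such as "function", `V_β` or satisfaction with no absoluteness argument,
and only a handful of explicit formulas is ever evaluated in the structures (`IsElementary.emb`). -/

namespace SetModel

variable {M : Type u} [LSet.Structure M]

set_option linter.unusedVariables false
set_option linter.unusedSectionVars false

/-! ### Definability by instance search -/

/-- `P` is a definable predicate of finitely many of the variables `v 0, v 1, …`. -/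
class Dfn (P : (ℕ → M) → Prop) : Prop where
  out : (Set.univ : Set M).Definable LSet {v | P v}

/-- `t` is a definable function of the variables. -/
class DTm (t : (ℕ → M) → M) : Prop where
  out : Dfn fun v => v 0 = t (fun i => v (i + 1))

theorem Dfn.congr {P Q : (ℕ → M) → Prop} (h : Dfn P) (e : ∀ v, P v ↔ Q v) : Dfn Q := by
  have : P = Q := funext fun v => propext (e v)
  exact this ▸ h

theorem Dfn.reindex {P : (ℕ → M) → Prop} (h : Dfn P) (σ : ℕ → ℕ) :
    Dfn fun v => P (fun i => v (σ i)) :=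
  ⟨h.out.preimage_comp σ⟩

/-- Variables follow the de Bruijn convention: under a binder the bound variable is `v 0` and the
old `v i` is `v (i + 1)`. The instances for binding operators below all take their hypotheses in
this shape. -/
theorem dfn_ex {P : (ℕ → M) → M → Prop} (h : Dfn fun v => P (fun i => v (i + 1)) (v 0)) :
    Dfn fun v => ∃ x, P v x := by
  obtain ⟨φ, hφ⟩ := h.out
  refine ⟨⟨(FirstOrder.Language.BoundedFormula.relabel (n := 1)
    (fun i : ℕ => Nat.casesOn i (Sum.inr 0) Sum.inl : ℕ → ℕ ⊕ Fin 1) φ).ex, ?_⟩⟩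
  ext v
  have key : ∀ w : ℕ → M, P (fun i => w (i + 1)) (w 0) ↔ φ.Realize w := fun w => by
    have := Set.ext_iff.1 hφ w
    exact this
  simp only [Set.mem_ofPred_eq, FirstOrder.Language.Formula.Realize,
    FirstOrder.Language.BoundedFormula.realize_ex,
    FirstOrder.Language.BoundedFormula.realize_relabel]
  refine exists_congr fun x => ?_
  have h2 := key (fun i => Nat.casesOn i x v)
  refine Iff.trans h2 ?_
  unfold FirstOrder.Language.Formula.Realize
  refine iff_of_eq ?_
  congr 1
  · funext i
    cases i with
    | zero => rfl
    | succ i => rfl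
  · funext i; exact i.elim0

instance dfn_not {P : (ℕ → M) → Prop} [h : Dfn P] : Dfn fun v => ¬ P v := ⟨h.out.compl⟩
instance dfn_and {P Q : (ℕ → M) → Prop} [h : Dfn P] [h' : Dfn Q] : Dfn fun v => P v ∧ Q v :=
  ⟨h.out.inter h'.out⟩
instance dfn_or {P Q : (ℕ → M) → Prop} [h : Dfn P] [h' : Dfn Q] : Dfn fun v => P v ∨ Q v :=
  ⟨h.out.union h'.out⟩
instance dfn_imp {P Q : (ℕ → M) → Prop} [h : Dfn P] [h' : Dfn Q] : Dfn fun v => P v → Q v :=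
  (inferInstance : Dfn fun v => ¬ P v ∨ Q v).congr fun _ => imp_iff_not_or.symm
instance dfn_iff {P Q : (ℕ → M) → Prop} [h : Dfn P] [h' : Dfn Q] : Dfn fun v => P v ↔ Q v :=
  (inferInstance : Dfn fun v => (P v → Q v) ∧ (Q v → P v)).congr fun _ => iff_iff_implies_and_implies.symm
instance dfn_const {p : Prop} : Dfn (M := M) fun _ => p := by
  by_cases hp : p
  · exact ⟨by simp [hp]⟩
  · exact ⟨by simp [hp]⟩
instance dfn_exists {P : (ℕ → M) → M → Prop} [h : Dfn fun v => P (fun i => v (i + 1)) (v 0)] :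
    Dfn fun v => ∃ x, P v x := dfn_ex h
instance dfn_forall {P : (ℕ → M) → M → Prop} [h : Dfn fun v => P (fun i => v (i + 1)) (v 0)] :
    Dfn fun v => ∀ x, P v x :=
  (inferInstance : Dfn fun v => ¬ ∃ x, ¬ P v x).congr fun _ => by push Not; rfl

theorem dfn_var_eq (i j : ℕ) : Dfn fun v : ℕ → M => v i = v j :=
  ⟨⟨FirstOrder.Language.Term.equal (FirstOrder.Language.Term.var i)
    (FirstOrder.Language.Term.var j), by ext v; simp [FirstOrder.Language.Formula.Realize, FirstOrder.Language.Term.equal]⟩⟩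

theorem dfn_var_mem (i j : ℕ) : Dfn fun v : ℕ → M => v i ∊ v j :=
  ⟨by
    refine Set.Definable.mono (A := ∅) (Set.empty_definable_iff.2 ?_) (Set.empty_subset _)
    refine ⟨FirstOrder.Language.Relations.formula₂ (L := LSet) SetRel.mem
      (FirstOrder.Language.Term.var i) (FirstOrder.Language.Term.var j), ?_⟩
    ext v
    exact (FirstOrder.Language.Formula.realize_rel₂ (L := LSet) (M := M) (R := SetRel.mem)
      (v := v) (t₁ := FirstOrder.Language.Term.var i) (t₂ := FirstOrder.Language.Term.var j)).symm⟩

instance dtm_var (i : ℕ) : DTm fun v : ℕ → M => v i := ⟨dfn_var_eq 0 (i + 1)⟩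

instance dtm_const (c : M) : DTm fun _ : ℕ → M => c :=
  ⟨⟨⟨FirstOrder.Language.Term.equal (FirstOrder.Language.Term.var 0)
    (FirstOrder.Language.Constants.term (LSet.con (⟨c, trivial⟩ : (Set.univ : Set M)))), by
      ext v; simp [FirstOrder.Language.Formula.Realize, FirstOrder.Language.Term.equal]⟩⟩⟩

/-- `LSet` has no function symbols, so a definable term is substituted by means of a quantifier. -/
theorem dfn_bind {P : (ℕ → M) → M → Prop} {a : (ℕ → M) → M} [ha : DTm a]
    (h : Dfn fun v => P (fun i => v (i + 1)) (v 0)) : Dfn fun v => P v (a v) :=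
  have := ha.out
  (dfn_ex (P := fun v x => x = a v ∧ P v x) dfn_and).congr fun v => by simp

/-- Definability of predicates and functions of a fixed number of variables. -/
class DP1 (P : M → Prop) : Prop where out : Dfn fun v => P (v 0)
class DP2 (P : M → M → Prop) : Prop where out : Dfn fun v => P (v 0) (v 1)
class DP3 (P : M → M → M → Prop) : Prop where out : Dfn fun v => P (v 0) (v 1) (v 2)
class DP4 (P : M → M → M → M → Prop) : Prop where out : Dfn fun v => P (v 0) (v 1) (v 2) (v 3)
class DP5 (P : M → M → M → M → M → Prop) : Prop where
  out : Dfn fun v => P (v 0) (v 1) (v 2) (v 3) (v 4)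
class DP6 (P : M → M → M → M → M → M → Prop) : Prop where
  out : Dfn fun v => P (v 0) (v 1) (v 2) (v 3) (v 4) (v 5)
class DF1 (F : M → M) : Prop where out : DTm fun v => F (v 0)
class DF2 (F : M → M → M) : Prop where out : DTm fun v => F (v 0) (v 1)
class DF3 (F : M → M → M → M) : Prop where out : DTm fun v => F (v 0) (v 1) (v 2)

section
variable {a b c d e f : (ℕ → M) → M} [ha : DTm a] [hb : DTm b] [hc : DTm c] [hd : DTm d]
  [he : DTm e] [hf : DTm f]

theorem DTm.shift {a : (ℕ → M) → M} (h : DTm a) (σ : ℕ → ℕ) : DTm fun v => a (fun i => v (σ i)) :=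
  ⟨(h.out.reindex fun i => Nat.casesOn i 0 (fun k => σ k + 1)).congr fun _ => Iff.rfl⟩

instance dp1_app {P : M → Prop} [h : DP1 P] : Dfn fun v => P (a v) :=
  dfn_bind (P := fun _ x => P x) h.out
-- Here and for higher arities the arguments are bound one at a time. Each binding shifts the
-- remaining ones by one, and the final `reindex` restores their order.
instance dp2_app {P : M → M → Prop} [h : DP2 P] : Dfn fun v => P (a v) (b v) :=
  dfn_bind (P := fun v x => P x (b v))
    (have := hb.shift (· + 1)
     dfn_bind (P := fun v y => P (v 0) y) (h.out.reindex fun i => Nat.casesOn i 1 (fun _ => 0)))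
instance dp3_app {P : M → M → M → Prop} [h : DP3 P] : Dfn fun v => P (a v) (b v) (c v) :=
  dfn_bind (P := fun v x => P x (b v) (c v))
    (have := hb.shift (· + 1)
     have := hc.shift (· + 1)
     have : DP2 fun y z : M => P y z z := ⟨h.out.reindex fun i => match i with | 0 => 0 | 1 => 1 | _ => 1⟩
     dfn_bind (P := fun v y => P (v 0) y (c fun i => v (i + 1)))
       (have := hc.shift (· + 2)
        dfn_bind (P := fun v z => P (v 1) (v 0) z)
          (h.out.reindex fun i => match i with | 0 => 2 | 1 => 1 | _ => 0)))
instance dp4_app {P : M → M → M → M → Prop} [h : DP4 P] :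
    Dfn fun v => P (a v) (b v) (c v) (d v) :=
  dfn_bind (P := fun v x => P x (b v) (c v) (d v))
    (have := hb.shift (· + 1)
     have := hc.shift (· + 1)
     have := hd.shift (· + 1)
     have := hc.shift (· + 2)
     have := hd.shift (· + 2)
     have := hd.shift (· + 3)
     dfn_bind (P := fun v y => P (v 0) y (c fun i => v (i + 1)) (d fun i => v (i + 1)))
      (dfn_bind (P := fun v z => P (v 1) (v 0) z (d fun i => v (i + 2)))
        (dfn_bind (P := fun v z => P (v 2) (v 1) (v 0) z)
          (h.out.reindex fun i => match i with | 0 => 3 | 1 => 2 | 2 => 1 | _ => 0))))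
instance dp5_app {P : M → M → M → M → M → Prop} [h : DP5 P] :
    Dfn fun v => P (a v) (b v) (c v) (d v) (e v) :=
  dfn_bind (P := fun v x => P (a v) (b v) (c v) (d v) x)
    (have : DP4 fun (_ _ _ _ : M) => True := ⟨dfn_const⟩
     have := ha.shift (· + 1)
     have := hb.shift (· + 1)
     have := hc.shift (· + 1)
     have := hd.shift (· + 1)
     have := hb.shift (· + 2)
     have := hc.shift (· + 2)
     have := hd.shift (· + 2)
     have := hc.shift (· + 3)
     have := hd.shift (· + 3)
     have := hd.shift (· + 4)
     dfn_bind (P := fun v x => P x (b fun i => v (i + 1)) (c fun i => v (i + 1)) (d fun i => v (i + 1)) (v 0))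
      (dfn_bind (P := fun v y => P (v 0) y (c fun i => v (i + 2)) (d fun i => v (i + 2)) (v 1))
       (dfn_bind (P := fun v z => P (v 1) (v 0) z (d fun i => v (i + 3)) (v 2))
        (dfn_bind (P := fun v z => P (v 2) (v 1) (v 0) z (v 3))
          (h.out.reindex fun i => match i with | 0 => 3 | 1 => 2 | 2 => 1 | 3 => 0 | _ => 4)))))
instance dp6_app {P : M → M → M → M → M → M → Prop} [h : DP6 P] :
    Dfn fun v => P (a v) (b v) (c v) (d v) (e v) (f v) :=
  dfn_bind (P := fun v x => P (a v) (b v) (c v) (d v) (e v) x)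
    (have := ha.shift (· + 1)
     have := hb.shift (· + 1)
     have := hc.shift (· + 1)
     have := hd.shift (· + 1)
     have := he.shift (· + 1)
     have := ha.shift (· + 2)
     have := hb.shift (· + 2)
     have := hc.shift (· + 2)
     have := hd.shift (· + 2)
     have := hb.shift (· + 3)
     have := hc.shift (· + 3)
     have := hd.shift (· + 3)
     have := hc.shift (· + 4)
     have := hd.shift (· + 4)
     have := hd.shift (· + 5)
     dfn_bind (P := fun v x => P (a fun i => v (i + 1)) (b fun i => v (i + 1)) (c fun i => v (i + 1)) (d fun i => v (i + 1)) x (v 0))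
     (dfn_bind (P := fun v x => P x (b fun i => v (i + 2)) (c fun i => v (i + 2)) (d fun i => v (i + 2)) (v 0) (v 1))
      (dfn_bind (P := fun v y => P (v 0) y (c fun i => v (i + 3)) (d fun i => v (i + 3)) (v 1) (v 2))
       (dfn_bind (P := fun v z => P (v 1) (v 0) z (d fun i => v (i + 4)) (v 2) (v 3))
        (dfn_bind (P := fun v z => P (v 2) (v 1) (v 0) z (v 3) (v 4))
          (h.out.reindex fun i => match i with
            | 0 => 3 | 1 => 2 | 2 => 1 | 3 => 0 | 4 => 4 | _ => 5))))))

instance dp_mem : DP2 (Mem : M → M → Prop) := ⟨dfn_var_mem 0 1⟩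
instance dp_ne : DP2 (Ne : M → M → Prop) := ⟨(Dfn.congr (@dfn_not _ _ _ ⟨(dfn_var_eq 0 1).out⟩) fun _ => Iff.rfl)⟩
instance dp_eq : DP2 (Eq : M → M → Prop) := ⟨dfn_var_eq 0 1⟩

instance df1_app {F : M → M} [h : DF1 F] : DTm fun v => F (a v) :=
  ⟨have := ha.shift (· + 1)
   have : DP2 fun x y => y = F x := ⟨h.out.out.reindex fun i => Nat.casesOn i 1 fun _ => 0⟩
   dp2_app (P := fun x y => y = F x) (a := fun v => a fun i => v (i + 1)) (b := fun v => v 0)⟩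
instance df2_app {F : M → M → M} [h : DF2 F] : DTm fun v => F (a v) (b v) :=
  ⟨have := ha.shift (· + 1)
   have := hb.shift (· + 1)
   have : DP3 fun x y z => z = F x y :=
     ⟨h.out.out.reindex fun i => match i with | 0 => 2 | 1 => 0 | _ => 1⟩
   dp3_app (P := fun x y z => z = F x y) (a := fun v => a fun i => v (i + 1))
    (b := fun v => b fun i => v (i + 1)) (c := fun v => v 0)⟩
instance df3_app {F : M → M → M → M} [h : DF3 F] : DTm fun v => F (a v) (b v) (c v) :=
  ⟨have := ha.shift (· + 1)
   have := hb.shift (· + 1)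
   have := hc.shift (· + 1)
   have : DP4 fun x y z w => w = F x y z :=
     ⟨h.out.out.reindex fun i => match i with | 0 => 3 | 1 => 0 | 2 => 1 | _ => 2⟩
   dp4_app (P := fun x y z w => w = F x y z) (a := fun v => a fun i => v (i + 1))
    (b := fun v => b fun i => v (i + 1)) (c := fun v => c fun i => v (i + 1)) (d := fun v => v 0)⟩
end

class DSet (A : Set M) : Prop where out : DP1 fun x => x ∈ A

instance dset_app {A : Set M} [h : DSet A] {a : (ℕ → M) → M} [DTm a] : Dfn fun v => a v ∈ A :=
  have := h.out
  dp1_app (P := fun x => x ∈ A)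

instance dset_setOf {P : M → Prop} [h : DP1 P] : DSet {x | P x} := ⟨h⟩

theorem dset_iff {A : Set M} : DSet A ↔ IsClass A := by
  constructor
  · intro h
    have := h.out.out.out.preimage_comp (fun _ : ℕ => (0 : Fin 1))
    exact this
  · intro h
    refine ⟨⟨⟨?_⟩⟩⟩
    have := Set.Definable.preimage_comp (fun i : Fin 1 => (i : ℕ)) h
    exact this

theorem isClassRel_of_dp2 {R : M → M → Prop} [h : DP2 R] : IsClassRel {p : M × M | R p.1 p.2} := by
  have := h.out.out.preimage_comp (fun i : ℕ => (match i with | 0 => 0 | _ => 1 : Fin 2))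
  exact this

instance dfn_unique {P : (ℕ → M) → M → Prop} [h : Dfn fun v => P (fun i => v (i + 1)) (v 0)] :
    Dfn fun v => ∃! x, P v x :=
  have : Dfn fun v : ℕ → M => P (fun i => v (i + 2)) (v 0) :=
    (h.reindex fun i => Nat.casesOn i 0 fun k => k + 2).congr fun _ => Iff.rfl
  (inferInstance : Dfn fun v => ∃ x, P v x ∧ ∀ y, P v y → y = x).congr fun _ => Iff.rfl

/-! ### Definability of the basic notions -/

instance : DP1 (IsEmptySet : M → Prop) := ⟨by unfold IsEmptySet; infer_instance⟩
instance : DP2 (IsSubset : M → M → Prop) := ⟨by unfold IsSubset; infer_instance⟩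
instance : DP2 (IsSucc : M → M → Prop) := ⟨by unfold IsSucc; infer_instance⟩
instance : DP3 (IsUPair : M → M → M → Prop) := ⟨by unfold IsUPair; infer_instance⟩
instance : DP3 (IsOPair : M → M → M → Prop) := ⟨by unfold IsOPair; infer_instance⟩
instance : DP1 (IsInductive : M → Prop) := ⟨by unfold IsInductive; infer_instance⟩
instance : DP3 (App : M → M → M → Prop) := ⟨by unfold App; infer_instance⟩
instance : DP2 (IsFunOn : M → M → Prop) := ⟨by unfold IsFunOn; infer_instance⟩
instance : DP3 (IsFun : M → M → M → Prop) := ⟨by unfold IsFun; infer_instance⟩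
instance : DP3 (IsBijection : M → M → M → Prop) := ⟨by unfold IsBijection; infer_instance⟩
instance : DP2 (SameCard : M → M → Prop) := ⟨by unfold SameCard; infer_instance⟩
instance : DP1 (IsTransitiveSet : M → Prop) := ⟨by unfold IsTransitiveSet; infer_instance⟩
instance : DP1 (IsOrdinal : M → Prop) := ⟨by unfold IsOrdinal; infer_instance⟩
instance : DP1 (IsCardinal : M → Prop) := ⟨by unfold IsCardinal; infer_instance⟩
instance : DP1 (IsNat : M → Prop) := ⟨by unfold IsNat; infer_instance⟩
instance : DP1 (IsOmega : M → Prop) := ⟨by unfold IsOmega; infer_instance⟩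
instance dp_numeral (k : ℕ) : DP1 (IsNumeral k : M → Prop) := by
  induction k with
  | zero => exact ⟨by unfold IsNumeral; infer_instance⟩
  | succ k ih => exact ⟨by unfold IsNumeral; infer_instance⟩
instance : DP2 (IsV : M → M → Prop) := ⟨by unfold IsV; infer_instance⟩
instance : DP1 (IsLanguage : M → Prop) := ⟨by unfold IsLanguage; infer_instance⟩
instance : DP1 (IsLStd : M → Prop) := ⟨by unfold IsLStd; infer_instance⟩
instance : DP3 (IsStructureOn : M → M → M → Prop) := ⟨by unfold IsStructureOn; infer_instance⟩
instance : DP2 (IsStructure : M → M → Prop) := ⟨by unfold IsStructure; infer_instance⟩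
instance : DP2 (IsOrdStructure : M → M → Prop) := ⟨by unfold IsOrdStructure; infer_instance⟩
instance (k : ℕ) : DP3 (IsCode k : M → M → M → Prop) := ⟨by unfold IsCode; infer_instance⟩
instance : DP3 (IsVarTuple : M → M → M → Prop) := ⟨by unfold IsVarTuple; infer_instance⟩
instance : DP2 (FormulaClosed : M → M → Prop) := ⟨by unfold FormulaClosed; infer_instance⟩
instance : DP2 (IsFormula : M → M → Prop) := ⟨by unfold IsFormula; infer_instance⟩
instance : DP2 (IsAssignment : M → M → Prop) := ⟨by unfold IsAssignment; infer_instance⟩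
set_option synthInstance.maxHeartbeats 400000 in
set_option synthInstance.maxSize 1000 in
instance : DP4 (IsTruth : M → M → M → M → Prop) := ⟨by unfold IsTruth; infer_instance⟩
instance : DP5 (Sat : M → M → M → M → M → Prop) := ⟨by unfold Sat; infer_instance⟩
instance : DP6 (IsElementary : M → M → M → M → M → M → Prop) :=
  ⟨by unfold IsElementary; infer_instance⟩
instance : DP3 (ElemEmbeds : M → M → M → Prop) := ⟨by unfold ElemEmbeds; infer_instance⟩
instance : DP2 (SameCardStructures : M → M → Prop) := ⟨by unfold SameCardStructures; infer_instance⟩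
instance (A : Set M) [DSet A] : DP4 (IsVStructure A : M → M → M → M → Prop) :=
  ⟨by unfold IsVStructure; infer_instance⟩
instance : DP2 (IsCriticalPoint : M → M → Prop) := ⟨by unfold IsCriticalPoint; infer_instance⟩
instance (A : Set M) [DSet A] : DP2 (IsExtendibleTo A : M → M → Prop) :=
  ⟨by unfold IsExtendibleTo; infer_instance⟩

theorem IsModelZFC.nonempty (h : IsModelZFC M) : Nonempty M := let ⟨X, _⟩ := h.infinity; ⟨X⟩

variable [hZ : Fact (IsModelZFC M)]

theorem ext {x y : M} (h : ∀ z, z ∊ x ↔ z ∊ y) : x = y := hZ.out.extensionality x y h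

/-! ### Sets given by comprehension -/

def IsSetP (P : M → Prop) : Prop := ∃ y, ∀ z, z ∊ y ↔ P z

variable (M) in
noncomputable def dflt : M := Classical.choice hZ.out.nonempty

open Classical in
/-- The set `{z | P z}`, if there is one. -/
noncomputable def mk (P : M → Prop) : M := if h : IsSetP P then h.choose else dflt M

theorem mem_mk {P : M → Prop} (h : IsSetP P) {z : M} : z ∊ mk P ↔ P z := by
  unfold mk
  rw [dif_pos h]
  exact h.choose_spec z

theorem eq_mk {P : M → Prop} {x : M} (h : ∀ z, z ∊ x ↔ P z) : x = mk P :=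
  ext fun z => (h z).trans (mem_mk ⟨x, h⟩).symm

/-- Expresses the graph of `mk`, default value included, in first-order terms; this makes `mk` a
definable operation in `dtm_mk`. -/
theorem eq_mk_iff {P : M → Prop} {u : M} :
    u = mk P ↔ (∀ z, z ∊ u ↔ P z) ∨ ¬ (∃ y, ∀ z, z ∊ y ↔ P z) ∧ u = dflt M := by
  by_cases h : IsSetP P
  · constructor
    · rintro rfl
      exact Or.inl fun z => mem_mk h
    · rintro (h' | ⟨h', -⟩)
      · exact eq_mk h'
      · exact absurd h h'
  · constructor
    · intro e
      unfold mk at e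
      rw [dif_neg h] at e
      exact Or.inr ⟨h, e⟩
    · rintro (h' | ⟨-, e⟩)
      · exact absurd ⟨u, h'⟩ h
      · unfold mk
        rw [dif_neg h, e]

instance dtm_mk {P : (ℕ → M) → M → Prop} [h : Dfn fun v => P (fun i => v (i + 1)) (v 0)] :
    DTm fun v => mk (P v) :=
  ⟨by
    have h1 : Dfn fun v : ℕ → M => P (fun i => v (i + 2)) (v 0) :=
      (h.reindex fun i => Nat.casesOn i 0 fun k => k + 2).congr fun _ => Iff.rfl
    have h2 : Dfn fun v : ℕ → M => P (fun i => v (i + 3)) (v 0) :=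
      (h.reindex fun i => Nat.casesOn i 0 fun k => k + 3).congr fun _ => Iff.rfl
    clear h
    have e1 : Dfn fun v : ℕ → M => ∀ z, z ∊ v 0 ↔ P (fun i => v (i + 1)) z := inferInstance
    have e2 : Dfn fun v : ℕ → M => ∃ y, ∀ z, z ∊ y ↔ P (fun i => v (i + 1)) z := inferInstance
    clear h1 h2
    exact Dfn.congr (P := fun v : ℕ → M => (∀ z, z ∊ v 0 ↔ P (fun i => v (i + 1)) z) ∨
      ¬ (∃ y, ∀ z, z ∊ y ↔ P (fun i => v (i + 1)) z) ∧ v 0 = dflt M) inferInstance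
      fun v => eq_mk_iff.symm⟩

open Classical in
instance dtm_ite {P : (ℕ → M) → Prop} {a b : (ℕ → M) → M} [h : Dfn P] [ha : DTm a] [hb : DTm b] :
    DTm fun v => if P v then a v else b v :=
  ⟨by
    have := ha.shift (· + 1)
    have := hb.shift (· + 1)
    have := h.reindex (· + 1)
    refine Dfn.congr (P := fun v : ℕ → M => (P (fun i => v (i + 1)) ∧ v 0 = a (fun i => v (i + 1))) ∨
      (¬ P (fun i => v (i + 1)) ∧ v 0 = b (fun i => v (i + 1)))) inferInstance fun v => ?_
    split_ifs with h <;> simp [h]⟩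

theorem isSetP_of_subset (P : M → Prop) [h : Dfn fun v : ℕ → M => P (v 0)] {a : M}
    (ha : ∀ z, P z → z ∊ a) : IsSetP P := by
  obtain ⟨y, hy⟩ := hZ.out.separation {z | P z} (dset_iff.1 ⟨⟨h⟩⟩) a
  exact ⟨y, fun z => (hy z).trans ⟨fun h => h.2, fun h => ⟨ha z h, h⟩⟩⟩

theorem isSetP_image {F : M → M} [h : DTm fun v : ℕ → M => F (v 0)] (a : M) :
    IsSetP fun z => ∃ x, x ∊ a ∧ z = F x := by
  have : DF1 F := ⟨h⟩
  have : DP2 fun x y => y = F x := ⟨inferInstance⟩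
  obtain ⟨y, hy⟩ := hZ.out.replacement {p | p.2 = F p.1}
    (isClassRel_of_dp2 (R := fun x y => y = F x)) a
    fun x _ => ⟨F x, rfl, fun _ h => h⟩
  exact ⟨y, hy⟩

/-- A definable class that injects definably into a set is a set. -/
theorem isSetP_of_inj (P : M → Prop) (H : M → M) [h : Dfn fun v : ℕ → M => P (v 0)]
    [h' : DTm fun v : ℕ → M => H (v 0)] {b : M}
    (hb : ∀ x, P x → H x ∊ b) (hi : ∀ x y, P x → P y → H x = H y → x = y) : IsSetP P := by
  have : DP1 P := ⟨h⟩
  have : DF1 H := ⟨h'⟩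
  obtain ⟨b', hb'⟩ := isSetP_of_subset (fun y => ∃ x, P x ∧ y = H x) (a := b)
    (by rintro _ ⟨x, hx, rfl⟩; exact hb x hx)
  have : DP2 fun y x => P x ∧ y = H x := ⟨inferInstance⟩
  obtain ⟨c, hc⟩ := hZ.out.replacement {p | P p.2 ∧ p.1 = H p.2}
    (isClassRel_of_dp2 (R := fun y x => P x ∧ y = H x)) b' (by
    intro y hy
    obtain ⟨x, hx, rfl⟩ := (hb' y).1 hy
    exact ⟨x, ⟨hx, rfl⟩, fun z hz => hi _ _ hz.1 hx hz.2.symm⟩)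
  refine ⟨c, fun z => (hc z).trans ⟨?_, fun hz => ⟨H z, (hb' _).2 ⟨z, hz, rfl⟩, hz, rfl⟩⟩⟩
  rintro ⟨a, -, h, -⟩
  exact h

/-! ### Elementary operations on sets -/

noncomputable def upair (x y : M) : M := mk fun z => z = x ∨ z = y
noncomputable def sing (x : M) : M := upair x x
noncomputable def pr (x y : M) : M := upair (sing x) (upair x y)
noncomputable def sU (x : M) : M := mk fun z => ∃ y, y ∊ x ∧ z ∊ y
noncomputable def pow (x : M) : M := mk fun z => IsSubset z x
noncomputable def un (x y : M) : M := mk fun z => z ∊ x ∨ z ∊ y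
variable (M) in
noncomputable def emp : M := mk fun _ => False
noncomputable def sc (x : M) : M := mk fun z => z ∊ x ∨ z = x
noncomputable def sep (a : M) (P : M → Prop) : M := mk fun z => z ∊ a ∧ P z
noncomputable def img (F : M → M) (a : M) : M := mk fun z => ∃ x, x ∊ a ∧ z = F x
noncomputable def lam (a : M) (F : M → M) : M := img (fun x => pr x (F x)) a
noncomputable def prod (a b : M) : M := mk fun z => ∃ x y, x ∊ a ∧ y ∊ b ∧ z = pr x y
noncomputable def ap (f x : M) : M := mk fun z => ∃ y, pr x y ∊ f ∧ z ∊ y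
noncomputable def ran (f : M) : M := mk fun y => ∃ x, pr x y ∊ f
noncomputable def dom (f : M) : M := mk fun x => ∃ y, pr x y ∊ f
noncomputable def funs (a b : M) : M := mk fun f => IsFun f a b
variable (M) in
noncomputable def om : M := mk fun n => IsNat n

instance : DF2 (upair : M → M → M) := ⟨by unfold upair; infer_instance⟩
instance : DF1 (sing : M → M) := ⟨by unfold sing; infer_instance⟩
instance : DF2 (pr : M → M → M) := ⟨by unfold pr; infer_instance⟩
instance : DF1 (sU : M → M) := ⟨by unfold sU; infer_instance⟩
instance : DF1 (pow : M → M) := ⟨by unfold pow; infer_instance⟩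
instance : DF2 (un : M → M → M) := ⟨by unfold un; infer_instance⟩
instance : DF1 (sc : M → M) := ⟨by unfold sc; infer_instance⟩
instance : DF2 (prod : M → M → M) := ⟨by unfold prod; infer_instance⟩
instance : DF2 (ap : M → M → M) := ⟨by unfold ap; infer_instance⟩
instance : DF1 (ran : M → M) := ⟨by unfold ran; infer_instance⟩
instance : DF1 (dom : M → M) := ⟨by unfold dom; infer_instance⟩
instance : DF2 (funs : M → M → M) := ⟨by unfold funs; infer_instance⟩

instance dtm_sep {P : (ℕ → M) → M → Prop} {a : (ℕ → M) → M}
    [h : Dfn fun v => P (fun i => v (i + 1)) (v 0)] [ha : DTm a] :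
    DTm fun v => sep (a v) (P v) := by
  have := ha.shift (· + 1)
  unfold sep
  infer_instance
instance dtm_img {F : (ℕ → M) → M → M} {a : (ℕ → M) → M}
    [h : DTm fun v => F (fun i => v (i + 1)) (v 0)] [ha : DTm a] :
    DTm fun v => img (F v) (a v) := by
  have := ha.shift (· + 2)
  have : DTm fun v : ℕ → M => F (fun i => v (i + 2)) (v 0) :=
    h.shift fun i => Nat.casesOn i 0 fun k => k + 2
  unfold img
  infer_instance
instance dtm_lam {F : (ℕ → M) → M → M} {a : (ℕ → M) → M}
    [h : DTm fun v => F (fun i => v (i + 1)) (v 0)] [ha : DTm a] :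
    DTm fun v => lam (a v) (F v) := by
  unfold lam
  infer_instance

@[simp] theorem mem_upair {x y z : M} : z ∊ upair x y ↔ z = x ∨ z = y :=
  mem_mk (hZ.out.pairing x y)
@[simp] theorem mem_sing {x z : M} : z ∊ sing x ↔ z = x := by simp [sing]
@[simp] theorem mem_sU {x z : M} : z ∊ sU x ↔ ∃ y, y ∊ x ∧ z ∊ y := mem_mk (hZ.out.union x)
@[simp] theorem mem_pow {x z : M} : z ∊ pow x ↔ IsSubset z x := mem_mk (hZ.out.powerset x)
@[simp] theorem mem_un {x y z : M} : z ∊ un x y ↔ z ∊ x ∨ z ∊ y :=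
  mem_mk ⟨sU (upair x y), fun z => by simp⟩
@[simp] theorem not_mem_emp {z : M} : ¬ z ∊ emp M := fun h =>
  (mem_mk (isSetP_of_subset (fun _ : M => False) (a := dflt M) fun _ h => h.elim)).1 h
@[simp] theorem mem_sc {x z : M} : z ∊ sc x ↔ z ∊ x ∨ z = x :=
  mem_mk ⟨un x (sing x), fun z => by simp⟩
theorem mem_sep {a : M} {P : M → Prop} [h : Dfn fun v : ℕ → M => P (v 0)] {z : M} :
    z ∊ sep a P ↔ z ∊ a ∧ P z :=
  have : DP1 P := ⟨h⟩
  mem_mk (isSetP_of_subset (fun z => z ∊ a ∧ P z) fun _ h => h.1)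
theorem mem_img {a : M} {F : M → M} [h : DTm fun v : ℕ → M => F (v 0)] {z : M} :
    z ∊ img F a ↔ ∃ x, x ∊ a ∧ z = F x := mem_mk (isSetP_image a)

theorem eq_emp_iff {x : M} : x = emp M ↔ ∀ z, ¬ z ∊ x :=
  ⟨fun h z => h ▸ not_mem_emp, fun h => ext fun z => by simp [h z]⟩
theorem ne_emp_iff {x : M} : x ≠ emp M ↔ ∃ z, z ∊ x := by simp [eq_emp_iff]

@[simp] theorem isEmptySet_iff {x : M} : IsEmptySet x ↔ x = emp M := eq_emp_iff.symm
@[simp] theorem isSucc_iff {s x : M} : IsSucc s x ↔ s = sc x :=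
  ⟨fun h => ext fun z => (h z).trans mem_sc.symm, fun h z => h ▸ mem_sc⟩
@[simp] theorem isUPair_iff {p x y : M} : IsUPair p x y ↔ p = upair x y :=
  ⟨fun h => ext fun z => (h z).trans mem_upair.symm, fun h z => h ▸ mem_upair⟩
@[simp] theorem isOPair_iff {p x y : M} : IsOPair p x y ↔ p = pr x y := by
  simp [IsOPair, pr, sing]
theorem app_iff {f x y : M} : App f x y ↔ pr x y ∊ f := by simp [App]

theorem sing_inj {x y : M} : sing x = sing y ↔ x = y :=
  ⟨fun h => mem_sing.1 (h ▸ mem_sing.2 rfl), fun h => h ▸ rfl⟩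

@[simp] theorem pr_inj {x y x' y' : M} : pr x y = pr x' y' ↔ x = x' ∧ y = y' := by
  refine ⟨fun h => ?_, fun h => by rw [h.1, h.2]⟩
  have hx : x = x' := by
    have h1 : sing x ∊ pr x' y' := h ▸ mem_upair.2 (Or.inl rfl)
    rcases mem_upair.1 h1 with h1 | h1
    · exact sing_inj.1 h1
    · exact (mem_sing.1 (h1.symm ▸ mem_upair.2 (Or.inl rfl) : x' ∊ sing x)).symm
  subst hx
  refine ⟨rfl, ?_⟩
  have h1 : upair x y ∊ pr x y' := h ▸ mem_upair.2 (Or.inr rfl)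
  have h2 : upair x y' ∊ pr x y := h ▸ mem_upair.2 (Or.inr rfl)
  have hy : y = x ∨ y = y' := by
    rcases mem_upair.1 h1 with h1 | h1
    · exact Or.inl (mem_sing.1 (h1 ▸ mem_upair.2 (Or.inr rfl)))
    · exact mem_upair.1 (h1 ▸ mem_upair.2 (Or.inr rfl))
  have hy' : y' = x ∨ y' = y := by
    rcases mem_upair.1 h2 with h1 | h1
    · exact Or.inl (mem_sing.1 (h1 ▸ mem_upair.2 (Or.inr rfl)))
    · exact mem_upair.1 (h1 ▸ mem_upair.2 (Or.inr rfl))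
  rcases hy with rfl | rfl
  · rcases hy' with rfl | rfl <;> rfl
  · rfl

@[simp] theorem mem_prod {a b z : M} : z ∊ prod a b ↔ ∃ x y, x ∊ a ∧ y ∊ b ∧ z = pr x y :=
  mem_mk ⟨sU (img (fun x => img (pr x) b) a), fun z => by
    simp only [mem_sU, mem_img]
    constructor
    · rintro ⟨_, ⟨x, hx, rfl⟩, h⟩
      obtain ⟨y, hy, rfl⟩ := mem_img.1 h
      exact ⟨x, y, hx, hy, rfl⟩
    · rintro ⟨x, y, hx, hy, rfl⟩
      exact ⟨_, ⟨x, hx, rfl⟩, mem_img.2 ⟨y, hy, rfl⟩⟩⟩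
theorem pr_mem_prod {a b x y : M} : pr x y ∊ prod a b ↔ x ∊ a ∧ y ∊ b := by
  rw [mem_prod]
  constructor
  · rintro ⟨x', y', hx, hy, e⟩
    obtain ⟨rfl, rfl⟩ := pr_inj.1 e
    exact ⟨hx, hy⟩
  · rintro ⟨hx, hy⟩
    exact ⟨x, y, hx, hy, rfl⟩

theorem isSubset_refl (x : M) : IsSubset x x := fun _ h => h
theorem IsSubset.trans {x y z : M} (h : IsSubset x y) (h' : IsSubset y z) : IsSubset x z :=
  fun w hw => h' w (h w hw)
theorem mem_ran {f y : M} : y ∊ ran f ↔ ∃ x, pr x y ∊ f :=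
  mem_mk (isSetP_of_subset _ (a := sU (sU f)) fun y ⟨x, h⟩ =>
    mem_sU.2 ⟨upair x y, mem_sU.2 ⟨_, h, mem_upair.2 (Or.inr rfl)⟩, mem_upair.2 (Or.inr rfl)⟩)
theorem mem_dom {f x : M} : x ∊ dom f ↔ ∃ y, pr x y ∊ f :=
  mem_mk (isSetP_of_subset _ (a := sU (sU f)) fun x ⟨y, h⟩ =>
    mem_sU.2 ⟨upair x y, mem_sU.2 ⟨_, h, mem_upair.2 (Or.inr rfl)⟩, mem_upair.2 (Or.inl rfl)⟩)

/-! ### Functions -/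

theorem isFunOn_iff {f a : M} : IsFunOn f a ↔
    (∀ p, p ∊ f → ∃ x y, x ∊ a ∧ p = pr x y) ∧ ∀ x, x ∊ a → ∃! y, pr x y ∊ f := by
  simp [IsFunOn, app_iff]

theorem ap_eq {f x y : M} (h : pr x y ∊ f) (h' : ∀ z, pr x z ∊ f → z = y) : ap f x = y :=
  (eq_mk fun z => ⟨fun hz => ⟨y, h, hz⟩, fun ⟨w, hw, hz⟩ => h' w hw ▸ hz⟩).symm

theorem IsFunOn.app_iff {f a x y : M} (h : IsFunOn f a) (hx : x ∊ a) :
    pr x y ∊ f ↔ y = ap f x := by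
  obtain ⟨w, hw, hw'⟩ := (isFunOn_iff.1 h).2 x hx
  rw [ap_eq hw hw']
  exact ⟨hw' y, fun e => e ▸ hw⟩

theorem IsFunOn.ap_mem {f a x : M} (h : IsFunOn f a) (hx : x ∊ a) : pr x (ap f x) ∊ f :=
  (h.app_iff hx).2 rfl

theorem IsFunOn.mem_iff {f a p : M} (h : IsFunOn f a) : p ∊ f ↔ ∃ x, x ∊ a ∧ p = pr x (ap f x) := by
  constructor
  · intro hp
    obtain ⟨x, y, hx, rfl⟩ := (isFunOn_iff.1 h).1 p hp
    exact ⟨x, hx, by rw [← (h.app_iff hx).1 hp]⟩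
  · rintro ⟨x, hx, rfl⟩
    exact h.ap_mem hx

theorem IsFunOn.pr_mem {f a x y : M} (h : IsFunOn f a) : pr x y ∊ f ↔ x ∊ a ∧ y = ap f x := by
  rw [h.mem_iff]
  constructor
  · rintro ⟨x', hx, e⟩
    obtain ⟨rfl, rfl⟩ := pr_inj.1 e
    exact ⟨hx, rfl⟩
  · rintro ⟨hx, rfl⟩
    exact ⟨x, hx, rfl⟩

theorem IsFunOn.ext {f g a : M} (hf : IsFunOn f a) (hg : IsFunOn g a)
    (h : ∀ x, x ∊ a → ap f x = ap g x) : f = g :=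
  SetModel.ext fun p => by
    rw [hf.mem_iff, hg.mem_iff]
    exact exists_congr fun x => and_congr_right fun hx => by rw [h x hx]

theorem IsFunOn.dom_eq {f a : M} (h : IsFunOn f a) : dom f = a :=
  SetModel.ext fun x => by
    rw [mem_dom]
    exact ⟨fun ⟨y, hy⟩ => (h.pr_mem.1 hy).1, fun hx => ⟨_, h.ap_mem hx⟩⟩

theorem IsFunOn.mem_ran {f a y : M} (h : IsFunOn f a) : y ∊ ran f ↔ ∃ x, x ∊ a ∧ y = ap f x := by
  rw [SetModel.mem_ran]
  exact exists_congr fun x => h.pr_mem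

theorem isFun_iff {f a b : M} : IsFun f a b ↔ IsFunOn f a ∧ ∀ x, x ∊ a → ap f x ∊ b := by
  refine and_congr_right fun h => ?_
  simp only [app_iff, h.pr_mem]
  exact ⟨fun H x hx => H x _ ⟨hx, rfl⟩, fun H x y ⟨hx, e⟩ => e ▸ H x hx⟩

theorem IsFun.ap_mem {f a b x : M} (h : IsFun f a b) (hx : x ∊ a) : ap f x ∊ b :=
  (isFun_iff.1 h).2 x hx

theorem IsFun.subset_prod {f a b : M} (h : IsFun f a b) : IsSubset f (prod a b) := fun p hp => by
  obtain ⟨x, hx, rfl⟩ := h.1.mem_iff.1 hp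
  exact pr_mem_prod.2 ⟨hx, h.ap_mem hx⟩

theorem IsFun.mono {f a b b' : M} (h : IsFun f a b) (hb : IsSubset b b') : IsFun f a b' :=
  ⟨h.1, fun x y hxy => hb _ (h.2 x y hxy)⟩

@[simp] theorem mem_funs {a b f : M} : f ∊ funs a b ↔ IsFun f a b :=
  mem_mk (isSetP_of_subset _ (a := pow (prod a b)) fun _ h => mem_pow.2 h.subset_prod)

theorem mem_lam {a : M} {F : M → M} [h : DTm fun v : ℕ → M => F (v 0)] {p : M} :
    p ∊ lam a F ↔ ∃ x, x ∊ a ∧ p = pr x (F x) :=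
  have : DF1 F := ⟨h⟩
  mem_img

theorem pr_mem_lam {a : M} {F : M → M} [h : DTm fun v : ℕ → M => F (v 0)] {x y : M} :
    pr x y ∊ lam a F ↔ x ∊ a ∧ y = F x := by
  rw [mem_lam]
  constructor
  · rintro ⟨x', hx, e⟩
    obtain ⟨rfl, rfl⟩ := pr_inj.1 e
    exact ⟨hx, rfl⟩
  · rintro ⟨hx, rfl⟩
    exact ⟨x, hx, rfl⟩

theorem isFunOn_lam {a : M} {F : M → M} [h : DTm fun v : ℕ → M => F (v 0)] :
    IsFunOn (lam a F) a :=
  isFunOn_iff.2 ⟨fun p hp => let ⟨x, hx, e⟩ := mem_lam.1 hp; ⟨x, _, hx, e⟩,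
    fun x hx => ⟨F x, pr_mem_lam.2 ⟨hx, rfl⟩, fun _ hy => (pr_mem_lam.1 hy).2⟩⟩

theorem ap_lam {a : M} {F : M → M} [h : DTm fun v : ℕ → M => F (v 0)] {x : M} (hx : x ∊ a) :
    ap (lam a F) x = F x :=
  ap_eq (pr_mem_lam.2 ⟨hx, rfl⟩) fun _ hz => (pr_mem_lam.1 hz).2

theorem isFun_lam {a b : M} {F : M → M} [h : DTm fun v : ℕ → M => F (v 0)]
    (H : ∀ x, x ∊ a → F x ∊ b) : IsFun (lam a F) a b :=
  isFun_iff.2 ⟨isFunOn_lam, fun x hx => by rw [ap_lam hx]; exact H x hx⟩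

theorem isBijection_iff {f a b : M} : IsBijection f a b ↔ IsFun f a b ∧
    (∀ x x', x ∊ a → x' ∊ a → ap f x = ap f x' → x = x') ∧ ∀ y, y ∊ b → ∃ x, x ∊ a ∧ ap f x = y := by
  refine and_congr_right fun h => ?_
  simp only [app_iff, h.1.pr_mem]
  constructor
  · intro H
    refine ⟨fun x x' hx hx' e => ?_, fun y hy => ?_⟩
    · obtain ⟨w, -, hw⟩ := H _ (h.ap_mem hx)
      exact (hw x ⟨hx, rfl⟩).trans (hw x' ⟨hx', e⟩).symm
    · obtain ⟨x, ⟨hx, e⟩, -⟩ := H y hy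
      exact ⟨x, hx, e.symm⟩
  · rintro ⟨h1, h2⟩ y hy
    obtain ⟨x, hx, rfl⟩ := h2 y hy
    exact ⟨x, ⟨hx, rfl⟩, fun x' hx' => (h1 _ _ hx hx'.1 hx'.2).symm⟩

theorem sameCard_of_bij {a b : M} (F : M → M) [h : DTm fun v : ℕ → M => F (v 0)]
    (h1 : ∀ x, x ∊ a → F x ∊ b) (h2 : ∀ x x', x ∊ a → x' ∊ a → F x = F x' → x = x')
    (h3 : ∀ y, y ∊ b → ∃ x, x ∊ a ∧ F x = y) : IsBijection (lam a F) a b :=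
  isBijection_iff.2 ⟨isFun_lam h1, fun x x' hx hx' e => h2 x x' hx hx' (by
    rwa [ap_lam hx, ap_lam hx'] at e), fun y hy => by
      obtain ⟨x, hx, e⟩ := h3 y hy
      exact ⟨x, hx, by rw [ap_lam hx, e]⟩⟩

/-- The inverse relation of `f`. -/
noncomputable def inv (f : M) : M := mk fun p => ∃ x y, pr x y ∊ f ∧ p = pr y x

instance : DF1 (inv : M → M) := ⟨by unfold inv; infer_instance⟩

theorem pr_mem_inv {f x y : M} : pr x y ∊ inv f ↔ pr y x ∊ f := by
  refine (mem_mk (isSetP_of_subset _ (a := prod (ran f) (dom f)) ?_)).trans ?_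
  · rintro _ ⟨x, y, h, rfl⟩
    exact pr_mem_prod.2 ⟨mem_ran.2 ⟨x, h⟩, mem_dom.2 ⟨y, h⟩⟩
  · constructor
    · rintro ⟨x', y', h, e⟩
      obtain ⟨rfl, rfl⟩ := pr_inj.1 e
      exact h
    · exact fun h => ⟨y, x, h, rfl⟩

theorem mem_inv {f p : M} : p ∊ inv f ↔ ∃ x y, pr x y ∊ f ∧ p = pr y x :=
  mem_mk (isSetP_of_subset _ (a := prod (ran f) (dom f)) (by
    rintro _ ⟨x, y, h, rfl⟩
    exact pr_mem_prod.2 ⟨mem_ran.2 ⟨x, h⟩, mem_dom.2 ⟨y, h⟩⟩))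

theorem IsBijection.symm {f a b : M} (h : IsBijection f a b) : IsBijection (inv f) b a := by
  have h' := isBijection_iff.1 h
  have hf : IsFunOn (inv f) b := isFunOn_iff.2 ⟨fun p hp => by
      obtain ⟨x, y, hxy, rfl⟩ := mem_inv.1 hp
      exact ⟨y, x, h.1.2 x y (app_iff.2 hxy), rfl⟩, fun y hy => by
        have := h.2 y hy
        simp only [app_iff] at this
        simpa only [pr_mem_inv] using this⟩
  refine ⟨⟨hf, fun y x hyx => ?_⟩, fun x hx => ?_⟩
  · rw [app_iff, pr_mem_inv, h.1.1.pr_mem] at hyx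
    exact hyx.1
  · simp only [app_iff, pr_mem_inv]
    exact (isFunOn_iff.1 h.1.1).2 x hx

theorem IsBijection.ap_inv {f a b y : M} (h : IsBijection f a b) (hy : y ∊ b) :
    ap (inv f) y ∊ a ∧ ap f (ap (inv f) y) = y := by
  have h1 := h.symm.1.1.ap_mem hy
  rw [pr_mem_inv, h.1.1.pr_mem] at h1
  exact ⟨h1.1, h1.2.symm⟩

theorem IsBijection.inv_ap {f a b x : M} (h : IsBijection f a b) (hx : x ∊ a) :
    ap (inv f) (ap f x) = x :=
  (isBijection_iff.1 h).2.1 _ _ (h.ap_inv (h.1.ap_mem hx)).1 hx (h.ap_inv (h.1.ap_mem hx)).2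

noncomputable def comp (g f : M) : M := lam (dom f) fun x => ap g (ap f x)

instance : DF2 (comp : M → M → M) := ⟨by unfold comp; infer_instance⟩

theorem ap_comp {g f a x : M} (hf : IsFunOn f a) (hx : x ∊ a) : ap (comp g f) x = ap g (ap f x) :=
  ap_lam (by rwa [hf.dom_eq])

theorem isFunOn_comp {g f a : M} (hf : IsFunOn f a) : IsFunOn (comp g f) a := by
  have : IsFunOn (comp g f) (dom f) := isFunOn_lam
  rwa [hf.dom_eq] at this

theorem isFun_comp {g f a b c : M} (hg : IsFun g b c) (hf : IsFun f a b) : IsFun (comp g f) a c :=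
  isFun_iff.2 ⟨isFunOn_comp hf.1, fun x hx => by
    rw [ap_comp hf.1 hx]; exact hg.ap_mem (hf.ap_mem hx)⟩

theorem isBijection_comp {g f a b c : M} (hg : IsBijection g b c) (hf : IsBijection f a b) :
    IsBijection (comp g f) a c := by
  have h1 := isBijection_iff.1 hg
  have h2 := isBijection_iff.1 hf
  refine isBijection_iff.2 ⟨isFun_comp hg.1 hf.1, fun x x' hx hx' e => ?_, fun z hz => ?_⟩
  · rw [ap_comp hf.1.1 hx, ap_comp hf.1.1 hx'] at e
    exact h2.2.1 _ _ hx hx' (h1.2.1 _ _ (hf.1.ap_mem hx) (hf.1.ap_mem hx') e)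
  · obtain ⟨y, hy, rfl⟩ := h1.2.2 z hz
    obtain ⟨x, hx, rfl⟩ := h2.2.2 y hy
    exact ⟨x, hx, ap_comp hf.1.1 hx⟩

theorem SameCard.symm {a b : M} (h : SameCard a b) : SameCard b a := let ⟨_, h⟩ := h; ⟨_, h.symm⟩
theorem SameCard.trans {a b c : M} (h : SameCard a b) (h' : SameCard b c) : SameCard a c :=
  let ⟨_, h⟩ := h; let ⟨_, h'⟩ := h'; ⟨_, isBijection_comp h' h⟩
theorem sameCard_refl (a : M) : SameCard a a :=
  ⟨_, sameCard_of_bij (fun x => x) (fun _ h => h) (fun _ _ _ _ e => e) fun y hy => ⟨y, hy, rfl⟩⟩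

/-! ### Foundation, natural numbers -/

theorem exists_minimal {x y : M} (h : y ∊ x) : ∃ y, y ∊ x ∧ ∀ z, z ∊ x → ¬ z ∊ y :=
  hZ.out.foundation x ⟨y, h⟩

theorem not_mem_self (x : M) : ¬ x ∊ x := fun h => by
  obtain ⟨y, hy, hy'⟩ := exists_minimal (mem_sing.2 rfl : x ∊ sing x)
  obtain rfl := mem_sing.1 hy
  exact hy' y hy h

theorem not_mem_of_mem {x y : M} (h : x ∊ y) : ¬ y ∊ x := fun h' => by
  obtain ⟨w, hw, hw'⟩ := exists_minimal (mem_upair.2 (Or.inl rfl) : x ∊ upair x y)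
  rcases mem_upair.1 hw with rfl | rfl
  · exact hw' y (by simp) h'
  · exact hw' x (by simp) h

theorem ne_of_mem {x y : M} (h : x ∊ y) : x ≠ y := fun e => not_mem_self y (e ▸ h)

theorem isInductive_iff {X : M} : IsInductive X ↔ emp M ∊ X ∧ ∀ x, x ∊ X → sc x ∊ X := by
  simp [IsInductive]

@[simp] theorem isNat_iff {n : M} : IsNat n ↔ n ∊ om M := by
  obtain ⟨X, hX⟩ := hZ.out.infinity
  exact (mem_mk (isSetP_of_subset _ (a := X) fun n hn => hn X hX)).symm

@[simp] theorem isOmega_iff {w : M} : IsOmega w ↔ w = om M := by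
  simp only [IsOmega, isNat_iff]
  exact ⟨ext, fun h n => h ▸ Iff.rfl⟩

theorem emp_mem_om : emp M ∊ om M := isNat_iff.1 fun _ hX => (isInductive_iff.1 hX).1
theorem sc_mem_om {n : M} (h : n ∊ om M) : sc n ∊ om M :=
  isNat_iff.1 fun X hX => (isInductive_iff.1 hX).2 n (isNat_iff.2 h X hX)

theorem nat_induction {P : M → Prop} [h : Dfn fun v : ℕ → M => P (v 0)] (h0 : P (emp M))
    (hs : ∀ n, n ∊ om M → P n → P (sc n)) {n : M} (hn : n ∊ om M) : P n := by
  have : n ∊ sep (om M) P := isNat_iff.2 hn _ (isInductive_iff.2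
    ⟨mem_sep.2 ⟨emp_mem_om, h0⟩, fun x hx => by
      rw [mem_sep] at hx ⊢
      exact ⟨sc_mem_om hx.1, hs x hx.1 hx.2⟩⟩)
  exact (mem_sep.1 this).2

theorem mem_om_of_mem {n m : M} (hn : n ∊ om M) (hm : m ∊ n) : m ∊ om M :=
  nat_induction (P := fun n => ∀ m, m ∊ n → m ∊ om M) (fun m hm => absurd hm not_mem_emp)
    (fun n hn ih m hm => (mem_sc.1 hm).elim (ih m) fun e => e ▸ hn) hn m hm

noncomputable def num : ℕ → M
  | 0 => emp M
  | k + 1 => sc (num k)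

@[simp] theorem isNumeral_iff {k : ℕ} {x : M} : IsNumeral k x ↔ x = num k := by
  induction k generalizing x with
  | zero => simp [IsNumeral, num]
  | succ k ih => simp [IsNumeral, num, ih]

theorem num_mem_om (k : ℕ) : (num k : M) ∊ om M := by
  induction k with
  | zero => exact emp_mem_om
  | succ k ih => exact sc_mem_om ih

theorem mem_num {k : ℕ} {z : M} : z ∊ num k ↔ ∃ i < k, z = num i := by
  induction k with
  | zero => simp [num]
  | succ k ih =>
    rw [num, mem_sc, ih]
    constructor
    · rintro (⟨i, hi, rfl⟩ | rfl)
      · exact ⟨i, by omega, rfl⟩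
      · exact ⟨k, by omega, rfl⟩
    · rintro ⟨i, hi, rfl⟩
      rcases Nat.lt_succ_iff_lt_or_eq.1 hi with h | rfl
      · exact Or.inl ⟨i, h, rfl⟩
      · exact Or.inr rfl

@[simp] theorem num_inj {i j : ℕ} : (num i : M) = num j ↔ i = j := by
  refine ⟨fun h => ?_, fun h => h ▸ rfl⟩
  rcases Nat.lt_trichotomy i j with hl | hl | hl
  · exact absurd (mem_num.2 ⟨i, hl, rfl⟩ : (num i : M) ∊ num j) (h ▸ not_mem_self _)
  · exact hl
  · exact absurd (mem_num.2 ⟨j, hl, rfl⟩ : (num j : M) ∊ num i) (h ▸ not_mem_self _)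

noncomputable def code (k : ℕ) (a b : M) : M := pr (num k) (pr a b)

instance (k : ℕ) : DF2 (code k : M → M → M) := ⟨by unfold code; infer_instance⟩

@[simp] theorem isCode_iff {k : ℕ} {c a b : M} : IsCode k c a b ↔ c = code k a b := by
  simp [IsCode, code]

theorem code_inj {k l : ℕ} {a b c d : M} : code k a b = code l c d ↔ k = l ∧ a = c ∧ b = d := by
  simp [code]

/-! ### Ordinals -/

theorem IsOrdinal.mem {α β : M} (h : IsOrdinal α) (hβ : β ∊ α) : IsOrdinal β :=
  ⟨h.2 β hβ, fun y hy => h.2 y (h.1 β hβ y hy)⟩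

theorem IsOrdinal.subset {α β : M} (h : IsOrdinal α) (hβ : β ∊ α) : IsSubset β α := h.1 β hβ

theorem IsOrdinal.trans {α β γ : M} (h : IsOrdinal α) (h1 : γ ∊ β) (h2 : β ∊ α) : γ ∊ α :=
  h.1 β h2 γ h1

/-- The least ordinal principle for definable classes. -/
theorem exists_least_ord (P : M → Prop) [h : Dfn fun v : ℕ → M => P (v 0)] {α : M}
    (hα : IsOrdinal α) (hP : P α) : ∃ β, IsOrdinal β ∧ P β ∧ ∀ γ, γ ∊ β → ¬ P γ := by
  by_cases hc : ∃ β, β ∊ sep α P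
  · obtain ⟨β, hβ⟩ := hc
    obtain ⟨γ, hγ, hmin⟩ := exists_minimal hβ
    rw [mem_sep] at hγ
    exact ⟨γ, hα.mem hγ.1, hγ.2, fun δ hδ hPδ =>
      hmin δ (mem_sep.2 ⟨hα.trans hδ hγ.1, hPδ⟩) hδ⟩
  · push Not at hc
    exact ⟨α, hα, hP, fun γ hγ hPγ => hc γ (mem_sep.2 ⟨hγ, hPγ⟩)⟩

/-- Let `α₀` be the least ordinal incomparable with some ordinal, and `β₀` the least one
incomparable with `α₀`. By minimality they have the same elements. -/
theorem ord_trichotomy {α β : M} (hα : IsOrdinal α) (hβ : IsOrdinal β) :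
    α ∊ β ∨ α = β ∨ β ∊ α := by
  by_contra hc
  obtain ⟨α₀, hα₀, ⟨β₁, hβ₁, h1⟩, hmin⟩ := exists_least_ord
    (fun α => ∃ β, IsOrdinal β ∧ ¬ (α ∊ β ∨ α = β ∨ β ∊ α)) hα ⟨β, hβ, hc⟩
  obtain ⟨β₀, hβ₀, h2, hmin'⟩ := exists_least_ord
    (fun β => ¬ (α₀ ∊ β ∨ α₀ = β ∨ β ∊ α₀)) hβ₁ h1
  refine h2 (Or.inr (Or.inl (ext fun z => ⟨fun hz => ?_, fun hz => ?_⟩)))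
  · by_contra hz'
    refine hmin z hz ⟨β₀, hβ₀, ?_⟩
    rintro (h | rfl | h)
    · exact hz' h
    · exact h2 (Or.inr (Or.inr hz))
    · exact h2 (Or.inr (Or.inr (hα₀.trans h hz)))
  · rcases not_not.1 (hmin' z hz) with h | rfl | h
    · exact absurd (Or.inl (hβ₀.trans h hz)) h2
    · exact absurd (Or.inl hz) h2
    · exact h

theorem IsOrdinal.mem_of_ssubset {α β : M} (hα : IsOrdinal α) (hβ : IsOrdinal β)
    (h : IsSubset α β) (hne : α ≠ β) : α ∊ β := by
  rcases ord_trichotomy hα hβ with h' | rfl | h'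
  · exact h'
  · exact absurd rfl hne
  · exact absurd (h β h') (not_mem_self β)

theorem ord_not_mem {α β : M} (hα : IsOrdinal α) (hβ : IsOrdinal β) :
    ¬ α ∊ β ↔ IsSubset β α := by
  constructor
  · intro h
    rcases ord_trichotomy hα hβ with h' | rfl | h'
    · exact absurd h' h
    · exact isSubset_refl _
    · exact hα.subset h'
  · exact fun h h' => not_mem_self _ (h _ h')

theorem ord_subset_iff {α β : M} (hα : IsOrdinal α) (hβ : IsOrdinal β) :
    IsSubset α β ↔ α ∊ β ∨ α = β := by
  constructor
  · intro h
    by_cases e : α = β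
    · exact Or.inr e
    · exact Or.inl (hα.mem_of_ssubset hβ h e)
  · rintro (h | rfl)
    · exact hβ.subset h
    · exact isSubset_refl _

theorem ord_mem_of_subset_mem {α β γ : M} (hα : IsOrdinal α) (hγ : IsOrdinal γ)
    (h : IsSubset α β) (h' : β ∊ γ) : α ∊ γ := by
  rcases (ord_subset_iff hα (hγ.mem h')).1 h with h | rfl
  · exact hγ.trans h h'
  · exact h'

theorem ord_emp : IsOrdinal (emp M) :=
  ⟨fun _ h => absurd h not_mem_emp, fun _ h => absurd h not_mem_emp⟩

theorem IsOrdinal.sc {α : M} (h : IsOrdinal α) : IsOrdinal (sc α) := by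
  refine ⟨fun y hy z hz => ?_, fun y hy => ?_⟩
  · rw [mem_sc] at hy ⊢
    rcases hy with hy | rfl
    · exact Or.inl (h.trans hz hy)
    · exact Or.inl hz
  · rcases mem_sc.1 hy with hy | rfl
    · exact h.2 y hy
    · exact h.1

theorem ord_sU {x : M} (h : ∀ y, y ∊ x → IsOrdinal y) : IsOrdinal (sU x) := by
  refine ⟨fun y hy z hz => ?_, fun y hy => ?_⟩
  · obtain ⟨w, hw, hyw⟩ := mem_sU.1 hy
    exact mem_sU.2 ⟨w, hw, (h w hw).trans hz hyw⟩
  · obtain ⟨w, hw, hyw⟩ := mem_sU.1 hy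
    exact (h w hw).2 y hyw

theorem ord_un {α β : M} (hα : IsOrdinal α) (hβ : IsOrdinal β) : IsOrdinal (un α β) := by
  have := ord_sU (x := upair α β) (by simp [hα, hβ])
  convert this using 1
  exact ext fun z => by simp

theorem ord_of_nat {n : M} (hn : n ∊ om M) : IsOrdinal n :=
  nat_induction (P := IsOrdinal) ord_emp (fun _ _ h => h.sc) hn

theorem ord_om : IsOrdinal (om M) :=
  ⟨fun _ hn _ hm => mem_om_of_mem hn hm, fun _ hn => (ord_of_nat hn).1⟩

theorem ord_induction {P : M → Prop} [h : Dfn fun v : ℕ → M => P (v 0)]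
    (H : ∀ α, IsOrdinal α → (∀ β, β ∊ α → P β) → P α) {α : M} (hα : IsOrdinal α) : P α := by
  by_contra hc
  have : DP1 P := ⟨h⟩
  obtain ⟨β, hβ, hPβ, hmin⟩ := exists_least_ord (fun x => ¬ P x) hα hc
  exact hPβ (H β hβ fun γ hγ => not_not.1 (hmin γ hγ))

theorem not_isSetP_ord : ¬ IsSetP (IsOrdinal : M → Prop) := by
  rintro ⟨a, ha⟩
  have : IsOrdinal a := ⟨fun y hy z hz => (ha z).2 (((ha y).1 hy).mem hz),
    fun y hy => ((ha y).1 hy).1⟩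
  exact not_mem_self a ((ha a).2 this)

/-! ### Recursion on ordinals -/

/-- The auxiliary `u` keeps the argument of `G` a bound variable, the form in which definability of
`G` is available to instance search. -/
def IsAttempt (G : M → M) (f s : M) : Prop :=
  IsFunOn f s ∧ ∀ β, β ∊ s → ∃ u, u = lam β (fun x => ap f x) ∧ ap f β = G u

/-- The function on the ordinals with `trec G α = G (trec G restricted to α)`. -/
noncomputable def trec (G : M → M) (α : M) : M :=
  mk fun z => ∃ f y, IsAttempt G f (sc α) ∧ pr α y ∊ f ∧ z ∊ y

instance dtm_trec {G : (ℕ → M) → M → M} {a : (ℕ → M) → M}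
    [h : DTm fun v => G (fun i => v (i + 1)) (v 0)] [ha : DTm a] :
    DTm fun v => trec (G v) (a v) := by
  have := ha.shift (· + 3)
  have := ha.shift (· + 4)
  have : DTm fun v : ℕ → M => G (fun i => v (i + 5)) (v 0) :=
    h.shift fun i => Nat.casesOn i 0 fun k => k + 5
  clear h ha
  unfold trec IsAttempt
  infer_instance

theorem lam_congr {a : M} {F F' : M → M} (h : ∀ x, x ∊ a → F x = F' x) : lam a F = lam a F' := by
  unfold lam img
  congr 1
  funext z
  refine propext (exists_congr fun x => and_congr_right fun hx => by simp only [h x hx])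

section
variable {G : M → M} [hG : DTm fun v : ℕ → M => G (v 0)]

theorem IsAttempt.unique {f g s t : M} (hf : IsAttempt G f s) (hg : IsAttempt G g t)
    (hs : IsOrdinal s) (ht : IsOrdinal t) {β : M} (hβ : β ∊ s) (hβ' : β ∊ t) :
    ap f β = ap g β := by
  refine ord_induction (P := fun β => β ∊ s → β ∊ t → ap f β = ap g β) ?_ (hs.mem hβ) hβ hβ'
  intro β _ ih h1 h2
  obtain ⟨_, rfl, e1⟩ := hf.2 β h1
  obtain ⟨_, rfl, e2⟩ := hg.2 β h2
  rw [e1, e2, lam_congr fun x hx => ih x hx (hs.trans hx h1) (ht.trans hx h2)]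

theorem IsAttempt.trec_eq {f α : M} (hf : IsAttempt G f (sc α)) (hα : IsOrdinal α) :
    trec G α = ap f α := by
  refine (eq_mk fun z => ?_).symm
  constructor
  · exact fun hz => ⟨f, ap f α, hf, hf.1.ap_mem (by simp), hz⟩
  · rintro ⟨g, y, hg, hy, hz⟩
    have hy' := (hg.1.pr_mem.1 hy).2
    rw [hf.unique hg hα.sc hα.sc (mem_sc.2 (Or.inr rfl)) (mem_sc.2 (Or.inr rfl)), ← hy']
    exact hz

/-- By induction, the function `β ↦ G (lam β (trec G))` on `sc α` is an attempt: below `α` its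
values are those of `trec G`. Attempts agree on common arguments, so it computes `trec G α`. -/
theorem trec_eq {α : M} (hα : IsOrdinal α) : trec G α = G (lam α (trec G)) := by
  have hG1 : DF1 G := ⟨hG⟩
  have hT : DF1 (trec G) := ⟨inferInstance⟩
  suffices H : ∃ f, IsAttempt G f (sc α) ∧ ap f α = G (lam α (trec G)) by
    obtain ⟨f, hf, e⟩ := H
    rw [hf.trec_eq hα, e]
  have hA : DP2 (IsAttempt G) := ⟨by unfold IsAttempt; infer_instance⟩
  refine ord_induction (P := fun α => ∃ f, IsAttempt G f (sc α) ∧ ap f α = G (lam α (trec G)))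
    ?_ hα
  intro α hα ih
  have key : ∀ β, β ∊ α → trec G β = G (lam β (trec G)) := fun β hβ => by
    obtain ⟨f, hf, e⟩ := ih β hβ
    rw [hf.trec_eq (hα.mem hβ), e]
  have hf : ∀ β, β ∊ sc α → ap (lam (sc α) fun β => G (lam β (trec G))) β = G (lam β (trec G)) :=
    fun β hβ => ap_lam hβ
  refine ⟨lam (sc α) fun β => G (lam β (trec G)), ⟨isFunOn_lam, fun β hβ => ⟨_, rfl, ?_⟩⟩,
    hf α (mem_sc.2 (Or.inr rfl))⟩
  rw [hf β hβ]
  congr 1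
  refine lam_congr fun γ hγ => ?_
  have hγα : γ ∊ α := by
    rcases mem_sc.1 hβ with h | rfl
    · exact hα.trans hγ h
    · exact hγ
  rw [hf γ (mem_sc.2 (Or.inl hγα)), key γ hγα]
end

/-! ### Recursion on natural numbers -/

open Classical in
-- At stage `0` the history `f` is empty. At stage `sc n` its domain is `sc n`, whose union is the
-- predecessor `n`.
noncomputable def nrec (a : M) (g : M → M) (n : M) : M :=
  trec (fun f => if f = emp M then a else g (ap f (sU (dom f)))) n

instance dtm_nrec {g : (ℕ → M) → M → M} {a n : (ℕ → M) → M}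
    [h : DTm fun v => g (fun i => v (i + 1)) (v 0)] [ha : DTm a] [hn : DTm n] :
    DTm fun v => nrec (a v) (g v) (n v) := by
  have := ha.shift (· + 1)
  have : DTm fun v : ℕ → M => g (fun i => v (i + 1)) (ap (v 0) (sU (dom (v 0)))) :=
    ⟨by
      have := h.out
      refine dfn_bind (P := fun v x => v 0 = g (fun i => v (i + 2)) x)
        (a := fun v : ℕ → M => ap (v 1) (sU (dom (v 1)))) ?_
      exact (this.reindex fun i => match i with | 0 => 1 | 1 => 0 | k + 2 => k + 3).congr
        fun _ => Iff.rfl⟩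
  clear h ha
  unfold nrec
  infer_instance

section
variable {a : M} {g : M → M} [hg : DTm fun v : ℕ → M => g (v 0)]

theorem nrec_zero : nrec a g (emp M) = a := by
  have : DF1 g := ⟨hg⟩
  unfold nrec
  rw [trec_eq ord_emp, if_pos]
  exact eq_emp_iff.2 fun z hz => by
    obtain ⟨x, hx, -⟩ := mem_lam.1 hz
    exact not_mem_emp hx

open Classical in
theorem nrec_succ {n : M} (hn : n ∊ om M) : nrec a g (sc n) = g (nrec a g n) := by
  have : DF1 g := ⟨hg⟩
  have hT : DF1 (nrec a g) := ⟨inferInstance⟩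
  have h1 : IsFunOn (lam (sc n) (nrec a g)) (sc n) := isFunOn_lam
  have e : nrec a g (sc n) = _ := trec_eq (ord_of_nat (sc_mem_om hn))
  change _ = ite (lam (sc n) (nrec a g) = emp M) a
    (g (ap (lam (sc n) (nrec a g)) (sU (dom (lam (sc n) (nrec a g)))))) at e
  have h2 : sU (sc n) = n := ext fun z => by
    simp only [mem_sU, mem_sc]
    constructor
    · rintro ⟨y, hy | rfl, hz⟩
      · exact (ord_of_nat hn).trans hz hy
      · exact hz
    · exact fun hz => ⟨n, Or.inr rfl, hz⟩
  rw [e, if_neg, h1.dom_eq, h2, ap_lam (mem_sc.2 (Or.inr rfl))]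
  exact ne_emp_iff.2 ⟨_, h1.ap_mem (mem_sc.2 (Or.inr rfl))⟩
end

/-! ### The cumulative hierarchy -/

noncomputable def V (α : M) : M := trec (fun f => mk fun x => ∃ γ z, pr γ z ∊ f ∧ IsSubset x z) α

instance : DF1 (V : M → M) := ⟨by unfold V; infer_instance⟩

theorem mem_V {α x : M} (hα : IsOrdinal α) : x ∊ V α ↔ ∃ γ, γ ∊ α ∧ IsSubset x (V γ) := by
  have e : V α = _ := trec_eq hα
  change _ = mk fun x => ∃ γ z, pr γ z ∊ lam α V ∧ IsSubset x z at e
  rw [e, mem_mk]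
  · constructor
    · rintro ⟨γ, z, h, hx⟩
      obtain ⟨hγ, rfl⟩ := pr_mem_lam.1 h
      exact ⟨γ, hγ, hx⟩
    · rintro ⟨γ, hγ, hx⟩
      exact ⟨γ, _, pr_mem_lam.2 ⟨hγ, rfl⟩, hx⟩
  · refine isSetP_of_subset _ (a := pow (sU (ran (lam α V)))) ?_
    rintro x ⟨γ, z, h, hx⟩
    exact mem_pow.2 fun w hw => mem_sU.2 ⟨z, mem_ran.2 ⟨γ, h⟩, hx w hw⟩

theorem V_mono {α β : M} (hα : IsOrdinal α) (hβ : IsOrdinal β) (h : IsSubset α β) :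
    IsSubset (V α) (V β) := fun x hx => by
  rw [mem_V hα] at hx
  obtain ⟨γ, hγ, hx⟩ := hx
  exact (mem_V hβ).2 ⟨γ, h γ hγ, hx⟩

theorem V_trans {α x y : M} (hα : IsOrdinal α) (hx : x ∊ V α) (hy : y ∊ x) : y ∊ V α := by
  obtain ⟨γ, hγ, hxγ⟩ := (mem_V hα).1 hx
  exact V_mono (hα.mem hγ) hα (hα.subset hγ) _ (hxγ y hy)

theorem V_subset {α x y : M} (hα : IsOrdinal α) (hx : x ∊ V α) (hy : IsSubset y x) : y ∊ V α := by
  obtain ⟨γ, hγ, hxγ⟩ := (mem_V hα).1 hx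
  exact (mem_V hα).2 ⟨γ, hγ, hy.trans hxγ⟩

theorem V_mem_V {α β : M} (hα : IsOrdinal α) (hβ : β ∊ α) : V β ∊ V α :=
  (mem_V hα).2 ⟨β, hβ, isSubset_refl _⟩

theorem mem_V_sc {α x : M} (hα : IsOrdinal α) : x ∊ V (sc α) ↔ IsSubset x (V α) := by
  constructor
  · intro h
    obtain ⟨γ, hγ, hx⟩ := (mem_V hα.sc).1 h
    refine hx.trans (V_mono (hα.sc.mem hγ) hα ?_)
    rcases mem_sc.1 hγ with h | rfl
    · exact hα.subset h
    · exact isSubset_refl _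
  · exact fun h => (mem_V hα.sc).2 ⟨α, by simp, h⟩

theorem ord_subset_V {α : M} (hα : IsOrdinal α) : IsSubset α (V α) := by
  refine ord_induction (P := fun α => IsSubset α (V α)) (fun α hα ih β hβ => ?_) hα
  exact (mem_V hα).2 ⟨β, hβ, ih β hβ⟩

theorem ord_mem_V {α β : M} (hα : IsOrdinal α) (hβ : IsOrdinal β) : β ∊ V α ↔ β ∊ α := by
  refine ⟨fun h => ?_, fun h => ord_subset_V hα _ h⟩
  refine ord_induction (P := fun α => ∀ β, IsOrdinal β → β ∊ V α → β ∊ α) ?_ hα β hβ h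
  intro α hα ih β hβ h
  obtain ⟨γ, hγ, hs⟩ := (mem_V hα).1 h
  have : IsSubset β γ := fun δ hδ => ih γ hγ δ (hβ.mem hδ) (hs δ hδ)
  exact ord_mem_of_subset_mem hβ hα this hγ

theorem isV_iff {η v : M} (hη : IsOrdinal η) : IsV η v ↔ v = V η := by
  simp only [IsV, isSucc_iff, app_iff]
  constructor
  · rintro ⟨_, f, rfl, hf, h, hv⟩
    have key : ∀ β, IsOrdinal β → β ∊ sc η → ap f β = V β := fun β hβ => by
      refine ord_induction (P := fun β => β ∊ sc η → ap f β = V β) (fun β hβ ih hβη => ?_) hβ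
      refine ext fun x => (h β _ (hf.ap_mem hβη) x).trans ((mem_V hβ).trans ?_).symm
      have hm : ∀ γ, γ ∊ β → γ ∊ sc η := fun γ hγ => hη.sc.trans hγ hβη
      constructor
      · rintro ⟨γ, hγ, hx⟩
        exact ⟨γ, _, hγ, hf.ap_mem (hm γ hγ), by rwa [ih γ hγ (hm γ hγ)]⟩
      · rintro ⟨γ, z, hγ, hz, hx⟩
        rw [(hf.pr_mem.1 hz).2, ih γ hγ (hm γ hγ)] at hx
        exact ⟨γ, hγ, hx⟩
    rw [(hf.pr_mem.1 hv).2, key η hη (by simp)]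
  · rintro rfl
    refine ⟨_, lam (sc η) V, rfl, isFunOn_lam, ?_, pr_mem_lam.2 ⟨by simp, rfl⟩⟩
    intro β y hβ x
    obtain ⟨hβη, rfl⟩ := pr_mem_lam.1 hβ
    rw [mem_V (hη.sc.mem hβη)]
    constructor
    · rintro ⟨γ, hγ, hx⟩
      exact ⟨γ, _, hγ, pr_mem_lam.2 ⟨hη.sc.trans hγ hβη, rfl⟩, hx⟩
    · rintro ⟨γ, z, hγ, hz, hx⟩
      exact ⟨γ, hγ, (pr_mem_lam.1 hz).2 ▸ hx⟩

/-- Every set belongs to the cumulative hierarchy. -/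
theorem exists_mem_V (x : M) : ∃ α, IsOrdinal α ∧ x ∊ V α := by
  -- The comprehension term is the least `α` with `y ∊ V α`, written as the intersection of all of
  -- them; replacement then gathers these ranks over `y ∊ x`, and a bound for them yields a level
  -- containing `x`.
  have step : ∀ x : M, (∀ y, y ∊ x → ∃ α, IsOrdinal α ∧ y ∊ V α) → ∃ α, IsOrdinal α ∧ x ∊ V α := by
    intro x hx
    have hrk : ∀ y, y ∊ x → ∃ α, IsOrdinal α ∧ y ∊ V α ∧
        (mk fun β => ∀ α, IsOrdinal α → y ∊ V α → β ∊ α) = α := fun y hy => by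
      obtain ⟨α, hα, hyα⟩ := hx y hy
      obtain ⟨β, hβ, hyβ, hmin⟩ := exists_least_ord (fun α => y ∊ V α) hα hyα
      refine ⟨β, hβ, hyβ, (eq_mk fun γ => ⟨fun hγ α hα h => ?_, fun h => h β hβ hyβ⟩).symm⟩
      exact (ord_not_mem hα hβ).1 (fun h' => hmin α h' h) γ hγ
    have hr : ∀ y, y ∊ img (fun y => mk fun β => ∀ α, IsOrdinal α → y ∊ V α → β ∊ α) x →
        IsOrdinal y := fun y hy => by
      obtain ⟨z, hz, rfl⟩ := mem_img.1 hy
      obtain ⟨α, hα, -, e⟩ := hrk z hz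
      rwa [e]
    refine ⟨_, (ord_sU hr).sc, (mem_V_sc (ord_sU hr)).2 fun y hy => ?_⟩
    obtain ⟨α, hα, hyα, e⟩ := hrk y hy
    refine V_mono hα (ord_sU hr) (fun z hz => mem_sU.2 ⟨α, ?_, hz⟩) _ hyα
    exact mem_img.2 ⟨y, hy, e.symm⟩
  by_contra hx
  -- The union of the iterates of `sU` on `{x}` is the transitive closure of `{x}`. An `∈`-minimal
  -- element of it outside the hierarchy contradicts `step`.
  have hT : ∀ z, z ∊ sU (img (nrec (sing x) sU) (om M)) ↔ ∃ n, n ∊ om M ∧ z ∊ nrec (sing x) sU n := by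
    intro z
    simp only [mem_sU, mem_img]
    constructor
    · rintro ⟨_, ⟨n, hn, rfl⟩, hz⟩
      exact ⟨n, hn, hz⟩
    · rintro ⟨n, hn, hz⟩
      exact ⟨_, ⟨n, hn, rfl⟩, hz⟩
  have h0 : x ∊ sep (sU (img (nrec (sing x) sU) (om M))) fun y => ¬ ∃ α, IsOrdinal α ∧ y ∊ V α :=
    mem_sep.2 ⟨(hT x).2 ⟨_, emp_mem_om, by simp [nrec_zero]⟩, hx⟩
  obtain ⟨y, hy, hmin⟩ := exists_minimal h0
  rw [mem_sep, hT] at hy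
  obtain ⟨⟨n, hn, hyn⟩, hy⟩ := hy
  refine hy (step y fun z hz => ?_)
  by_contra hz'
  refine hmin z (mem_sep.2 ⟨(hT z).2 ⟨sc n, sc_mem_om hn, ?_⟩, hz'⟩) hz
  rw [nrec_succ hn]
  exact mem_sU.2 ⟨y, hyn, hz⟩

/-! ### Limit ordinals -/

def IsLim (θ : M) : Prop := IsOrdinal θ ∧ emp M ∊ θ ∧ ∀ β, β ∊ θ → sc β ∊ θ

instance : DP1 (IsLim : M → Prop) := ⟨by unfold IsLim; infer_instance⟩

/-- The limit is `γ + ω`, the union of the iterated successors of `γ` over the natural numbers of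
`M`. -/
theorem exists_lim {γ : M} (hγ : IsOrdinal γ) : ∃ θ, IsLim θ ∧ γ ∊ θ := by
  have hs : ∀ n, n ∊ om M → IsOrdinal (nrec γ sc n) := fun n hn =>
    nat_induction (P := fun n => IsOrdinal (nrec γ sc n)) (by rwa [nrec_zero])
      (fun n hn h => by rw [nrec_succ hn]; exact h.sc) hn
  have hT : ∀ z, z ∊ sU (img (nrec γ sc) (om M)) ↔ ∃ n, n ∊ om M ∧ z ∊ nrec γ sc n := by
    intro z
    simp only [mem_sU, mem_img]
    constructor
    · rintro ⟨_, ⟨n, hn, rfl⟩, hz⟩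
      exact ⟨n, hn, hz⟩
    · rintro ⟨n, hn, hz⟩
      exact ⟨_, ⟨n, hn, rfl⟩, hz⟩
  have ho : IsOrdinal (sU (img (nrec γ sc) (om M))) := ord_sU fun y hy => by
    obtain ⟨n, hn, rfl⟩ := mem_img.1 hy
    exact hs n hn
  have hγ' : γ ∊ sU (img (nrec γ sc) (om M)) :=
    (hT γ).2 ⟨sc (emp M), sc_mem_om emp_mem_om, by rw [nrec_succ emp_mem_om, nrec_zero]; simp⟩
  refine ⟨_, ⟨ho, ?_, fun β hβ => ?_⟩, hγ'⟩
  · exact ord_mem_of_subset_mem ord_emp ho (fun _ h => absurd h not_mem_emp) hγ'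
  · obtain ⟨n, hn, hβ⟩ := (hT β).1 hβ
    refine (hT _).2 ⟨sc n, sc_mem_om hn, ?_⟩
    rw [nrec_succ hn]
    refine ord_mem_of_subset_mem ((hs n hn).mem hβ).sc (hs n hn).sc (fun z hz => ?_)
      (mem_sc.2 (Or.inr rfl))
    rcases mem_sc.1 hz with hz | rfl
    · exact (hs n hn).trans hz hβ
    · exact hβ

section
variable {θ : M} (hθ : IsLim θ)
include hθ

theorem IsLim.exists_of_mem {x : M} (hx : x ∊ V θ) : ∃ β, β ∊ θ ∧ x ∊ V β := by
  obtain ⟨γ, hγ, hx⟩ := (mem_V hθ.1).1 hx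
  exact ⟨sc γ, hθ.2.2 γ hγ, (mem_V_sc (hθ.1.mem hγ)).2 hx⟩

theorem IsLim.upair {x y : M} (hx : x ∊ V θ) (hy : y ∊ V θ) : upair x y ∊ V θ := by
  obtain ⟨β, hβ, hx⟩ := hθ.exists_of_mem hx
  obtain ⟨γ, hγ, hy⟩ := hθ.exists_of_mem hy
  have oβ := hθ.1.mem hβ
  have oγ := hθ.1.mem hγ
  have : ∃ δ, δ ∊ θ ∧ x ∊ V δ ∧ y ∊ V δ := by
    rcases ord_trichotomy oβ oγ with h | rfl | h
    · exact ⟨γ, hγ, V_mono oβ oγ (oγ.subset h) _ hx, hy⟩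
    · exact ⟨β, hβ, hx, hy⟩
    · exact ⟨β, hβ, hx, V_mono oγ oβ (oβ.subset h) _ hy⟩
  obtain ⟨δ, hδ, hx, hy⟩ := this
  refine (mem_V hθ.1).2 ⟨δ, hδ, fun z hz => ?_⟩
  rcases mem_upair.1 hz with rfl | rfl
  · exact hx
  · exact hy

theorem IsLim.sing {x : M} (hx : x ∊ V θ) : sing x ∊ V θ := hθ.upair hx hx
theorem IsLim.pr {x y : M} (hx : x ∊ V θ) (hy : y ∊ V θ) : pr x y ∊ V θ :=
  hθ.upair (hθ.sing hx) (hθ.upair hx hy)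

theorem IsLim.pow {x : M} (hx : x ∊ V θ) : pow x ∊ V θ := by
  obtain ⟨β, hβ, hx⟩ := hθ.exists_of_mem hx
  exact (mem_V hθ.1).2 ⟨β, hβ, fun z hz => V_subset (hθ.1.mem hβ) hx (mem_pow.1 hz)⟩

theorem IsLim.sU {x : M} (hx : x ∊ V θ) : sU x ∊ V θ := by
  obtain ⟨β, hβ, hx⟩ := hθ.exists_of_mem hx
  refine (mem_V hθ.1).2 ⟨β, hβ, fun z hz => ?_⟩
  obtain ⟨y, hy, hz⟩ := mem_sU.1 hz
  exact V_trans (hθ.1.mem hβ) (V_trans (hθ.1.mem hβ) hx hy) hz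

theorem IsLim.un {x y : M} (hx : x ∊ V θ) (hy : y ∊ V θ) : un x y ∊ V θ := by
  have := hθ.sU (hθ.upair hx hy)
  convert this using 1
  exact ext fun z => by simp

theorem IsLim.prod {a b : M} (ha : a ∊ V θ) (hb : b ∊ V θ) : prod a b ∊ V θ := by
  refine V_subset hθ.1 (hθ.pow (hθ.pow (hθ.un ha hb))) fun p hp => ?_
  obtain ⟨x, y, hx, hy, rfl⟩ := mem_prod.1 hp
  refine mem_pow.2 fun z hz => mem_pow.2 fun w hw => ?_
  rw [mem_un]
  rcases mem_upair.1 hz with rfl | rfl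
  · exact Or.inl (mem_sing.1 hw ▸ hx)
  · rcases mem_upair.1 hw with rfl | rfl
    · exact Or.inl hx
    · exact Or.inr hy

theorem IsLim.of_isFun {f a b : M} (ha : a ∊ V θ) (hb : b ∊ V θ) (hf : IsFun f a b) : f ∊ V θ :=
  V_subset hθ.1 (hθ.prod ha hb) hf.subset_prod

theorem IsLim.funs {a b : M} (ha : a ∊ V θ) (hb : b ∊ V θ) : funs a b ∊ V θ :=
  V_subset hθ.1 (hθ.pow (hθ.prod ha hb)) fun _ hf => mem_pow.2 (mem_funs.1 hf).subset_prod

theorem IsLim.emp : emp M ∊ V θ := ord_subset_V hθ.1 _ hθ.2.1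
theorem IsLim.ord {α : M} (h : α ∊ θ) : α ∊ V θ := ord_subset_V hθ.1 _ h
theorem IsLim.V_mem {α : M} (h : α ∊ θ) : V α ∊ V θ := V_mem_V hθ.1 h
theorem IsLim.om_subset : IsSubset (om M) θ := fun n hn =>
  nat_induction (P := fun n => n ∊ θ) hθ.2.1 (fun n _ h => hθ.2.2 n h) hn
theorem IsLim.num (k : ℕ) : num k ∊ V θ := hθ.ord (hθ.om_subset _ (num_mem_om k))
end

theorem exists_lim_mem_V (x : M) {γ : M} (hγ : IsOrdinal γ) : ∃ θ, IsLim θ ∧ γ ∊ θ ∧ x ∊ V θ := by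
  obtain ⟨α, hα, hx⟩ := exists_mem_V x
  obtain ⟨θ, hθ, h⟩ := exists_lim (ord_un hα hγ)
  have h1 : IsSubset α (un α γ) := fun z hz => by simp [hz]
  have h2 : IsSubset γ (un α γ) := fun z hz => by simp [hz]
  exact ⟨θ, hθ, ord_mem_of_subset_mem hγ hθ.1 h2 h,
    V_mono hα hθ.1 (h1.trans (hθ.1.subset h)) _ hx⟩

/-! ### Choice -/

noncomputable def fst (p : M) : M := mk fun z => ∃ x y, p = pr x y ∧ z ∊ x
noncomputable def snd (p : M) : M := mk fun z => ∃ x y, p = pr x y ∧ z ∊ y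

instance : DF1 (fst : M → M) := ⟨by unfold fst; infer_instance⟩
instance : DF1 (snd : M → M) := ⟨by unfold snd; infer_instance⟩

@[simp] theorem fst_pr (x y : M) : fst (pr x y) = x :=
  (eq_mk fun z => ⟨fun h => ⟨x, y, rfl, h⟩, fun ⟨a, b, e, h⟩ => (pr_inj.1 e).1 ▸ h⟩).symm
@[simp] theorem snd_pr (x y : M) : snd (pr x y) = y :=
  (eq_mk fun z => ⟨fun h => ⟨x, y, rfl, h⟩, fun ⟨a, b, e, h⟩ => (pr_inj.1 e).2 ▸ h⟩).symm

/-- The sets `{x} × x` are pairwise disjoint, so the transversal form of choice applies to them. -/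
theorem exists_choice (F : M) : ∃ c, ∀ x, x ∊ F → (∃ z, z ∊ x) → ap c x ∊ x := by
  have hm : ∀ y, y ∊ img (fun x => prod (sing x) x) (sep F fun x => ∃ z, z ∊ x) ↔
      ∃ x, (x ∊ F ∧ ∃ z, z ∊ x) ∧ y = prod (sing x) x := fun y => by simp only [mem_img, mem_sep]
  obtain ⟨c, hc⟩ := hZ.out.choice (img (fun x => prod (sing x) x) (sep F fun x => ∃ z, z ∊ x)) (by
    intro y hy
    obtain ⟨x, ⟨-, z, hz⟩, rfl⟩ := (hm y).1 hy
    exact ⟨pr x z, pr_mem_prod.2 ⟨by simp, hz⟩⟩) (by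
    intro y y' hy hy' hne z hz
    obtain ⟨x, -, rfl⟩ := (hm y).1 hy
    obtain ⟨x', -, rfl⟩ := (hm y').1 hy'
    obtain ⟨a, b, ha, -, rfl⟩ := mem_prod.1 hz.1
    have h1 := mem_sing.1 (pr_mem_prod.1 hz.2).1
    rw [mem_sing] at ha
    subst ha h1
    exact hne rfl)
  -- The transversal may contain stray pairs `⟨x, z⟩` with `z ∉ x`; they are removed to make it
  -- single-valued at `x`.
  refine ⟨sep c fun p => ∃ x z, x ∊ F ∧ z ∊ x ∧ p = pr x z, fun x hx hne => ?_⟩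
  obtain ⟨p, ⟨hp, hpc⟩, hu⟩ := hc _ ((hm _).2 ⟨x, ⟨hx, hne⟩, rfl⟩)
  obtain ⟨x', z, hx', hz, rfl⟩ := mem_prod.1 hp
  obtain rfl := mem_sing.1 hx'
  rw [ap_eq (y := z) (mem_sep.2 ⟨hpc, _, _, hx, hz, rfl⟩)]
  · exact hz
  · intro w hw
    obtain ⟨hw, a, b, ha, hb, e⟩ := mem_sep.1 hw
    obtain ⟨rfl, rfl⟩ := pr_inj.1 e
    exact (pr_inj.1 (hu _ ⟨pr_mem_prod.2 ⟨by simp, hb⟩, hw⟩)).2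

open Classical in
/-- Every set is equinumerous with an ordinal. -/
theorem exists_bijection_ord (Z : M) : ∃ α h, IsOrdinal α ∧ IsBijection h Z α := by
  obtain ⟨c, hc⟩ := exists_choice (pow Z)
  -- Enumerate `Z` by recursion, choosing a new element each time. The value `Z` signals exhaustion:
  -- by foundation it is not an element of `Z`.
  let G : M → M := fun f => if ∃ z, z ∊ Z ∧ ¬ z ∊ ran f then ap c (sep Z fun z => ¬ z ∊ ran f) else Z
  have hG : DTm fun v : ℕ → M => G (v 0) := by unfold G; infer_instance
  have hT : DF1 (trec G) := ⟨have : DF1 G := ⟨hG⟩; inferInstance⟩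
  have hran : ∀ α y, y ∊ ran (lam α (trec G)) ↔ ∃ β, β ∊ α ∧ y = trec G β := fun α y => by
    rw [mem_ran]
    simp only [pr_mem_lam]
  have h1 : ∀ α, IsOrdinal α → (∃ z, z ∊ Z ∧ ¬ z ∊ ran (lam α (trec G))) →
      trec G α ∊ Z ∧ ∀ β, β ∊ α → trec G β ≠ trec G α := by
    intro α hα hz
    have e : trec G α = ap c (sep Z fun z => ¬ z ∊ ran (lam α (trec G))) := by
      rw [trec_eq hα]
      exact if_pos hz
    have := hc (sep Z fun z => ¬ z ∊ ran (lam α (trec G)))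
      (mem_pow.2 fun z hz => (mem_sep.1 hz).1) (let ⟨z, h⟩ := hz; ⟨z, mem_sep.2 h⟩)
    rw [← e, mem_sep] at this
    exact ⟨this.1, fun β hβ e => this.2 ((hran _ _).2 ⟨β, hβ, e.symm⟩)⟩
  have h2 : ∀ α, IsOrdinal α → trec G α ≠ Z → ∃ z, z ∊ Z ∧ ¬ z ∊ ran (lam α (trec G)) := by
    intro α hα hne
    by_contra hcon
    refine hne ?_
    rw [trec_eq hα]
    exact if_neg hcon
  have hinj : ∀ α β, IsOrdinal α → IsOrdinal β → trec G α ≠ Z → trec G β ≠ Z →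
      trec G α = trec G β → α = β := by
    intro α β hα hβ hα' hβ' e
    rcases ord_trichotomy hα hβ with h | h | h
    · exact absurd e ((h1 β hβ (h2 β hβ hβ')).2 α h)
    · exact h
    · exact absurd e.symm ((h1 α hα (h2 α hα hα')).2 β h)
  -- An enumeration that never stops would inject the class of all ordinals into `Z`.
  have hex : ∃ α, IsOrdinal α ∧ trec G α = Z := by
    by_contra! hcon
    refine not_isSetP_ord (isSetP_of_inj (IsOrdinal : M → Prop) (trec G) (b := Z) ?_ ?_)
    · exact fun α hα => (h1 α hα (h2 α hα (hcon α hα))).1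
    · exact fun α β hα hβ e => hinj α β hα hβ (hcon α hα) (hcon β hβ) e
  obtain ⟨α₀, hα₀, e₀⟩ := hex
  obtain ⟨α, hα, e, hmin⟩ := exists_least_ord (fun α => trec G α = Z) hα₀ e₀
  have hb : IsBijection (lam α (trec G)) α Z := by
    refine sameCard_of_bij _ (fun β hβ => ?_) (fun β γ hβ hγ e => ?_) (fun z hz => ?_)
    · exact (h1 β (hα.mem hβ) (h2 β (hα.mem hβ) (hmin β hβ))).1
    · exact hinj β γ (hα.mem hβ) (hα.mem hγ) (hmin β hβ) (hmin γ hγ) e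
    · by_contra hcon
      have h3 := (h1 α hα ⟨z, hz, fun h => by
        obtain ⟨β, hβ, rfl⟩ := (hran _ _).1 h
        exact hcon ⟨β, hβ, rfl⟩⟩).1
      rw [e] at h3
      exact not_mem_self Z h3
  exact ⟨α, _, hα, hb.symm⟩

/-! ### A function with large images of all large sets of sequences -/

/-- `G : ω × Z^ω → Z` maps `ω × B^ω` onto `Z`, for every `B ⊆ Z` equinumerous with `Z`. -/
def Covers (Z G : M) : Prop :=
  IsFun G (prod (om M) (funs (om M) Z)) Z ∧ ∀ B, IsSubset B Z → SameCard B Z →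
    ∀ z, z ∊ Z → ∃ n y, n ∊ om M ∧ IsFun y (om M) B ∧ pr (pr n y) z ∊ G

instance : DP2 (Covers : M → M → Prop) := ⟨by unfold Covers; infer_instance⟩

/-- Two sequences are eventually equal. -/
def EvEq (y y' : M) : Prop :=
  ∃ N, N ∊ om M ∧ ∀ n, n ∊ om M → ¬ n ∊ N → ap y n = ap y' n

instance : DP2 (EvEq : M → M → Prop) := ⟨by unfold EvEq; infer_instance⟩

theorem EvEq.symm {y y' : M} (h : EvEq y y') : EvEq y' y :=
  let ⟨N, hN, h⟩ := h
  ⟨N, hN, fun n hn hn' => (h n hn hn').symm⟩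

theorem EvEq.trans {x y z : M} (h : EvEq x y) (h' : EvEq y z) : EvEq x z := by
  obtain ⟨N, hN, h⟩ := h
  obtain ⟨N', hN', h'⟩ := h'
  have : ∃ K, K ∊ om M ∧ IsSubset N K ∧ IsSubset N' K := by
    rcases ord_trichotomy (ord_of_nat hN) (ord_of_nat hN') with hl | rfl | hl
    · exact ⟨N', hN', (ord_of_nat hN').subset hl, isSubset_refl _⟩
    · exact ⟨N, hN, isSubset_refl _, isSubset_refl _⟩
    · exact ⟨N, hN, isSubset_refl _, (ord_of_nat hN).subset hl⟩
  obtain ⟨K, hK, h1, h2⟩ := this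
  exact ⟨K, hK, fun n hn hnK => (h n hn fun h => hnK (h1 n h)).trans
    (h' n hn fun h => hnK (h2 n h))⟩

/-- Apply a choice function to the class of `y` under eventual equality; equivalent sequences have
the same class, hence the same representative. -/
theorem exists_representatives (Z : M) : ∃ r, ∀ y, IsFun y (om M) Z →
    IsFun (ap r y) (om M) Z ∧ EvEq y (ap r y) ∧
      ∀ y', IsFun y' (om M) Z → EvEq y y' → ap r y = ap r y' := by
  obtain ⟨c, hc⟩ := exists_choice (pow (funs (om M) Z))
  have hr : ∀ y, IsFun y (om M) Z →
      ap (lam (funs (om M) Z) fun y => ap c (sep (funs (om M) Z) fun x => EvEq y x)) y =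
        ap c (sep (funs (om M) Z) fun x => EvEq y x) := fun y hy => ap_lam (mem_funs.2 hy)
  refine ⟨lam (funs (om M) Z) fun y => ap c (sep (funs (om M) Z) fun x => EvEq y x),
    fun y hy => ?_⟩
  have h1 := hc (sep (funs (om M) Z) fun x => EvEq y x) (mem_pow.2 fun z hz => (mem_sep.1 hz).1)
    ⟨y, mem_sep.2 ⟨mem_funs.2 hy, emp M, emp_mem_om, fun _ _ _ => rfl⟩⟩
  rw [mem_sep] at h1
  refine ⟨?_, ?_, fun y' hy' he => ?_⟩
  · rw [hr y hy]
    exact mem_funs.1 h1.1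
  · rw [hr y hy]
    exact h1.2
  · rw [hr y hy, hr y' hy']
    congr 1
    refine ext fun z => ?_
    rw [mem_sep, mem_sep]
    exact and_congr_right fun _ => ⟨he.symm.trans, he.trans⟩

open Classical in
-- If every `A` fails, iterate failures to get `Z = S 0 ⊇ S 1 ⊇ …`, all of full size, and points `s
-- n ∊ S n` that are never a value of `r y` for a sequence `y` in `S (n + 1)`. The representative of
-- the sequence `s` agrees with `s` at some `N` and beyond. Changing `s` on an initial segment gives
-- an equivalent sequence inside `S (N + 1)`, whose representative takes the value `s N` at `N`, a
-- contradiction.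
theorem exists_covering_subset {Z r : M} (hr : ∀ y, IsFun y (om M) Z →
    IsFun (ap r y) (om M) Z ∧ EvEq y (ap r y) ∧
      ∀ y', IsFun y' (om M) Z → EvEq y y' → ap r y = ap r y') :
    ∃ A, IsSubset A Z ∧ SameCard A Z ∧ ∀ B, IsSubset B A → SameCard B Z → ∀ z, z ∊ A →
      ∃ n y, n ∊ om M ∧ IsFun y (om M) B ∧ ap (ap r y) n = z := by
  by_contra! hcon
  obtain ⟨d, hd⟩ := exists_choice (pow (prod (pow Z) Z))
  -- The pairs `⟨B, z⟩` witnessing that `A` fails, from which `d` chooses one.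
  let Q : M → M := fun A => sep (prod (pow Z) Z) fun p => IsSubset (fst p) A ∧
    SameCard (fst p) Z ∧ snd p ∊ A ∧ ∀ n y, n ∊ om M → IsFun y (om M) (fst p) → ap (ap r y) n ≠ snd p
  have hQ : DF1 Q := ⟨by unfold Q; infer_instance⟩
  let S : M → M := nrec Z fun A => fst (ap d (Q A))
  have hS : DF1 S := ⟨by unfold S; infer_instance⟩
  have step : ∀ A, IsSubset A Z → SameCard A Z → IsSubset (fst (ap d (Q A))) A ∧
      SameCard (fst (ap d (Q A))) Z ∧ snd (ap d (Q A)) ∊ A ∧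
        ∀ n y, n ∊ om M → IsFun y (om M) (fst (ap d (Q A))) → ap (ap r y) n ≠ snd (ap d (Q A)) := by
    intro A hA hAZ
    have := hd (Q A) (mem_pow.2 fun z hz => (mem_sep.1 hz).1) (by
      obtain ⟨B, hB, hBZ, z, hz, h⟩ := hcon A hA hAZ
      exact ⟨pr B z, mem_sep.2 ⟨pr_mem_prod.2 ⟨mem_pow.2 (hB.trans hA), hA z hz⟩, by
        simpa using ⟨hB, hBZ, hz, h⟩⟩⟩)
    exact (mem_sep.1 this).2
  have hSs : ∀ n, n ∊ om M → S (sc n) = fst (ap d (Q (S n))) := fun n hn => nrec_succ hn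
  have hS0 : S (emp M) = Z := nrec_zero
  clear_value S
  have hS1 : ∀ n, n ∊ om M → IsSubset (S n) Z ∧ SameCard (S n) Z := fun n hn => by
    refine nat_induction (P := fun n => IsSubset (S n) Z ∧ SameCard (S n) Z) ?_ ?_ hn
    · rw [hS0]
      exact ⟨isSubset_refl _, sameCard_refl _⟩
    · rintro n hn ⟨h1, h2⟩
      rw [hSs n hn]
      exact ⟨(step _ h1 h2).1.trans h1, (step _ h1 h2).2.1⟩
  have hdec : ∀ n m, n ∊ om M → m ∊ om M → ¬ m ∊ n → IsSubset (S m) (S n) := fun n m hn hm => by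
    refine nat_induction (P := fun m => ¬ m ∊ n → IsSubset (S m) (S n)) ?_ ?_ hm
    · intro h
      rcases ord_trichotomy (ord_of_nat hn) ord_emp with h' | rfl | h'
      · exact absurd h' not_mem_emp
      · exact isSubset_refl _
      · exact absurd h' h
    · intro m hm ih h
      rcases ord_trichotomy (ord_of_nat hn) (ord_of_nat (sc_mem_om hm)) with h' | rfl | h'
      · have hmn : ¬ m ∊ n := (ord_not_mem (ord_of_nat hm) (ord_of_nat hn)).2 (by
          rcases mem_sc.1 h' with h' | rfl
          · exact (ord_of_nat hm).subset h'
          · exact isSubset_refl _)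
        rw [hSs m hm]
        exact (step _ (hS1 m hm).1 (hS1 m hm).2).1.trans (ih hmn)
      · exact isSubset_refl _
      · exact absurd h' h
  let s : M := lam (om M) fun n => snd (ap d (Q (S n)))
  have hs : ∀ n, n ∊ om M → ap s n = snd (ap d (Q (S n))) := fun n hn => ap_lam hn
  have hs0 : IsFunOn s (om M) := isFunOn_lam
  clear_value s
  have hsS : ∀ n, n ∊ om M → ap s n ∊ S n := fun n hn => by
    rw [hs n hn]
    exact (step _ (hS1 n hn).1 (hS1 n hn).2).2.2.1
  have hsf : IsFun s (om M) Z := isFun_iff.2 ⟨hs0, fun n hn => (hS1 n hn).1 _ (hsS n hn)⟩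
  obtain ⟨-, ⟨N, hN, hNs⟩, hrs⟩ := hr s hsf
  have hN' := sc_mem_om hN
  -- The entries of `s` up to `N` may lie outside `S (sc N)`; they are overwritten by `s (N + 1)`,
  -- which lies inside.
  let y : M := lam (om M) fun k => if k ∊ sc N then ap s (sc N) else ap s k
  have hy : ∀ k, k ∊ om M → ap y k = if k ∊ sc N then ap s (sc N) else ap s k := fun k hk => ap_lam hk
  have hyf : IsFun y (om M) (S (sc N)) := isFun_iff.2 ⟨isFunOn_lam, fun k hk => by
    rw [hy k hk]
    split_ifs with h
    · exact hsS _ hN'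
    · exact hdec _ _ hN' hk h _ (hsS k hk)⟩
  have hsy : EvEq s y := ⟨sc N, hN', fun k hk hk' => by rw [hy k hk, if_neg hk']⟩
  have e := hrs y (hyf.mono (hS1 _ hN').1) hsy
  refine (step _ (hS1 N hN).1 (hS1 N hN).2).2.2.2 N y hN (by rwa [← hSs N hN]) ?_
  rw [← e, ← hNs N hN (not_mem_self N), hs N hN]

open Classical in
-- Transport the property of the subset `A` to `Z` along a bijection `h : A → Z`: send `⟨n, y⟩` to
-- `h` of the `n`-th term of the representative of `h⁻¹ ∘ y`. When that term is not in `A`, the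
-- value `y 0` serves as an arbitrary element of `Z`.
theorem exists_covers (Z : M) : ∃ G, Covers Z G := by
  obtain ⟨r, hr⟩ := exists_representatives Z
  obtain ⟨A, hAZ, ⟨h, hh⟩, hA⟩ := exists_covering_subset hr
  let F : M → M := fun p => ap (ap r (comp (inv h) (snd p))) (fst p)
  have hF : DF1 F := ⟨by unfold F; infer_instance⟩
  refine ⟨lam (prod (om M) (funs (om M) Z)) fun p => if F p ∊ A then ap h (F p) else
    ap (snd p) (emp M), isFun_lam fun p hp => ?_, fun B hB hBZ z hz => ?_⟩
  · obtain ⟨n, y, hn, hy, rfl⟩ := mem_prod.1 hp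
    split_ifs with hc
    · exact hh.1.ap_mem hc
    · rw [snd_pr]
      exact (mem_funs.1 hy).ap_mem emp_mem_om
  · have hB' : IsBijection (lam B fun b => ap (inv h) b) B (img (fun b => ap (inv h) b) B) := by
      refine sameCard_of_bij _ (fun b hb => mem_img.2 ⟨b, hb, rfl⟩) (fun b b' hb hb' e => ?_)
        fun y hy => ?_
      · rw [← (hh.ap_inv (hB b hb)).2, ← (hh.ap_inv (hB b' hb')).2, e]
      · obtain ⟨b, hb, rfl⟩ := mem_img.1 hy
        exact ⟨b, hb, rfl⟩
    obtain ⟨n, y, hn, hy, e⟩ := hA (img (fun b => ap (inv h) b) B) (fun x hx => by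
      obtain ⟨b, hb, rfl⟩ := mem_img.1 hx
      exact (hh.ap_inv (hB b hb)).1) ((SameCard.symm ⟨_, hB'⟩).trans hBZ) (ap (inv h) z)
      (hh.ap_inv hz).1
    have hyb : ∀ k, k ∊ om M → ∃ b, b ∊ B ∧ ap y k = ap (inv h) b := fun k hk => mem_img.1 (hy.ap_mem hk)
    have hyA : IsFun y (om M) A := isFun_iff.2 ⟨hy.1, fun k hk => by
      obtain ⟨b, hb, e⟩ := hyb k hk
      rw [e]
      exact (hh.ap_inv (hB b hb)).1⟩
    have hcy : IsFun (comp h y) (om M) B := isFun_iff.2 ⟨isFunOn_comp hy.1, fun k hk => by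
      obtain ⟨b, hb, e⟩ := hyb k hk
      rw [ap_comp hy.1 hk, e, (hh.ap_inv (hB b hb)).2]
      exact hb⟩
    have hcc : comp (inv h) (comp h y) = y :=
      (isFunOn_comp hcy.1).ext hy.1 fun k hk => by
        rw [ap_comp hcy.1 hk, ap_comp hy.1 hk, hh.inv_ap (hyA.ap_mem hk)]
    refine ⟨n, comp h y, hn, hcy, pr_mem_lam.2
      ⟨pr_mem_prod.2 ⟨hn, mem_funs.2 (hcy.mono hB)⟩, ?_⟩⟩
    have hFe : F (pr n (comp h y)) = ap (inv h) z := by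
      unfold F
      rw [snd_pr, fst_pr, hcc, e]
    rw [hFe, if_pos (hh.ap_inv hz).1, (hh.ap_inv hz).2]

/-! ### Formulas -/

@[simp] theorem isAssignment_iff {s D : M} : IsAssignment s D ↔ IsFun s (om M) D := by
  simp [IsAssignment]

theorem isVarTuple_iff {L r t : M} : IsVarTuple L r t ↔ ∃ n, pr r n ∊ L ∧ IsFun t n (om M) := by
  simp [IsVarTuple, app_iff]

theorem formulaClosed_iff {L X : M} : FormulaClosed L X ↔
    (∀ i j, i ∊ om M → j ∊ om M → code 0 i j ∊ X) ∧
    (∀ r t, IsVarTuple L r t → code 1 r t ∊ X) ∧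
    (∀ a, a ∊ X → code 2 a a ∊ X) ∧
    (∀ a b, a ∊ X → b ∊ X → code 3 a b ∊ X) ∧
    (∀ i a, i ∊ om M → a ∊ X → code 4 i a ∊ X) := by
  simp only [FormulaClosed, isNat_iff, isCode_iff]
  exact ⟨fun ⟨h0, h1, h2, h3, h4⟩ => ⟨fun i j hi hj => h0 i j _ hi hj rfl,
    fun r t h => h1 r t _ h rfl, fun a h => h2 a _ h rfl, fun a b h h' => h3 a b _ h h' rfl,
    fun i a h h' => h4 i a _ h h' rfl⟩,
    fun ⟨h0, h1, h2, h3, h4⟩ => ⟨fun i j c hi hj e => e ▸ h0 i j hi hj,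
    fun r t c h e => e ▸ h1 r t h, fun a c h e => e ▸ h2 a h, fun a b c h h' e => e ▸ h3 a b h h',
    fun i a c h h' e => e ▸ h4 i a h h'⟩⟩

theorem isFormula_eq {L i j : M} (hi : i ∊ om M) (hj : j ∊ om M) : IsFormula L (code 0 i j) :=
  fun _ hX => (formulaClosed_iff.1 hX).1 i j hi hj
theorem isFormula_rel {L r t : M} (h : IsVarTuple L r t) : IsFormula L (code 1 r t) :=
  fun _ hX => (formulaClosed_iff.1 hX).2.1 r t h
theorem isFormula_neg {L a : M} (h : IsFormula L a) : IsFormula L (code 2 a a) :=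
  fun X hX => (formulaClosed_iff.1 hX).2.2.1 a (h X hX)
theorem isFormula_and {L a b : M} (h : IsFormula L a) (h' : IsFormula L b) :
    IsFormula L (code 3 a b) :=
  fun X hX => (formulaClosed_iff.1 hX).2.2.2.1 a b (h X hX) (h' X hX)
theorem isFormula_ex {L i a : M} (hi : i ∊ om M) (h : IsFormula L a) : IsFormula L (code 4 i a) :=
  fun X hX => (formulaClosed_iff.1 hX).2.2.2.2 i a hi (h X hX)

theorem IsLim.code {θ : M} (hθ : IsLim θ) (k : ℕ) {a b : M} (ha : a ∊ V θ) (hb : b ∊ V θ) :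
    code k a b ∊ V θ := hθ.pr (hθ.num k) (hθ.pr ha hb)

theorem mem_V_of_pr {θ x y : M} (hθ : IsOrdinal θ) (h : pr x y ∊ V θ) : x ∊ V θ ∧ y ∊ V θ := by
  have h1 : upair x y ∊ V θ := V_trans hθ h (mem_upair.2 (Or.inr rfl))
  exact ⟨V_trans hθ h1 (mem_upair.2 (Or.inl rfl)), V_trans hθ h1 (mem_upair.2 (Or.inr rfl))⟩

theorem formulaClosed_V {L θ : M} (hθ : IsLim θ) (hom : om M ∊ θ) (hL : L ∊ V θ) :
    FormulaClosed L (V θ) := by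
  have hn : ∀ i, i ∊ om M → i ∊ V θ := fun i hi => hθ.ord (hθ.om_subset i hi)
  refine formulaClosed_iff.2 ⟨fun i j hi hj => hθ.code 0 (hn i hi) (hn j hj), fun r t h => ?_,
    fun a h => hθ.code 2 h h, fun a b h h' => hθ.code 3 h h', fun i a h h' => hθ.code 4 (hn i h) h'⟩
  obtain ⟨n, hrn, ht⟩ := isVarTuple_iff.1 h
  have := mem_V_of_pr hθ.1 (V_trans hθ.1 hL hrn)
  exact hθ.code 1 this.1 (hθ.of_isFun this.2 (hθ.ord hom) ht)

theorem exists_formulaClosed (L : M) : ∃ θ, IsLim θ ∧ FormulaClosed L (V θ) := by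
  obtain ⟨θ, hθ, h1, h2⟩ := exists_lim_mem_V L ord_om
  exact ⟨θ, hθ, formulaClosed_V hθ h1 h2⟩

/-- A formula lies in every closed set, but the formulas satisfying `P` must first be known to form
a set; they are separated from a level `V θ` closed under formula formation. -/
theorem formula_induction {L : M} {P : M → Prop} [h : Dfn fun v : ℕ → M => P (v 0)]
    (h0 : ∀ i j, i ∊ om M → j ∊ om M → P (code 0 i j))
    (h1 : ∀ r t, IsVarTuple L r t → P (code 1 r t))
    (h2 : ∀ a, IsFormula L a → P a → P (code 2 a a))
    (h3 : ∀ a b, IsFormula L a → IsFormula L b → P a → P b → P (code 3 a b))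
    (h4 : ∀ i a, i ∊ om M → IsFormula L a → P a → P (code 4 i a))
    {φ : M} (hφ : IsFormula L φ) : P φ := by
  have : DP1 P := ⟨h⟩
  obtain ⟨θ, hθ, hc⟩ := exists_formulaClosed L
  have hm : ∀ c, c ∊ sep (V θ) (fun c => IsFormula L c ∧ P c) ↔ IsFormula L c ∧ P c := fun c => by
    rw [mem_sep]
    exact ⟨fun h => h.2, fun h => ⟨h.1 _ hc, h⟩⟩
  refine ((hm φ).1 (hφ (sep (V θ) fun c => IsFormula L c ∧ P c) (formulaClosed_iff.2 ?_))).2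
  simp only [hm]
  exact ⟨fun i j hi hj => ⟨isFormula_eq hi hj, h0 i j hi hj⟩,
    fun r t ht => ⟨isFormula_rel ht, h1 r t ht⟩,
    fun a ha => ⟨isFormula_neg ha.1, h2 a ha.1 ha.2⟩,
    fun a b ha hb => ⟨isFormula_and ha.1 hb.1, h3 a b ha.1 hb.1 ha.2 hb.2⟩,
    fun i a hi ha => ⟨isFormula_ex hi ha.1, h4 i a hi ha.1 ha.2⟩⟩

/-! ### Satisfaction -/

/-- The value of an atomic formula. -/
def AtomHolds (I r t s : M) : Prop :=
  ∃ R u, pr r R ∊ I ∧ u ∊ R ∧ ∀ k x, pr k x ∊ u ↔ ∃ i, pr k i ∊ t ∧ pr i x ∊ s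

instance : DP4 (AtomHolds : M → M → M → M → Prop) := ⟨by unfold AtomHolds; infer_instance⟩

theorem isTruth_iff {L D I T : M} : IsTruth L D I T ↔ ∀ s, IsFun s (om M) D →
    (∀ i j, i ∊ om M → j ∊ om M → (pr (code 0 i j) s ∊ T ↔ ap s i = ap s j)) ∧
    (∀ r t, IsVarTuple L r t → (pr (code 1 r t) s ∊ T ↔ AtomHolds I r t s)) ∧
    (∀ a, IsFormula L a → (pr (code 2 a a) s ∊ T ↔ ¬ pr a s ∊ T)) ∧
    (∀ a b, IsFormula L a → IsFormula L b → (pr (code 3 a b) s ∊ T ↔ pr a s ∊ T ∧ pr b s ∊ T)) ∧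
    (∀ i a, i ∊ om M → IsFormula L a → (pr (code 4 i a) s ∊ T ↔ ∃ s', IsFun s' (om M) D ∧
      pr a s' ∊ T ∧ ∀ k x, k ≠ i → (pr k x ∊ s' ↔ pr k x ∊ s))) := by
  have he : ∀ s i j, IsFun s (om M) D → i ∊ om M → j ∊ om M →
      ((∃ x, pr i x ∊ s ∧ pr j x ∊ s) ↔ ap s i = ap s j) := fun s i j hs hi hj => by
    simp only [hs.1.pr_mem, hi, hj, true_and]
    exact ⟨fun ⟨x, h, h'⟩ => h.symm.trans h', fun h => ⟨_, rfl, h⟩⟩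
  simp only [IsTruth, isNat_iff, isCode_iff, app_iff, isAssignment_iff, AtomHolds]
  refine forall_congr' fun s => imp_congr_right fun hs => ?_
  refine and_congr ⟨fun h i j hi hj => (h i j _ hi hj rfl).trans (he s i j hs hi hj),
      fun h i j c hi hj e => e ▸ (h i j hi hj).trans (he s i j hs hi hj).symm⟩
    (and_congr ⟨fun h r t hr => h r t _ hr rfl, fun h r t c hr e => e ▸ h r t hr⟩
    (and_congr ⟨fun h a ha => h a _ ha rfl, fun h a c ha e => e ▸ h a ha⟩
    (and_congr ⟨fun h a b ha hb => h a b _ ha hb rfl, fun h a b c ha hb e => e ▸ h a b ha hb⟩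
    ⟨fun h i a hi ha => h i a _ hi ha rfl, fun h i a c hi ha e => e ▸ h i a hi ha⟩)))

/-- One step of the recursive definition of truth. -/
def TruthStep (L D I c s X : M) : Prop :=
  (∃ i j, c = code 0 i j ∧ ap s i = ap s j) ∨
  (∃ r t, c = code 1 r t ∧ AtomHolds I r t s) ∨
  (∃ a, c = code 2 a a ∧ ¬ pr a s ∊ X) ∨
  (∃ a b, c = code 3 a b ∧ pr a s ∊ X ∧ pr b s ∊ X) ∨
  (∃ i a, c = code 4 i a ∧ ∃ s', IsFun s' (om M) D ∧
      pr a s' ∊ X ∧ ∀ k x, k ≠ i → (pr k x ∊ s' ↔ pr k x ∊ s))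

set_option synthInstance.maxHeartbeats 400000 in
set_option synthInstance.maxSize 1000 in
instance : DP6 (TruthStep : M → M → M → M → M → M → Prop) :=
  ⟨by unfold TruthStep; infer_instance⟩

/-- Truth of a code refers to `X` only at the immediate components of that code. -/
theorem TruthStep.congr {L D I c s X X' : M} (hs : IsFun s (om M) D)
    (h : ∀ k a b, c = code k a b → ∀ s', IsFun s' (om M) D →
      (pr a s' ∊ X ↔ pr a s' ∊ X') ∧ (pr b s' ∊ X ↔ pr b s' ∊ X')) :
    TruthStep L D I c s X ↔ TruthStep L D I c s X' := by
  unfold TruthStep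
  refine or_congr Iff.rfl (or_congr Iff.rfl (or_congr ?_ (or_congr ?_ ?_)))
  · exact exists_congr fun a => and_congr_right fun e => not_congr (h _ _ _ e s hs).1
  · exact exists_congr fun a => exists_congr fun b => and_congr_right fun e =>
      and_congr (h _ _ _ e s hs).1 (h _ _ _ e s hs).2
  · exact exists_congr fun i => exists_congr fun a => and_congr_right fun e =>
      exists_congr fun s' => and_congr_right fun hs' => and_congr_left fun _ => (h _ _ _ e s' hs').2

/-- Level `α` decides the codes in `V α` from the union of the earlier levels. Recursion on rank
replaces recursion on formulas, since components of a code have smaller rank. -/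
noncomputable def truthLevel (L D I α : M) : M :=
  trec (fun f => sep (prod (V (dom f)) (funs (om M) D)) fun p =>
    TruthStep L D I (fst p) (snd p) (sU (ran f))) α

instance (L D I : M) : DF1 (truthLevel L D I) := ⟨by unfold truthLevel; infer_instance⟩

theorem mem_truthLevel {L D I α c s : M} (hα : IsOrdinal α) : pr c s ∊ truthLevel L D I α ↔
    c ∊ V α ∧ IsFun s (om M) D ∧ TruthStep L D I c s (sU (ran (lam α (truthLevel L D I)))) := by
  have e : truthLevel L D I α = _ := trec_eq hα
  change _ = sep (prod (V (dom (lam α (truthLevel L D I)))) (funs (om M) D)) (fun p =>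
    TruthStep L D I (fst p) (snd p) (sU (ran (lam α (truthLevel L D I))))) at e
  have h1 : IsFunOn (lam α (truthLevel L D I)) α := isFunOn_lam
  rw [e, mem_sep, pr_mem_prod, fst_pr, snd_pr, h1.dom_eq, mem_funs, and_assoc]

theorem mem_sU_truthLevel {L D I α p : M} : p ∊ sU (ran (lam α (truthLevel L D I))) ↔
    ∃ β, β ∊ α ∧ p ∊ truthLevel L D I β := by
  simp only [mem_sU, mem_ran, pr_mem_lam]
  constructor
  · rintro ⟨_, ⟨β, hβ, rfl⟩, h⟩
    exact ⟨β, hβ, h⟩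
  · rintro ⟨β, hβ, h⟩
    exact ⟨_, ⟨β, hβ, rfl⟩, h⟩

/-- Two levels decide their common codes alike: the components of such a code already lie in earlier
`V β` and `V β'`, where the induction hypothesis compares the levels. -/
theorem truthLevel_coherent {L D I α : M} (hα : IsOrdinal α) : ∀ α' c s, IsOrdinal α' →
    IsFun s (om M) D → c ∊ V α → c ∊ V α' →
      (pr c s ∊ truthLevel L D I α ↔ pr c s ∊ truthLevel L D I α') := by
  refine ord_induction (P := fun α => ∀ α' c s, IsOrdinal α' →
    IsFun s (om M) D → c ∊ V α → c ∊ V α' →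
      (pr c s ∊ truthLevel L D I α ↔ pr c s ∊ truthLevel L D I α')) ?_ hα
  intro α hα ih α' c s hα' hs hc hc'
  rw [mem_truthLevel hα, mem_truthLevel hα']
  simp only [hc, hc', hs, true_and]
  obtain ⟨β, hβ, hcβ⟩ := (mem_V hα).1 hc
  obtain ⟨β', hβ', hcβ'⟩ := (mem_V hα').1 hc'
  have oβ := hα.mem hβ
  have oβ' := hα'.mem hβ'
  have key : ∀ a, a ∊ V β → a ∊ V β' → ∀ s, IsFun s (om M) D →
      (pr a s ∊ sU (ran (lam α (truthLevel L D I))) ↔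
        pr a s ∊ sU (ran (lam α' (truthLevel L D I)))) := by
    intro a ha ha' s hs
    rw [mem_sU_truthLevel, mem_sU_truthLevel]
    constructor
    · rintro ⟨δ, hδ, h⟩
      have haδ := ((mem_truthLevel (hα.mem hδ)).1 h).1
      exact ⟨β', hβ', (ih δ hδ β' a s oβ' hs haδ ha').1 h⟩
    · rintro ⟨δ, hδ, h⟩
      have haδ := ((mem_truthLevel (hα'.mem hδ)).1 h).1
      exact ⟨β, hβ, (ih β hβ δ a s (hα'.mem hδ) hs ha haδ).2 h⟩
  refine TruthStep.congr hs fun k a b e s' hs' => ?_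
  have hp : ∀ γ, IsOrdinal γ → IsSubset c (V γ) → a ∊ V γ ∧ b ∊ V γ := fun γ hγ h => by
    subst e
    have h1 : upair (num k) (pr a b) ∊ V γ := h _ (mem_upair.2 (Or.inr rfl))
    exact mem_V_of_pr hγ (V_trans hγ h1 (mem_upair.2 (Or.inr rfl)))
  have h1 := hp β oβ hcβ
  have h2 := hp β' oβ' hcβ'
  exact ⟨key a h1.1 h2.1 s' hs', key b h1.2 h2.2 s' hs'⟩

/-- At a limit `θ` with `V θ` closed under formula formation, level `θ` agrees on `V θ` with the
union of the earlier levels, so on formulas it is a fixed point of `TruthStep`. -/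
theorem exists_truth (L D I : M) : ∃ T, IsTruth L D I T := by
  obtain ⟨θ, hθ, hc⟩ := exists_formulaClosed L
  have hV : ∀ φ, IsFormula L φ → φ ∊ V θ := fun φ hφ => hφ _ hc
  have key : ∀ a s, a ∊ V θ → IsFun s (om M) D →
      (pr a s ∊ sU (ran (lam θ (truthLevel L D I))) ↔ pr a s ∊ truthLevel L D I θ) := by
    intro a s ha hs
    obtain ⟨β, hβ, haβ⟩ := hθ.exists_of_mem ha
    rw [mem_sU_truthLevel]
    constructor
    · rintro ⟨δ, hδ, h⟩
      exact (truthLevel_coherent (hθ.1.mem hδ) θ a s hθ.1 hs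
        ((mem_truthLevel (hθ.1.mem hδ)).1 h).1 ha).1 h
    · exact fun h => ⟨β, hβ, (truthLevel_coherent (hθ.1.mem hβ) θ a s hθ.1 hs haβ ha).2 h⟩
  have key' : ∀ c s, IsFun s (om M) D → IsFormula L c → (pr c s ∊ truthLevel L D I θ ↔
      TruthStep L D I c s (truthLevel L D I θ)) := by
    intro c s hs hcf
    rw [mem_truthLevel hθ.1]
    simp only [hV c hcf, hs, true_and]
    refine TruthStep.congr hs fun k a b e s' hs' => ?_
    have h1 := hV c hcf
    rw [e] at h1
    have h2 := mem_V_of_pr hθ.1 (mem_V_of_pr hθ.1 h1).2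
    exact ⟨key a s' h2.1 hs', key b s' h2.2 hs'⟩
  refine ⟨truthLevel L D I θ, isTruth_iff.2 fun s hs => ⟨fun i j hi hj => ?_, fun r t ht => ?_,
    fun a ha => ?_, fun a b ha hb => ?_, fun i a hi ha => ?_⟩⟩
  · rw [key' _ s hs (isFormula_eq hi hj)]
    simp [TruthStep, code_inj]
  · rw [key' _ s hs (isFormula_rel ht)]
    simp [TruthStep, code_inj]
  · rw [key' _ s hs (isFormula_neg ha)]
    simp [TruthStep, code_inj]
  · rw [key' _ s hs (isFormula_and ha hb)]
    simp [TruthStep, code_inj]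
  · rw [key' _ s hs (isFormula_ex hi ha)]
    simp [TruthStep, code_inj]

theorem IsTruth.unique {L D I T T' φ : M} (h : IsTruth L D I T) (h' : IsTruth L D I T')
    (hφ : IsFormula L φ) : ∀ s, IsFun s (om M) D → (pr φ s ∊ T ↔ pr φ s ∊ T') := by
  rw [isTruth_iff] at h h'
  refine formula_induction (P := fun φ => ∀ s, IsFun s (om M) D → (pr φ s ∊ T ↔ pr φ s ∊ T'))
    ?_ ?_ ?_ ?_ ?_ hφ
  · exact fun i j hi hj s hs => ((h s hs).1 i j hi hj).trans ((h' s hs).1 i j hi hj).symm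
  · exact fun r t ht s hs => ((h s hs).2.1 r t ht).trans ((h' s hs).2.1 r t ht).symm
  · intro a ha ih s hs
    rw [(h s hs).2.2.1 a ha, (h' s hs).2.2.1 a ha, ih s hs]
  · intro a b ha hb iha ihb s hs
    rw [(h s hs).2.2.2.1 a b ha hb, (h' s hs).2.2.2.1 a b ha hb, iha s hs, ihb s hs]
  · intro i a hi ha ih s hs
    rw [(h s hs).2.2.2.2 i a hi ha, (h' s hs).2.2.2.2 i a hi ha]
    exact exists_congr fun s' => and_congr_right fun hs' => and_congr_left fun _ => ih s' hs'

section
variable {L D I : M}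

theorem IsTruth.sat_iff {T φ s : M} (hT : IsTruth L D I T) (hφ : IsFormula L φ)
    (hs : IsFun s (om M) D) : Sat L D I φ s ↔ pr φ s ∊ T := by
  simp only [Sat, app_iff]
  exact ⟨fun ⟨T', h, h'⟩ => (h.unique hT hφ s hs).1 h', fun h => ⟨T, hT, h⟩⟩

theorem sat_eq {i j s : M} (hs : IsFun s (om M) D) (hi : i ∊ om M) (hj : j ∊ om M) :
    Sat L D I (code 0 i j) s ↔ ap s i = ap s j := by
  obtain ⟨T, hT⟩ := exists_truth L D I
  rw [hT.sat_iff (isFormula_eq hi hj) hs, (isTruth_iff.1 hT s hs).1 i j hi hj]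

/-- The truth definition determines only which pairs belong to `u`. The hypothesis `hI` says that
`u` consists of pairs, which identifies it with `comp s t`. -/
theorem sat_rel {n r t s : M} (hs : IsFun s (om M) D) (hr : pr r n ∊ L) (ht : IsFun t n (om M))
    (hI : ∀ R u, pr r R ∊ I → u ∊ R → ∃ n, IsFunOn u n) :
    Sat L D I (code 1 r t) s ↔ ∃ R, pr r R ∊ I ∧ comp s t ∊ R := by
  obtain ⟨T, hT⟩ := exists_truth L D I
  have hrt : IsVarTuple L r t := isVarTuple_iff.2 ⟨n, hr, ht⟩
  rw [hT.sat_iff (isFormula_rel hrt) hs, (isTruth_iff.1 hT s hs).2.1 r t hrt, AtomHolds]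
  have hst := isFun_comp hs ht
  have hc : ∀ k x, pr k x ∊ comp s t ↔ ∃ i, pr k i ∊ t ∧ pr i x ∊ s := fun k x => by
    rw [hst.1.pr_mem]
    simp only [ht.1.pr_mem, hs.1.pr_mem]
    constructor
    · rintro ⟨hk, rfl⟩
      exact ⟨_, ⟨hk, rfl⟩, ht.ap_mem hk, ap_comp ht.1 hk⟩
    · rintro ⟨_, ⟨hk, rfl⟩, -, rfl⟩
      exact ⟨hk, (ap_comp ht.1 hk).symm⟩
  constructor
  · rintro ⟨R, u, hR, hu, h⟩
    obtain ⟨m, hm⟩ := hI R u hR hu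
    have : u = comp s t := by
      refine ext fun p => ⟨fun hp => ?_, fun hp => ?_⟩
      · obtain ⟨x, -, rfl⟩ := hm.mem_iff.1 hp
        exact (hc _ _).2 ((h _ _).1 hp)
      · obtain ⟨x, -, rfl⟩ := hst.1.mem_iff.1 hp
        exact (h _ _).2 ((hc _ _).1 hp)
    exact ⟨R, hR, this ▸ hu⟩
  · rintro ⟨R, hR, hu⟩
    exact ⟨R, _, hR, hu, hc⟩

theorem sat_neg {a s : M} (hs : IsFun s (om M) D) (ha : IsFormula L a) :
    Sat L D I (code 2 a a) s ↔ ¬ Sat L D I a s := by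
  obtain ⟨T, hT⟩ := exists_truth L D I
  rw [hT.sat_iff (isFormula_neg ha) hs, hT.sat_iff ha hs, (isTruth_iff.1 hT s hs).2.2.1 a ha]

theorem sat_and {a b s : M} (hs : IsFun s (om M) D) (ha : IsFormula L a) (hb : IsFormula L b) :
    Sat L D I (code 3 a b) s ↔ Sat L D I a s ∧ Sat L D I b s := by
  obtain ⟨T, hT⟩ := exists_truth L D I
  rw [hT.sat_iff (isFormula_and ha hb) hs, hT.sat_iff ha hs, hT.sat_iff hb hs,
    (isTruth_iff.1 hT s hs).2.2.2.1 a b ha hb]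

open Classical in
/-- The assignment `s` with the value at `i` changed to `x`. -/
noncomputable def upd (s i x : M) : M := lam (om M) fun k => if k = i then x else ap s k

instance : DF3 (upd : M → M → M → M) := ⟨by unfold upd; infer_instance⟩

open Classical in
theorem ap_upd {s i x k : M} (hk : k ∊ om M) : ap (upd s i x) k = if k = i then x else ap s k :=
  ap_lam hk

open Classical in
theorem isFun_upd {s i x : M} (hs : IsFun s (om M) D) (hx : x ∊ D) : IsFun (upd s i x) (om M) D :=
  isFun_iff.2 ⟨isFunOn_lam, fun k hk => by
    rw [ap_upd hk]
    split_ifs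
    · exact hx
    · exact hs.ap_mem hk⟩

open Classical in
theorem sat_ex {i a s : M} (hs : IsFun s (om M) D) (hi : i ∊ om M) (ha : IsFormula L a) :
    Sat L D I (code 4 i a) s ↔ ∃ x, x ∊ D ∧ Sat L D I a (upd s i x) := by
  obtain ⟨T, hT⟩ := exists_truth L D I
  rw [hT.sat_iff (isFormula_ex hi ha) hs, (isTruth_iff.1 hT s hs).2.2.2.2 i a hi ha]
  constructor
  · rintro ⟨s', hs', h, he⟩
    refine ⟨ap s' i, hs'.ap_mem hi, ?_⟩
    have e : upd s i (ap s' i) = s' := (isFun_upd hs (hs'.ap_mem hi)).1.ext hs'.1 fun k hk => by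
      rw [ap_upd hk]
      split_ifs with hki
      · rw [hki]
      · exact ((hs.1.pr_mem.1 ((he k _ hki).1 (hs'.1.ap_mem hk))).2).symm
    rwa [e, hT.sat_iff ha hs']
  · rintro ⟨x, hx, h⟩
    have hu := isFun_upd (i := i) hs hx
    refine ⟨upd s i x, hu, (hT.sat_iff ha hu).1 h, fun k y hki => ?_⟩
    rw [hu.1.pr_mem, hs.1.pr_mem]
    refine and_congr_right fun hk => ?_
    rw [ap_upd hk, if_neg hki]

end

/-! ### The language with a binary and a unary symbol -/

variable (M) in
noncomputable def lstd : M := upair (pr (num 0) (num 2)) (pr (num 1) (num 1))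

theorem isLStd_iff {L : M} : IsLStd L ↔ L = lstd M := by
  simp only [IsLStd, isNumeral_iff, isOPair_iff]
  have h : ∀ p : M, (∃ r n, p = pr r n ∧ (r = num 0 ∧ n = num 2 ∨ r = num 1 ∧ n = num 1)) ↔
      p ∊ lstd M := fun p => by
    simp only [lstd, mem_upair]
    constructor
    · rintro ⟨r, n, rfl, ⟨rfl, rfl⟩ | ⟨rfl, rfl⟩⟩ <;> simp
    · rintro (rfl | rfl)
      · exact ⟨_, _, rfl, Or.inl ⟨rfl, rfl⟩⟩
      · exact ⟨_, _, rfl, Or.inr ⟨rfl, rfl⟩⟩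
  simp only [h]
  exact ⟨ext, fun e p => e ▸ Iff.rfl⟩

section
variable {a b x y : M}

theorem isFunOn_upair (h : a ≠ b) : IsFunOn (upair (pr a x) (pr b y)) (upair a b) := by
  refine isFunOn_iff.2 ⟨fun p hp => ?_, fun z hz => ?_⟩
  · rcases mem_upair.1 hp with rfl | rfl
    · exact ⟨a, x, by simp, rfl⟩
    · exact ⟨b, y, by simp, rfl⟩
  · rcases mem_upair.1 hz with rfl | rfl
    · exact ⟨x, by simp, fun w hw => by simpa [h] using hw⟩
    · exact ⟨y, by simp, fun w hw => by simpa [h.symm] using hw⟩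

theorem ap_upair_left (h : a ≠ b) : ap (upair (pr a x) (pr b y)) a = x :=
  (((isFunOn_upair h).pr_mem).1 (by simp : pr a x ∊ upair (pr a x) (pr b y))).2.symm
theorem ap_upair_right (h : a ≠ b) : ap (upair (pr a x) (pr b y)) b = y :=
  (((isFunOn_upair h).pr_mem).1 (by simp : pr b y ∊ upair (pr a x) (pr b y))).2.symm

theorem isFunOn_sing : IsFunOn (sing (pr a x)) (sing a) := by
  refine isFunOn_iff.2 ⟨fun p hp => ⟨a, x, by simp, mem_sing.1 hp⟩, fun z hz => ?_⟩
  obtain rfl := mem_sing.1 hz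
  exact ⟨x, by simp, fun w hw => by simpa using hw⟩
theorem ap_sing : ap (sing (pr a x)) a = x :=
  ((isFunOn_sing.pr_mem).1 (by simp : pr a x ∊ sing (pr a x))).2.symm
end

theorem num_zero_ne_one : (num 0 : M) ≠ num 1 := by simp

theorem num_two : (num 2 : M) = upair (num 0) (num 1) := ext fun z => by
  rw [mem_num, mem_upair]
  constructor
  · rintro ⟨i, hi, rfl⟩
    interval_cases i <;> simp
  · rintro (rfl | rfl)
    · exact ⟨0, by omega, rfl⟩
    · exact ⟨1, by omega, rfl⟩

theorem num_one : (num 1 : M) = sing (num 0) := ext fun z => by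
  rw [mem_num, mem_sing]
  constructor
  · rintro ⟨i, hi, rfl⟩
    interval_cases i
    rfl
  · rintro rfl
    exact ⟨0, by omega, rfl⟩

theorem isFunOn_lstd : IsFunOn (lstd M) (num 2) := num_two (M := M) ▸ isFunOn_upair num_zero_ne_one

theorem isLanguage_lstd : IsLanguage (lstd M) := by
  refine ⟨num 2, om M, isOmega_iff.2 rfl, isFunOn_lstd, fun x y h => ?_⟩
  rw [app_iff, lstd, mem_upair, pr_inj, pr_inj] at h
  rcases h with ⟨-, rfl⟩ | ⟨-, rfl⟩ <;> exact num_mem_om _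

/-! ### The structures `⟨D, ∈, A ∩ D⟩` -/

noncomputable def memRel (D : M) : M :=
  sep (funs (num 2) D) fun t => ap t (num 0) ∊ ap t (num 1)
noncomputable def predRel (D : M) (A : Set M) : M := sep (funs (num 1) D) fun t => ap t (num 0) ∈ A

/-- The interpretation of `ε` as membership and of `R` as `A`, on the set `D`. -/
noncomputable def vInt (A : Set M) (D : M) : M :=
  upair (pr (num 0) (memRel D)) (pr (num 1) (predRel D A))

instance : DF1 (memRel : M → M) := ⟨by unfold memRel; infer_instance⟩
instance (A : Set M) [DSet A] : DF1 (vInt A : M → M) := ⟨by unfold vInt predRel; infer_instance⟩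

section
variable {A : Set M} {D I : M}

theorem pr_mem_vInt {r R : M} : pr r R ∊ vInt A D ↔
    r = num 0 ∧ R = memRel D ∨ r = num 1 ∧ R = predRel D A := by
  simp [vInt]

variable [hA : DSet A]

theorem mem_memRel {t : M} : t ∊ memRel D ↔ IsFun t (num 2) D ∧ ap t (num 0) ∊ ap t (num 1) := by
  rw [memRel, mem_sep, mem_funs]
theorem mem_predRel {t : M} : t ∊ predRel D A ↔ IsFun t (num 1) D ∧ ap t (num 0) ∈ A := by
  rw [predRel, mem_sep, mem_funs]

theorem isStructureOn_vInt (hD : ∃ x, x ∊ D) : IsStructureOn (lstd M) D (vInt A D) := by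
  refine ⟨hD, num 2, isFunOn_lstd, num_two (M := M) ▸ isFunOn_upair num_zero_ne_one,
    fun r n R h h' t ht => ?_⟩
  rw [app_iff, lstd, mem_upair, pr_inj, pr_inj] at h
  rw [app_iff, pr_mem_vInt] at h'
  rcases h with ⟨rfl, rfl⟩ | ⟨rfl, rfl⟩
  · rcases h' with ⟨-, rfl⟩ | ⟨h', -⟩
    · exact (mem_memRel.1 ht).1
    · simp at h'
  · rcases h' with ⟨h', -⟩ | ⟨-, rfl⟩
    · simp at h'
    · exact (mem_predRel.1 ht).1

theorem num_lt_mem {i j : ℕ} (h : i < j) : (num i : M) ∊ num j := mem_num.2 ⟨i, h, rfl⟩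

theorem isVStructure_iff {η : M} (hη : IsOrdinal η) : IsVStructure A (lstd M) η D I ↔
    D = V η ∧ (∃ x, x ∊ D) ∧ I = vInt A D := by
  have h0 : ∀ t : M, (∃ n zero one x y, IsNumeral 2 n ∧ IsFun t n D ∧ IsNumeral 0 zero ∧
      IsNumeral 1 one ∧ App t zero x ∧ App t one y ∧ x ∊ y) ↔ t ∊ memRel D := fun t => by
    simp only [isNumeral_iff, app_iff]
    rw [mem_memRel]
    constructor
    · rintro ⟨_, _, _, x, y, rfl, ht, rfl, rfl, hx, hy, hxy⟩
      rw [(ht.1.pr_mem.1 hx).2, (ht.1.pr_mem.1 hy).2] at hxy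
      exact ⟨ht, hxy⟩
    · rintro ⟨ht, hxy⟩
      exact ⟨_, _, _, _, _, rfl, ht, rfl, rfl, ht.1.ap_mem (num_lt_mem (by omega)),
        ht.1.ap_mem (num_lt_mem (by omega)), hxy⟩
  have h1 : ∀ t : M, (∃ n zero x, IsNumeral 1 n ∧ IsFun t n D ∧ IsNumeral 0 zero ∧
      App t zero x ∧ x ∈ A) ↔ t ∊ predRel D A := fun t => by
    simp only [isNumeral_iff, app_iff]
    rw [mem_predRel]
    constructor
    · rintro ⟨_, _, x, rfl, ht, rfl, hx, hxy⟩
      rw [(ht.1.pr_mem.1 hx).2] at hxy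
      exact ⟨ht, hxy⟩
    · rintro ⟨ht, hxy⟩
      exact ⟨_, _, _, rfl, ht, rfl, ht.1.ap_mem (num_lt_mem (by omega)), hxy⟩
  unfold IsVStructure
  rw [isV_iff hη]
  simp only [h0, h1]
  refine and_congr_right fun _ => ?_
  constructor
  · rintro ⟨⟨hD, S, hS, hI, -⟩, hE, hP⟩
    refine ⟨hD, ?_⟩
    obtain rfl : S = num 2 := hS.dom_eq.symm.trans isFunOn_lstd.dom_eq
    refine hI.ext (num_two (M := M) ▸ isFunOn_upair num_zero_ne_one) fun r hr => ?_
    rw [num_two, mem_upair] at hr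
    rcases hr with rfl | rfl
    · rw [vInt, ap_upair_left num_zero_ne_one]
      exact ext (hE _ _ (isNumeral_iff.2 rfl) (app_iff.2 (hI.ap_mem (num_lt_mem (by omega)))))
    · rw [vInt, ap_upair_right num_zero_ne_one]
      exact ext (hP _ _ (isNumeral_iff.2 rfl) (app_iff.2 (hI.ap_mem (num_lt_mem (by omega)))))
  · rintro ⟨hD, rfl⟩
    refine ⟨isStructureOn_vInt hD, fun r E hr hE t => ?_, fun r P hr hP t => ?_⟩
    · rw [app_iff, pr_mem_vInt] at hE
      rw [isNumeral_iff] at hr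
      subst hr
      rcases hE with ⟨-, rfl⟩ | ⟨h, -⟩
      · rfl
      · simp at h
    · rw [app_iff, pr_mem_vInt] at hP
      rw [isNumeral_iff] at hr
      subst hr
      rcases hP with ⟨h, -⟩ | ⟨-, rfl⟩
      · simp at h
      · rfl

theorem vInt_rel {r R u : M} (h : pr r R ∊ vInt A D) (hu : u ∊ R) : ∃ n, IsFunOn u n := by
  rcases pr_mem_vInt.1 h with ⟨-, rfl⟩ | ⟨-, rfl⟩
  · exact ⟨_, (mem_memRel.1 hu).1.1⟩
  · exact ⟨_, (mem_predRel.1 hu).1.1⟩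

noncomputable def memFm (i j : M) : M := code 1 (num 0) (upair (pr (num 0) i) (pr (num 1) j))
noncomputable def predFm (i : M) : M := code 1 (num 1) (sing (pr (num 0) i))

theorem isFun_pair {i j : M} (hi : i ∊ om M) (hj : j ∊ om M) :
    IsFun (upair (pr (num 0) i) (pr (num 1) j)) (num 2) (om M) := by
  have h : IsFunOn (upair (pr (num 0) i) (pr (num 1) j)) (num 2) :=
    num_two (M := M) ▸ isFunOn_upair num_zero_ne_one
  refine isFun_iff.2 ⟨h, fun x hx => ?_⟩
  rw [num_two, mem_upair] at hx
  rcases hx with rfl | rfl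
  · rwa [ap_upair_left num_zero_ne_one]
  · rwa [ap_upair_right num_zero_ne_one]

theorem isFun_single {i : M} (hi : i ∊ om M) : IsFun (sing (pr (num 0) i)) (num 1) (om M) := by
  have h : IsFunOn (sing (pr (num 0) i)) (num 1) := num_one (M := M) ▸ isFunOn_sing
  refine isFun_iff.2 ⟨h, fun x hx => ?_⟩
  rw [num_one, mem_sing] at hx
  subst hx
  rwa [ap_sing]

theorem isFormula_memFm {i j : M} (hi : i ∊ om M) (hj : j ∊ om M) :
    IsFormula (lstd M) (memFm i j) :=
  isFormula_rel (isVarTuple_iff.2 ⟨num 2, by simp [lstd], isFun_pair hi hj⟩)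
theorem isFormula_predFm {i : M} (hi : i ∊ om M) : IsFormula (lstd M) (predFm i) :=
  isFormula_rel (isVarTuple_iff.2 ⟨num 1, by simp [lstd], isFun_single hi⟩)

theorem sat_memFm {i j s : M} (hs : IsFun s (om M) D) (hi : i ∊ om M) (hj : j ∊ om M) :
    Sat (lstd M) D (vInt A D) (memFm i j) s ↔ ap s i ∊ ap s j := by
  have hf := isFun_pair hi hj
  rw [memFm, sat_rel hs (by simp [lstd]) hf (fun R u h hu => vInt_rel h hu)]
  have e : comp s (upair (pr (num 0) i) (pr (num 1) j)) ∊ memRel D ↔ ap s i ∊ ap s j := by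
    rw [mem_memRel, ap_comp hf.1 (num_lt_mem (by omega)), ap_comp hf.1 (num_lt_mem (by omega)),
      ap_upair_left num_zero_ne_one, ap_upair_right num_zero_ne_one]
    simp only [isFun_comp hs hf, true_and]
  simp [pr_mem_vInt, e]

theorem sat_predFm {i s : M} (hs : IsFun s (om M) D) (hi : i ∊ om M) :
    Sat (lstd M) D (vInt A D) (predFm i) s ↔ ap s i ∈ A := by
  have hf := isFun_single hi
  rw [predFm, sat_rel hs (by simp [lstd]) hf (fun R u h hu => vInt_rel h hu)]
  have e : comp s (sing (pr (num 0) i)) ∊ predRel D A ↔ ap s i ∈ A := by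
    rw [mem_predRel, ap_comp hf.1 (num_lt_mem (by omega)), ap_sing]
    simp only [isFun_comp hs hf, true_and]
  simp [pr_mem_vInt, e]
end

/-! ### Standard formulas -/

/-- Formulas of the language `{ε, R}` in the metatheory. -/
inductive Fm : Type
  | eq (i j : ℕ)
  | mem (i j : ℕ)
  | pred (i : ℕ)
  | neg (φ : Fm)
  | and (φ ψ : Fm)
  | ex (i : ℕ) (φ : Fm)

noncomputable def Fm.cd : Fm → M
  | eq i j => code 0 (num i) (num j)
  | mem i j => memFm (num i) (num j)
  | pred i => predFm (num i)
  | neg φ => code 2 φ.cd φ.cd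
  | and φ ψ => code 3 φ.cd ψ.cd
  | ex i φ => code 4 (num i) φ.cd

def Fm.Holds (D : M) (A : Set M) : Fm → (ℕ → M) → Prop
  | eq i j, v => v i = v j
  | mem i j, v => v i ∊ v j
  | pred i, v => v i ∈ A
  | neg φ, v => ¬ φ.Holds D A v
  | and φ ψ, v => φ.Holds D A v ∧ ψ.Holds D A v
  | ex i φ, v => ∃ x, x ∊ D ∧ φ.Holds D A (Function.update v i x)

theorem Fm.isFormula_cd (φ : Fm) : IsFormula (lstd M) φ.cd := by
  induction φ with
  | eq i j => exact isFormula_eq (num_mem_om i) (num_mem_om j)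
  | mem i j => exact isFormula_memFm (num_mem_om i) (num_mem_om j)
  | pred i => exact isFormula_predFm (num_mem_om i)
  | neg φ h => exact isFormula_neg h
  | and φ ψ h h' => exact isFormula_and h h'
  | ex i φ h => exact isFormula_ex (num_mem_om i) h

/-- Ties internal satisfaction to truth in the metatheory. Codes in `M` may be nonstandard, but only
a few explicit formulas need to be decoded. -/
theorem Fm.sat_cd {A : Set M} [DSet A] {D : M} (φ : Fm) : ∀ s, IsFun s (om M) D →
    (Sat (lstd M) D (vInt A D) φ.cd s ↔ φ.Holds D A fun i => ap s (num i)) := by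
  induction φ with
  | eq i j => exact fun s hs => sat_eq hs (num_mem_om i) (num_mem_om j)
  | mem i j => exact fun s hs => sat_memFm hs (num_mem_om i) (num_mem_om j)
  | pred i => exact fun s hs => sat_predFm hs (num_mem_om i)
  | neg φ h => exact fun s hs => (sat_neg hs φ.isFormula_cd).trans (not_congr (h s hs))
  | and φ ψ h h' =>
    exact fun s hs => (sat_and hs φ.isFormula_cd ψ.isFormula_cd).trans (and_congr (h s hs) (h' s hs))
  | ex i φ h =>
    intro s hs
    refine (sat_ex hs (num_mem_om i) φ.isFormula_cd).trans (exists_congr fun x =>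
      and_congr_right fun hx => ?_)
    rw [h _ (isFun_upd hs hx)]
    refine iff_of_eq (congrArg _ (funext fun k => ?_))
    rw [ap_upd (num_mem_om k), Function.update_apply]
    simp

/-- An arbitrary external sequence `ℕ → M` need not be represented by an element of `M`. An
eventually constant one is, by finitely many updates of a constant assignment, which also covers
nonstandard indices. -/
theorem exists_assignment {D d : M} (hd : d ∊ D) (n : ℕ) : ∀ v : ℕ → M, (∀ i, v i ∊ D) →
    (∀ i, n ≤ i → v i = d) → ∃ s, IsFun s (om M) D ∧ ∀ i, ap s (num i) = v i := by
  induction n with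
  | zero =>
    exact fun v _ h => ⟨lam (om M) fun _ => d, isFun_lam fun _ _ => hd, fun i => by
      rw [ap_lam (num_mem_om i), h i (Nat.zero_le i)]⟩
  | succ n ih =>
    intro v hv h
    obtain ⟨s, hs, e⟩ := ih (Function.update v n d) (fun i => by
      rw [Function.update_apply]; split_ifs; exacts [hd, hv i]) (fun i hi => by
      rw [Function.update_apply]; split_ifs; exacts [rfl, h i (by omega)])
    refine ⟨upd s (num n) (v n), isFun_upd hs (hv n), fun i => ?_⟩
    rw [ap_upd (num_mem_om i), e, Function.update_apply]
    simp only [num_inj]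
    split_ifs with hi
    · rw [hi]
    · rfl

/-! ### Elementary embeddings of `⟨D, ∈, A ∩ D⟩` -/

theorem IsElementary.holds_iff {A A' : Set M} [DSet A] [DSet A'] {D D' j : M}
    (h : IsElementary (lstd M) D (vInt A D) D' (vInt A' D') j) (φ : Fm) (n : ℕ) {v : ℕ → M}
    (hv : ∀ i, v i ∊ D) (hn : ∀ i, n ≤ i → v i = v n) :
    φ.Holds D A v ↔ φ.Holds D' A' fun i => ap j (v i) := by
  obtain ⟨s, hs, e⟩ := exists_assignment (hv n) n v hv hn
  have hs' := isFun_comp h.1 hs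
  have := h.2 φ.cd s (comp j s) φ.isFormula_cd (isAssignment_iff.2 hs) (isAssignment_iff.2 hs')
    (fun i x y hx hy => by
      rw [app_iff] at *
      obtain ⟨hi, rfl⟩ := hs.1.pr_mem.1 hx
      obtain ⟨_, rfl⟩ := h.1.1.pr_mem.1 hy
      exact hs'.1.pr_mem.2 ⟨hi, (ap_comp hs.1 hi).symm⟩)
  rw [φ.sat_cd s hs, φ.sat_cd _ hs'] at this
  simp only [ap_comp hs.1 (num_mem_om _), e] at this
  exact this

/-- What is used of an elementary embedding `J` of `⟨D, ∈, A ∩ D⟩` into `⟨D', ∈, A' ∩ D'⟩`. -/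
structure Emb (D D' : M) (A A' : Set M) (J : M → M) : Prop where
  maps : ∀ x, x ∊ D → J x ∊ D'
  mem : ∀ x y, x ∊ D → y ∊ D → (J x ∊ J y ↔ x ∊ y)
  inj : ∀ x y, x ∊ D → y ∊ D → J x = J y → x = y
  pred : ∀ x, x ∊ D → (J x ∈ A' ↔ x ∈ A)
  emp : emp M ∊ D → J (emp M) = emp M
  upair : ∀ x y, x ∊ D → y ∊ D → upair x y ∊ D → J (upair x y) = upair (J x) (J y)

/-- Each field comes from one formula in at most three parameters. Transitivity of `D'` turns
statements about elements in `D'` into statements about all elements. -/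
theorem IsElementary.emb {A A' : Set M} [DSet A] [DSet A'] {D D' j : M}
    (h : IsElementary (lstd M) D (vInt A D) D' (vInt A' D') j)
    (hD : ∀ x y, x ∊ D → y ∊ x → y ∊ D) (hD' : ∀ x y, x ∊ D' → y ∊ x → y ∊ D') :
    Emb D D' A A' (ap j) := by
  have h3 : ∀ (φ : Fm) (x y z : M), x ∊ D → y ∊ D → z ∊ D →
      (φ.Holds D A (fun i => if i = 0 then x else if i = 1 then y else z) ↔
        φ.Holds D' A' (fun i => if i = 0 then ap j x else if i = 1 then ap j y else ap j z)) := by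
    intro φ x y z hx hy hz
    have := h.holds_iff φ 2 (v := fun i => if i = 0 then x else if i = 1 then y else z)
      (fun i => by split_ifs <;> assumption)
      (fun i hi => by
        have h0 : i ≠ 0 := by omega
        have h1 : i ≠ 1 := by omega
        simp [h0, h1])
    simpa only [apply_ite (ap j)] using this
  have hmem : ∀ x y, x ∊ D → y ∊ D → (ap j x ∊ ap j y ↔ x ∊ y) := fun x y hx hy => by
    have := h3 (.mem 0 1) x y y hx hy hy
    simpa [Fm.Holds] using this.symm
  refine ⟨fun x hx => h.1.ap_mem hx, hmem, fun x y hx hy e => ?_, fun x hx => ?_, fun he => ?_,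
    fun x y hx hy hp => ?_⟩
  · have := h3 (.eq 0 1) x y y hx hy hy
    simp [Fm.Holds] at this
    exact this.2 e
  · have := h3 (.pred 0) x x x hx hx hx
    simpa [Fm.Holds] using this.symm
  · have := h3 (.neg (.ex 1 (.mem 1 0))) _ _ _ he he he
    simp [Fm.Holds] at this
    exact eq_emp_iff.2 fun z hz => this z (hD' _ _ (h.1.ap_mem he) hz) hz
  -- The formula says that every element of `v 0` is `v 1` or `v 2`; the converse inclusion follows
  -- from `hmem`.
  · have := h3 (.neg (.ex 3 (.and (.mem 3 0) (.and (.neg (.eq 3 1)) (.neg (.eq 3 2)))))) _ x y hp hx hy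
    simp [Fm.Holds] at this
    have h1 := this.1 fun z _ hz h => hz.resolve_left h
    refine ext fun z => ?_
    rw [mem_upair]
    constructor
    · intro hz
      by_contra hc
      push Not at hc
      exact hc.2 (h1 z (hD' _ _ (h.1.ap_mem hp) hz) hz hc.1)
    · rintro (rfl | rfl)
      · exact (hmem _ _ hx hp).2 (by simp)
      · exact (hmem _ _ hy hp).2 (by simp)

/-! ### Coding several classes by one -/

/-- Iterated singletons of the empty set, so every map preserving the empty set and unordered pairs
fixes them. -/
noncomputable def tg : ℕ → M
  | 0 => emp M
  | k + 1 => sing (tg k)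

theorem tg_inj {i j : ℕ} : (tg i : M) = tg j ↔ i = j := by
  refine ⟨fun h => ?_, fun h => h ▸ rfl⟩
  induction i generalizing j with
  | zero =>
    cases j with
    | zero => rfl
    | succ j => exact absurd h.symm (ne_emp_iff.2 ⟨tg j, by simp [tg]⟩)
  | succ i ih =>
    cases j with
    | zero => exact absurd h (ne_emp_iff.2 ⟨tg i, by simp [tg]⟩)
    | succ j => rw [ih (sing_inj.1 h)]

theorem IsLim.tg {θ : M} (hθ : IsLim θ) (k : ℕ) : tg k ∊ V θ := by
  induction k with
  | zero => exact hθ.emp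
  | succ k ih => exact hθ.sing ih

/-- The disjoint union of the first `n` of the classes `C k`. -/
def tagged (n : ℕ) (C : ℕ → Set M) : Set M := {p | ∃ k, k < n ∧ ∃ x, x ∈ C k ∧ p = pr (tg k) x}

theorem dfn_bex (n : ℕ) {P : ℕ → (ℕ → M) → Prop} (h : ∀ k, Dfn (P k)) :
    Dfn fun v => ∃ k, k < n ∧ P k v := by
  induction n with
  | zero => exact dfn_const (p := False).congr fun v => by simp
  | succ n ih =>
    have := h n
    refine (dfn_or (P := fun v => ∃ k, k < n ∧ P k v) (Q := P n)).congr fun v => ?_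
    constructor
    · rintro (⟨k, hk, h⟩ | h)
      · exact ⟨k, by omega, h⟩
      · exact ⟨n, by omega, h⟩
    · rintro ⟨k, hk, h⟩
      rcases Nat.lt_succ_iff_lt_or_eq.1 hk with hk | rfl
      · exact Or.inl ⟨k, hk, h⟩
      · exact Or.inr h

instance dset_tagged (n : ℕ) (C : ℕ → Set M) [h : ∀ k, DSet (C k)] : DSet (tagged n C) :=
  ⟨⟨dfn_bex n fun k => inferInstance⟩⟩

theorem pr_mem_tagged {n k : ℕ} {C : ℕ → Set M} (hk : k < n) {x : M} :
    pr (tg k) x ∈ tagged n C ↔ x ∈ C k := by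
  constructor
  · rintro ⟨l, hl, y, hy, e⟩
    obtain ⟨e1, rfl⟩ := pr_inj.1 e
    rwa [tg_inj.1 e1]
  · exact fun h => ⟨k, hk, x, h, rfl⟩

/-- A nonempty ordinal contains the empty set, whereas both elements of a Kuratowski pair are
nonempty. So an ordinal added to a tagged class is its only ordinal member and can be recovered. -/
theorem not_isOrdinal_pr (x y : M) : ¬ IsOrdinal (pr x y) := fun h => by
  have h1 : emp M ∊ pr x y := by
    rcases ord_trichotomy ord_emp h with h' | h' | h'
    · exact h'
    · exact absurd (h' ▸ mem_upair.2 (Or.inl rfl) : sing x ∊ emp M) not_mem_emp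
    · exact absurd h' not_mem_emp
  rcases mem_upair.1 h1 with e | e
  · exact ne_emp_iff.2 ⟨x, by simp⟩ e.symm
  · exact ne_emp_iff.2 ⟨x, by simp⟩ e.symm

theorem not_mem_tagged_of_ord {n : ℕ} {C : ℕ → Set M} {α : M} (h : IsOrdinal α) :
    ¬ α ∈ tagged n C := by
  rintro ⟨k, -, x, -, rfl⟩
  exact not_isOrdinal_pr _ _ h

/-- `tagged n C` with one ordinal added. -/
def pointed (n : ℕ) (C : ℕ → Set M) (ξ : M) : Set M := {p | p ∈ tagged n C ∨ p = ξ}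

instance (n : ℕ) (C : ℕ → Set M) [∀ k, DSet (C k)] (ξ : M) : DSet (pointed n C ξ) := ⟨⟨by
  unfold pointed
  exact (inferInstance : Dfn fun v : ℕ → M => v 0 ∈ tagged n C ∨ v 0 = ξ)⟩⟩

section
variable {n : ℕ} {C : ℕ → Set M} {θ θ' ξ ξ' : M} {J : M → M}
  (h : Emb (V θ) (V θ') (pointed n C ξ) (pointed n C ξ') J) (hθ : IsLim θ)
include h hθ

theorem Emb.map_pr {x y : M} (hx : x ∊ V θ) (hy : y ∊ V θ) : J (pr x y) = pr (J x) (J y) := by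
  have h1 := hθ.sing hx
  have h2 := hθ.upair hx hy
  rw [SetModel.pr, h.upair _ _ h1 h2 (hθ.upair h1 h2), h.upair _ _ hx hy h2]
  rw [show J (sing x) = sing (J x) from h.upair _ _ hx hx h1]
  rfl

theorem Emb.map_tg (k : ℕ) : J (tg k) = tg k := by
  induction k with
  | zero => exact h.emp hθ.emp
  | succ k ih =>
    have := h.upair _ _ (hθ.tg k) (hθ.tg k) (hθ.tg (k + 1))
    rw [ih] at this
    exact this

/-- The pair `⟨tg k, x⟩` is mapped to `⟨tg k, J x⟩`, and the extra point, being an ordinal, does not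
affect membership of pairs. -/
theorem Emb.class_iff (hξ : IsOrdinal ξ) (hξ' : IsOrdinal ξ') {k : ℕ} (hk : k < n) {x : M}
    (hx : x ∊ V θ) : J x ∈ C k ↔ x ∈ C k := by
  have h1 := h.pred _ (hθ.pr (hθ.tg k) hx)
  rw [h.map_pr hθ (hθ.tg k) hx, h.map_tg hθ] at h1
  have h2 : ∀ y ξ : M, IsOrdinal ξ → (SetModel.pr (tg k) y ∈ pointed n C ξ ↔ y ∈ C k) := fun y ξ hξ =>
    Iff.trans ⟨fun h => h.resolve_right fun e => not_isOrdinal_pr _ _ (e ▸ hξ), Or.inl⟩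
      (pr_mem_tagged hk)
  rwa [h2 _ _ hξ, h2 _ _ hξ'] at h1
end

/-! ### Embeddings of levels of the hierarchy that respect given classes -/

/-- No function from an element of `κ` to `κ` is onto. -/
def NoSurj (κ : M) : Prop := ∀ β f, β ∊ κ → IsFun f β κ → ∃ γ, γ ∊ κ ∧ ∀ x, ¬ pr x γ ∊ f

instance : DP1 (NoSurj : M → Prop) := ⟨by unfold NoSurj; infer_instance⟩

/-- Some classes that the embeddings below respect, together with the classes `E k`. -/
def baseClasses (E : ℕ → Set M) : ℕ → Set M
  | 0 => {x | IsOrdinal x}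
  | 1 => {x | x = om M}
  | 2 => {x | IsFun (fst x) (fst (snd x)) (snd (snd x))}
  | 3 => {x | NoSurj x}
  | 4 => {x | IsOrdinal (fst x) ∧ snd x = V (fst x)}
  | 5 => {x | IsSubset (fst x) (snd x)}
  | 6 => {x | snd x = sc (fst x)}
  | 7 => {x | Covers (fst x) (snd x)}
  | 8 => {x | ∀ γ, γ ∊ snd x → ∃ z, pr z γ ∊ fst x}
  | k + 9 => E k

instance dset_baseClasses (E : ℕ → Set M) [h : ∀ k, DSet (E k)] (k : ℕ) :
    DSet (baseClasses E k) := by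
  match k with
  | 0 => exact ⟨⟨(inferInstance : Dfn fun v : ℕ → M => IsOrdinal (v 0))⟩⟩
  | 1 => exact ⟨⟨(inferInstance : Dfn fun v : ℕ → M => v 0 = om M)⟩⟩
  | 2 => exact ⟨⟨(inferInstance : Dfn fun v : ℕ → M =>
      IsFun (fst (v 0)) (fst (snd (v 0))) (snd (snd (v 0))))⟩⟩
  | 3 => exact ⟨⟨(inferInstance : Dfn fun v : ℕ → M => NoSurj (v 0))⟩⟩
  | 4 => exact ⟨⟨(inferInstance : Dfn fun v : ℕ → M =>
      IsOrdinal (fst (v 0)) ∧ snd (v 0) = V (fst (v 0)))⟩⟩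
  | 5 => exact ⟨⟨(inferInstance : Dfn fun v : ℕ → M => IsSubset (fst (v 0)) (snd (v 0)))⟩⟩
  | 6 => exact ⟨⟨(inferInstance : Dfn fun v : ℕ → M => snd (v 0) = sc (fst (v 0)))⟩⟩
  | 7 => exact ⟨⟨(inferInstance : Dfn fun v : ℕ → M => Covers (fst (v 0)) (snd (v 0)))⟩⟩
  | 8 => exact ⟨⟨(inferInstance : Dfn fun v : ℕ → M =>
      ∀ γ, γ ∊ snd (v 0) → ∃ z, pr z γ ∊ fst (v 0))⟩⟩
  | k + 9 => exact h k

/-- `J` embeds `V θ` into `V θ'` and respects the classes `baseClasses E k`, `k < 12`. -/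
structure ClassEmb (E : ℕ → Set M) (θ θ' : M) (J : M → M) : Prop where
  lim : IsLim θ
  om_mem : om M ∊ θ
  ord : IsOrdinal θ'
  maps : ∀ x, x ∊ V θ → J x ∊ V θ'
  mem : ∀ x y, x ∊ V θ → y ∊ V θ → (J x ∊ J y ↔ x ∊ y)
  inj : ∀ x y, x ∊ V θ → y ∊ V θ → J x = J y → x = y
  map_pr : ∀ x y, x ∊ V θ → y ∊ V θ → J (pr x y) = pr (J x) (J y)
  map_emp : J (emp M) = emp M
  cls : ∀ k x, k < 12 → x ∊ V θ → (J x ∈ baseClasses E k ↔ x ∈ baseClasses E k)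

/-- The class of which the structures in both directions of the main argument are made. -/
abbrev codeClass (E : ℕ → Set M) (ξ : M) : Set M := pointed 12 (baseClasses E) ξ

theorem IsElementary.classEmb {E : ℕ → Set M} [∀ k, DSet (E k)] {θ θ' ξ ξ' j : M}
    (h : IsElementary (lstd M) (V θ) (vInt (codeClass E ξ) (V θ)) (V θ')
      (vInt (codeClass E ξ') (V θ')) j)
    (hθ : IsLim θ) (hom : om M ∊ θ) (hθ' : IsOrdinal θ') (hξ : IsOrdinal ξ) (hξ' : IsOrdinal ξ') :
    ClassEmb E θ θ' (ap j) := by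
  have he := h.emb (fun x y => V_trans hθ.1) (fun x y => V_trans hθ')
  exact ⟨hθ, hom, hθ', he.maps, he.mem, he.inj, fun x y => he.map_pr hθ, he.emp hθ.emp,
    fun k x hk => he.class_iff hθ hξ hξ' hk⟩

/-- The image of `ξ` is an ordinal satisfying the predicate, and `ξ'` is the only one in `codeClass
E ξ'`. -/
theorem IsElementary.map_point {E : ℕ → Set M} [∀ k, DSet (E k)] {θ θ' ξ ξ' j : M}
    (h : IsElementary (lstd M) (V θ) (vInt (codeClass E ξ) (V θ)) (V θ')
      (vInt (codeClass E ξ') (V θ')) j)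
    (hθ : IsLim θ) (hom : om M ∊ θ) (hθ' : IsOrdinal θ') (hξ : IsOrdinal ξ) (hξ' : IsOrdinal ξ')
    (hm : ξ ∊ θ) : ap j ξ = ξ' := by
  have he := h.emb (fun x y => V_trans hθ.1) (fun x y => V_trans hθ')
  have h1 : ap j ξ ∈ codeClass E ξ' := (he.pred ξ (hθ.ord hm)).2 (Or.inr rfl)
  have h2 : IsOrdinal (ap j ξ) := ((h.classEmb hθ hom hθ' hξ hξ').cls 0 ξ (by omega) (hθ.ord hm)).2 hξ
  exact h1.resolve_left (not_mem_tagged_of_ord h2)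

/-! ### Operations preserved by embeddings that respect the base classes -/

namespace ClassEmb
variable {E : ℕ → Set M} {θ θ' : M} {J : M → M} (h : ClassEmb E θ θ' J)
include h

theorem isOrdinal {α : M} (hα : α ∊ V θ) : IsOrdinal (J α) ↔ IsOrdinal α :=
  h.cls 0 α (by omega) hα

theorem om_mem_V : om M ∊ V θ := h.lim.ord h.om_mem

theorem map_om : J (om M) = om M := (h.cls 1 _ (by omega) h.om_mem_V).2 rfl

theorem isFun_iff {f a b : M} (hf : f ∊ V θ) (ha : a ∊ V θ) (hb : b ∊ V θ) :
    IsFun (J f) (J a) (J b) ↔ IsFun f a b := by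
  have := h.cls 2 _ (by omega) (h.lim.pr hf (h.lim.pr ha hb))
  rw [h.map_pr _ _ hf (h.lim.pr ha hb), h.map_pr _ _ ha hb] at this
  simpa [baseClasses] using this

theorem pr_mem_iff {x y f : M} (hx : x ∊ V θ) (hy : y ∊ V θ) (hf : f ∊ V θ) :
    pr (J x) (J y) ∊ J f ↔ pr x y ∊ f := by
  rw [← h.map_pr _ _ hx hy, h.mem _ _ (h.lim.pr hx hy) hf]

theorem map_ap {f a b x : M} (hf : IsFun f a b) (ha : a ∊ V θ) (hb : b ∊ V θ)
    (hx : x ∊ a) : ap (J f) (J x) = J (ap f x) := by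
  have hfV := h.lim.of_isFun ha hb hf
  have h1 := (h.isFun_iff hfV ha hb).2 hf
  have h2 := (h.pr_mem_iff (V_trans h.lim.1 ha hx) (V_trans h.lim.1 hb (hf.ap_mem hx)) hfV).2
    (hf.1.ap_mem hx)
  exact (h1.1.pr_mem.1 h2).2.symm

theorem map_V {β : M} (hβ : β ∊ θ) : J (V β) = V (J β) := by
  have h1 := h.lim.ord hβ
  have h2 := h.lim.V_mem hβ
  have := h.cls 4 _ (by omega) (h.lim.pr h1 h2)
  rw [h.map_pr _ _ h1 h2] at this
  simp only [baseClasses, Set.mem_ofPred_eq, fst_pr, snd_pr, and_true] at this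
  exact (this.2 (h.lim.1.mem hβ)).2

theorem subset_iff {x y : M} (hx : x ∊ V θ) (hy : y ∊ V θ) :
    IsSubset (J x) (J y) ↔ IsSubset x y := by
  have := h.cls 5 _ (by omega) (h.lim.pr hx hy)
  rw [h.map_pr _ _ hx hy] at this
  simpa [baseClasses] using this

theorem map_sc {β : M} (hβ : β ∊ θ) : J (sc β) = sc (J β) := by
  have h1 := h.lim.ord hβ
  have h2 := h.lim.ord (h.lim.2.2 β hβ)
  have := h.cls 6 _ (by omega) (h.lim.pr h1 h2)
  rw [h.map_pr _ _ h1 h2] at this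
  simpa [baseClasses] using this

/-! ### Critical points and a Kunen-type argument -/

variable [hJ : DF1 J]

theorem map_nat {n : M} (hn : n ∊ om M) : J n = n :=
  nat_induction (P := fun n => J n = n) h.map_emp (fun n hn ih => by
    rw [h.map_sc (h.lim.om_subset n hn), ih]) hn

/-- If `α` were the least ordinal with `J α < α`, applying `J` would give `J (J α) < J α`, a smaller
example. -/
theorem not_map_mem {α : M} (hα : α ∊ θ) : ¬ J α ∊ α := by
  intro hc
  obtain ⟨β, hβ, ⟨hβθ, hβJ⟩, hmin⟩ := exists_least_ord (fun α => α ∊ θ ∧ J α ∊ α)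
    (h.lim.1.mem hα) ⟨hα, hc⟩
  have h1 : J β ∊ θ := h.lim.1.trans hβJ hβθ
  exact hmin _ hβJ ⟨h1, (h.mem _ _ (h.lim.ord h1) (h.lim.ord hβθ)).2 hβJ⟩

theorem map_eq_or_mem {α : M} (hα : α ∊ θ) : J α = α ∨ α ∊ J α := by
  have o := h.lim.1.mem hα
  rcases ord_trichotomy o ((h.isOrdinal (h.lim.ord hα)).2 o) with h' | h' | h'
  · exact Or.inr h'
  · exact Or.inl h'.symm
  · exact absurd h' (h.not_map_mem hα)

/-- `κ` is the least ordinal moved by `J`. -/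
def _root_.SetModel.IsCrit (θ : M) (J : M → M) (κ : M) : Prop :=
  κ ∊ θ ∧ (∀ β, β ∊ κ → J β = β) ∧ κ ∊ J κ

theorem exists_crit {α : M} (hα : α ∊ θ) (hm : J α ≠ α) :
    ∃ κ, IsCrit θ J κ ∧ IsSubset κ α := by
  obtain ⟨κ, oκ, ⟨hκθ, hκ⟩, hmin⟩ := exists_least_ord (fun α => α ∊ θ ∧ J α ≠ α)
    (h.lim.1.mem hα) ⟨hα, hm⟩
  refine ⟨κ, ⟨hκθ, fun β hβ => ?_, (h.map_eq_or_mem hκθ).resolve_left hκ⟩,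
    (ord_not_mem (h.lim.1.mem hα) oκ).1 fun h' => hmin α h' ⟨hα, hm⟩⟩
  by_contra hc
  exact hmin β hβ ⟨h.lim.1.trans hβ hκθ, hc⟩

/-- A preimage of `κ` would be an ordinal. Those below `κ` are fixed, `κ` itself goes up, and those
above go above `J κ > κ`. -/
theorem ne_crit {κ : M} (hκ : IsCrit θ J κ) {x : M} (hx : x ∊ V θ) : J x ≠ κ := by
  have oκ := h.lim.1.mem hκ.1
  intro e
  have ox : IsOrdinal x := (h.isOrdinal hx).1 (e.symm ▸ oκ)
  rcases ord_trichotomy ox oκ with h' | h' | h'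
  · rw [hκ.2.1 x h'] at e
    exact not_mem_self κ (e ▸ h')
  · subst h'
    exact not_mem_self (J x) (by nth_rw 1 [e]; exact hκ.2.2)
  · have := (h.mem _ _ (h.lim.ord hκ.1) hx).2 h'
    rw [e] at this
    exact not_mem_of_mem hκ.2.2 this

/-- A set mapped to itself is fixed pointwise. -/
theorem not_crit_mem {κ Z : M} (hκ : IsCrit θ J κ) (hZ : Z ∊ V θ) (hJZ : J Z = Z)
    (hκZ : κ ∊ Z) : False := by
  have hZJ : ∀ x, x ∊ Z → J x ∊ Z := fun x hx => by
    have := (h.mem _ _ (V_trans h.lim.1 hZ hx) hZ).2 hx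
    rwa [hJZ] at this
  -- By elementarity `J G` covers `Z` too, and the pointwise image of `Z` under `J` is a subset of
  -- `Z` of full size. So `κ` is a value of `J G` at a sequence `y` of elements of that image.
  obtain ⟨G, hG⟩ := exists_covers Z
  have hF := h.lim.funs h.om_mem_V hZ
  have hP := h.lim.prod h.om_mem_V hF
  have hGV : G ∊ V θ := h.lim.of_isFun hP hZ hG.1
  have hG' : Covers Z (J G) := by
    have := h.cls 7 _ (by omega) (h.lim.pr hZ hGV)
    rw [h.map_pr _ _ hZ hGV, hJZ] at this
    simp only [baseClasses, Set.mem_ofPred_eq, fst_pr, snd_pr] at this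
    exact this.2 hG
  have hb : IsBijection (lam Z J) Z (img J Z) :=
    sameCard_of_bij _ (fun x hx => mem_img.2 ⟨x, hx, rfl⟩)
      (fun x y hx hy e => h.inj _ _ (V_trans h.lim.1 hZ hx) (V_trans h.lim.1 hZ hy) e)
      (fun y hy => let ⟨x, hx, e⟩ := mem_img.1 hy; ⟨x, hx, e.symm⟩)
  have hsub : IsSubset (img J Z) Z := fun y hy => by
    obtain ⟨x, hx, rfl⟩ := mem_img.1 hy
    exact hZJ x hx
  obtain ⟨n, y, hn, hy, hκG⟩ := hG'.2 (img J Z) hsub (SameCard.symm ⟨_, hb⟩) κ hκZ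
  have hxf : IsFun (comp (inv (lam Z J)) y) (om M) Z := isFun_comp hb.symm.1 hy
  have hxV := h.lim.of_isFun h.om_mem_V hZ hxf
  -- Since `J` fixes `ω` pointwise, it acts on an ω-sequence termwise; hence `y` is the image of its
  -- termwise preimage, and `κ` is a value of `J`, against `ne_crit`.
  have hJx : J (comp (inv (lam Z J)) y) = y := by
    have h1 := (h.isFun_iff hxV h.om_mem_V hZ).2 hxf
    rw [h.map_om, hJZ] at h1
    refine h1.1.ext hy.1 fun k hk => ?_
    have h2 := h.map_ap hxf h.om_mem_V hZ hk
    rw [h.map_nat hk] at h2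
    have h3 := hb.ap_inv (hy.ap_mem hk)
    rw [ap_lam h3.1] at h3
    rw [h2, ap_comp hy.1 hk, h3.2]
  have hnV : n ∊ V θ := V_trans h.lim.1 h.om_mem_V hn
  have hpP : pr n (comp (inv (lam Z J)) y) ∊ prod (om M) (funs (om M) Z) :=
    pr_mem_prod.2 ⟨hn, mem_funs.2 hxf⟩
  have h4 := h.map_ap hG.1 hP hZ hpP
  rw [h.map_pr _ _ hnV hxV, hJx, h.map_nat hn] at h4
  refine h.ne_crit hκ (V_trans h.lim.1 hZ (hG.1.ap_mem hpP)) ?_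
  rw [← h4, ← (hG'.1.1.pr_mem.1 hκG).2]

/-- If `f` maps `β < κ` onto `κ`, then `J f` maps `β` onto `J κ`, so `κ = J f x` for some `x < β`.
But `J x = x`, so `κ = J (f x)` is in the range of `J`. -/
theorem noSurj {κ : M} (hκ : IsCrit θ J κ) : NoSurj κ := by
  intro β f hβ hf
  by_contra! hc
  have hκV := h.lim.ord hκ.1
  have hβV : β ∊ V θ := V_trans h.lim.1 hκV hβ
  have hfV := h.lim.of_isFun hβV hκV hf
  have h1 := (h.isFun_iff hfV hβV hκV).2 hf
  -- Class 8 expresses surjectivity onto the second component.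
  have h2 := h.cls 8 _ (by omega) (h.lim.pr hfV hκV)
  rw [h.map_pr _ _ hfV hκV] at h2
  simp only [baseClasses, Set.mem_ofPred_eq, fst_pr, snd_pr] at h2
  obtain ⟨x, hx⟩ := h2.2 hc κ hκ.2.2
  obtain ⟨hxβ, e⟩ := h1.1.pr_mem.1 hx
  rw [hκ.2.1 β hβ] at hxβ
  have hxκ := (h.lim.1.mem hκ.1).trans hxβ hβ
  have h3 := h.map_ap hf hβV hκV hxβ
  rw [hκ.2.1 x hxκ, ← e] at h3
  exact h.ne_crit hκ (V_trans h.lim.1 hκV (hf.ap_mem hxβ)) h3.symm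

theorem isCardinal {κ : M} (hκ : IsCrit θ J κ) : IsCardinal κ := by
  refine ⟨h.lim.1.mem hκ.1, fun β hβ ⟨f, hf⟩ => ?_⟩
  obtain ⟨γ, hγ, hx⟩ := h.noSurj hκ β f hβ hf.1
  obtain ⟨x, hx', -⟩ := hf.2 γ hγ
  exact hx x (app_iff.1 hx')

theorem om_mem_crit {κ : M} (hκ : IsCrit θ J κ) : om M ∊ κ := by
  have oκ := h.lim.1.mem hκ.1
  rcases ord_trichotomy ord_om oκ with h' | h' | h'
  · exact h'
  · exact absurd (h' ▸ h.map_om) (ne_of_mem hκ.2.2).symm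
  · exact absurd (h.map_nat h') (ne_of_mem hκ.2.2).symm

theorem lim_crit {κ : M} (hκ : IsCrit θ J κ) : IsLim κ := by
  have oκ := h.lim.1.mem hκ.1
  refine ⟨oκ, oκ.trans emp_mem_om (h.om_mem_crit hκ), fun β hβ => ?_⟩
  have hβθ := h.lim.1.trans hβ hκ.1
  rcases ord_trichotomy (oκ.mem hβ).sc oκ with h' | h' | h'
  · exact h'
  · have := h.map_sc hβθ
    rw [hκ.2.1 β hβ, h'] at this
    exact absurd this (ne_of_mem hκ.2.2).symm
  · rcases mem_sc.1 h' with h' | rfl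
    · exact absurd h' (not_mem_of_mem hβ)
    · exact absurd hβ (not_mem_self _)

/-- Induction on rank. Besides the images of elements of `x`, `J x` has no further elements, because
`J x ⊆ J (V γ) = V γ` and `J` fixes `V γ` pointwise. -/
theorem map_eq_of_mem_V {κ : M} (hκ : IsCrit θ J κ) {x : M} (hx : x ∊ V κ) : J x = x := by
  have oκ := h.lim.1.mem hκ.1
  refine ord_induction (P := fun β => IsSubset β κ → ∀ x, x ∊ V β → J x = x) ?_ oκ
    (isSubset_refl κ) x hx
  intro β oβ ih hβ x hx
  obtain ⟨γ, hγ, hxγ⟩ := (mem_V oβ).1 hx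
  have hγκ := hβ γ hγ
  have hγθ := h.lim.1.trans hγκ hκ.1
  have ih' := ih γ hγ (oκ.subset hγκ)
  have hVγ := h.lim.V_mem hγθ
  have hxθ : x ∊ V θ := V_subset h.lim.1 hVγ hxγ
  have hs := (h.subset_iff hxθ hVγ).2 hxγ
  rw [h.map_V hγθ, hκ.2.1 γ hγκ] at hs
  refine ext fun z => ⟨fun hz => ?_, fun hz => ?_⟩
  · have hz' : J z ∊ J x := by rwa [ih' z (hs z hz)]
    exact (h.mem _ _ (V_trans h.lim.1 hVγ (hs z hz)) hxθ).1 hz'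
  · rw [← ih' z (hxγ z hz), h.mem _ _ (V_trans h.lim.1 hxθ hz) hxθ]
    exact hz

end ClassEmb

/-! ### Extendible cardinals yield embeddings of ordinal structures -/

instance (f : M) : DF1 (ap f) := ⟨inferInstance⟩

/-- It contains `⟨tg 0, α⟩` for every ordinal `α`. -/
theorem isProperClass_codeClass (E : ℕ → Set M) [∀ k, DSet (E k)] (ξ : M) :
    IsProperClass (codeClass E ξ) := by
  refine ⟨dset_iff.1 inferInstance, ?_⟩
  rintro ⟨a, ha⟩
  refine not_isSetP_ord (isSetP_of_subset _ (a := sU (sU a)) fun α hα => ?_)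
  have : pr (tg 0) α ∊ a := (ha _).2 (Or.inl ((pr_mem_tagged (by omega)).2 hα))
  exact mem_sU.2 ⟨_, mem_sU.2 ⟨_, this, mem_upair.2 (Or.inr rfl)⟩, mem_upair.2 (Or.inr rfl)⟩

/-- The ordinal structures with domain in a given set form a set. -/
theorem exists_large_domain {L : M} (hL : IsLanguage L) {A : Set M} (hA : IsProperClass A)
    (hs : ∀ N ∈ A, IsOrdStructure L N) {κ : M} (hκ : IsOrdinal κ) :
    ∃ D I, pr D I ∈ A ∧ IsStructureOn L D I ∧ IsOrdinal D ∧ ¬ D ∊ κ := by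
  by_contra! hcon
  have hd : DSet A := dset_iff.2 hA.1
  obtain ⟨S, w, hw, hLS⟩ := hL
  obtain rfl := isOmega_iff.1 hw
  refine hA.2 (isSetP_of_subset (fun x => x ∈ A)
    -- With domains in `κ` and arities in `ω`, each relation is a set of subsets of `ω × κ`; this
    -- bounds all the structures by one set.
    (a := prod κ (funs S (pow (pow (prod (om M) κ))))) fun N hN => ?_)
  obtain ⟨D, I, e, hst, hD⟩ := hs N hN
  obtain rfl := isOPair_iff.1 e
  have hDκ := hcon D I hN hst hD
  obtain ⟨-, S', hLS', hI, hR⟩ := hst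
  obtain rfl : S' = S := hLS'.dom_eq.symm.trans hLS.1.dom_eq
  refine pr_mem_prod.2 ⟨hDκ, mem_funs.2 (isFun_iff.2 ⟨hI, fun r hr => ?_⟩)⟩
  refine mem_pow.2 fun t ht => mem_pow.2 fun p hp => ?_
  have hf := hR r _ _ (app_iff.2 (hLS.1.ap_mem hr)) (app_iff.2 (hI.ap_mem hr)) t ht
  obtain ⟨k, hk, rfl⟩ := hf.1.mem_iff.1 hp
  exact pr_mem_prod.2 ⟨mem_om_of_mem (hLS.ap_mem hr) hk, hκ.trans (hf.ap_mem hk) hDκ⟩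

/-- The first class makes images of members of `A` members of `A`; the second makes the embedding
respect satisfaction of all internal formulas of `L`, nonstandard ones included. -/
def satClasses (L : M) (A : Set M) : ℕ → Set M
  | 0 => A
  | 1 => {x | Sat L (fst x) (fst (snd x)) (fst (snd (snd x))) (snd (snd (snd x)))}
  | _ => ∅

instance (L : M) (A : Set M) [hA : DSet A] (k : ℕ) : DSet (satClasses L A k) := by
  match k with
  | 0 => exact hA
  | 1 => exact ⟨⟨(inferInstance : Dfn fun v : ℕ → M =>
      Sat L (fst (v 0)) (fst (snd (v 0))) (fst (snd (snd (v 0)))) (snd (snd (snd (v 0)))))⟩⟩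
  | k + 2 => exact ⟨⟨dfn_const (p := False)⟩⟩

/-- Formulas lie in `V κ` and are fixed, and `J s` is the termwise image of an assignment `s`
because `J` fixes `ω` pointwise. So `hS`, read at a formula and an assignment, is elementarity of
`J` on `D`. -/
theorem ClassEmb.isElementary {E : ℕ → Set M} {L θ θ' κ D I I' : M} {J : M → M} [DF1 J]
    (h : ClassEmb E θ θ' J) (hκ : IsCrit θ J κ) (hφ : ∀ φ, IsFormula L φ → φ ∊ V κ)
    (hD : D ∊ V θ) (hS : ∀ φ s, φ ∊ V θ → s ∊ V θ →
      (Sat L (J D) I' (J φ) (J s) ↔ Sat L D I φ s)) : IsElementary L D I (J D) I' (lam D J) := by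
  have hj : IsFun (lam D J) D (J D) :=
    isFun_lam fun x hx => (h.mem _ _ (V_trans h.lim.1 hD hx) hD).2 hx
  refine ⟨hj, fun φ s s' hf hs hs' hss => ?_⟩
  rw [isAssignment_iff] at hs hs'
  simp only [app_iff] at hss
  have hsV := h.lim.of_isFun h.om_mem_V hD hs
  have hfκ := hφ φ hf
  have hfV : φ ∊ V θ := V_mono (h.lim.1.mem hκ.1) h.lim.1 (h.lim.1.subset hκ.1) _ hfκ
  have e : J s = s' := by
    have h1 := (h.isFun_iff hsV h.om_mem_V hD).2 hs
    rw [h.map_om] at h1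
    refine h1.1.ext hs'.1 fun k hk => ?_
    have h2 := h.map_ap hs h.om_mem_V hD hk
    rw [h.map_nat hk] at h2
    rw [h2]
    exact (hs'.1.pr_mem.1 (hss k _ _ (hs.1.ap_mem hk) (pr_mem_lam.2 ⟨hs.ap_mem hk, rfl⟩))).2
  have h5 := hS φ s hfV hsV
  rw [e, h.map_eq_of_mem_V hκ hfκ] at h5
  exact h5.symm

open Classical in
-- As `κ ≤ D`, also `J κ ≤ J D`. A bijection from `D` to `J D`, with values outside `J κ` replaced
-- by `∅`, would map `D < J κ` onto `J κ`, although `J κ` inherits `NoSurj` from `κ`.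
theorem ClassEmb.not_sameCard {E : ℕ → Set M} {θ θ' κ D : M} {J : M → M} [DF1 J]
    (h : ClassEmb E θ θ' J) (hκ : IsCrit θ J κ) (hD : D ∊ θ) (hDκ : ¬ D ∊ κ) (hθ : θ ∊ J κ) :
    ¬ SameCard D (J D) := by
  rintro ⟨f, hf⟩
  have oκ := h.lim.1.mem hκ.1
  have oD := h.lim.1.mem hD
  have hκV := h.lim.ord hκ.1
  have oJκ : IsOrdinal (J κ) := (h.isOrdinal hκV).2 oκ
  have hsub := (h.subset_iff hκV (h.lim.ord hD)).2 ((ord_not_mem oD oκ).1 hDκ)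
  have hn : NoSurj (J κ) := (h.cls 3 κ (by omega) hκV).2 (h.noSurj hκ)
  have he : emp M ∊ J κ := oJκ.trans (oκ.trans emp_mem_om (h.om_mem_crit hκ)) hκ.2.2
  obtain ⟨γ, hγ, hx⟩ := hn D (lam D fun x => if ap f x ∊ J κ then ap f x else emp M)
    (oJκ.trans hD hθ) (isFun_lam fun x hx => by
      split_ifs with hc
      · exact hc
      · exact he)
  obtain ⟨x, hxD, e⟩ := (isBijection_iff.1 hf).2.2 γ (hsub γ hγ)
  exact hx x (pr_mem_lam.2 ⟨hxD, by rw [e, if_pos hγ]⟩)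

theorem ExtendiblePrinciple.ordinalVopenka (hext : ExtendiblePrinciple M) {L : M}
    (hL : IsLanguage L) : OrdinalVopenka L := by
  intro A hA hs
  have hd : DSet A := dset_iff.2 hA.1
  -- The distinguished point is a limit `ξ` with all formulas of `L` in `V ξ`; it serves to push the
  -- critical point above `L`.
  obtain ⟨ξ, hξ, hom, hLξ⟩ := exists_lim_mem_V L ord_om
  obtain ⟨κ, hκc, hκ⟩ := hext _ (isProperClass_codeClass (satClasses L A) ξ)
  obtain ⟨D, I, hN, hst, oD, hDκ⟩ := exists_large_domain hL hA hs hκc.1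
  obtain ⟨η, hη, homη, hx⟩ := exists_lim_mem_V (pr (pr D I) (pr ξ κ)) ord_om
  obtain ⟨hNV, hx⟩ := mem_V_of_pr hη.1 hx
  obtain ⟨hDV, hIV⟩ := mem_V_of_pr hη.1 hNV
  obtain ⟨hξV, hκV⟩ := mem_V_of_pr hη.1 hx
  have hξη := (ord_mem_V hη.1 hξ.1).1 hξV
  have hκη := (ord_mem_V hη.1 hκc.1).1 hκV
  have hDη := (ord_mem_V hη.1 oD).1 hDV
  obtain ⟨-, -, -, L', ζ, D₁, I₁, D₂, I₂, j, hL', oζ, h1, h2, hel, hcr, γ, hγ, hηγ⟩ :=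
    hκ η hη.1 hκη
  obtain rfl := isLStd_iff.1 hL'
  obtain ⟨rfl, -, rfl⟩ := (isVStructure_iff hη.1).1 h1
  obtain ⟨rfl, -, rfl⟩ := (isVStructure_iff oζ).1 h2
  have h := hel.classEmb hη homη oζ hξ.1 hξ.1
  have hξJ := hel.map_point hη homη oζ hξ.1 hξ.1 hξη
  rw [app_iff] at hγ
  have eγ := (hel.1.1.pr_mem.1 hγ).2
  subst eγ
  have oJκ : IsOrdinal (ap j κ) := (h.isOrdinal hκV).2 hκc.1
  have hcrit : IsCrit η (ap j) κ := ⟨hκη, fun β hβ =>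
    (hel.1.1.pr_mem.1 (app_iff.1 (hcr.2.1 β hβ))).2.symm, oJκ.trans hκη hηγ⟩
  -- If `κ ≤ ξ`, then `j(κ) ≤ j(ξ) = ξ < η`, against `η < j(κ)`.
  have hξκ : ξ ∊ κ := by
    rcases ord_trichotomy hξ.1 hκc.1 with h' | rfl | h'
    · exact h'
    · exact absurd hcrit.2.2 (hξJ.symm ▸ not_mem_self _)
    · have h3 := (h.mem _ _ hκV hξV).2 h'
      rw [hξJ] at h3
      exact absurd (hξ.1.trans hηγ h3) (not_mem_of_mem hξη)
  have hφ : ∀ φ, IsFormula L φ → φ ∊ V κ := fun φ hf =>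
    V_mono hξ.1 hκc.1 (hκc.1.subset hξκ) _ (hf _ (formulaClosed_V hξ hom hLξ))
  refine ⟨_, hN, pr (ap j D) (ap j I), ?_, ?_, ?_⟩
  · have := h.cls 9 _ (by omega) hNV
    rw [h.map_pr _ _ hDV hIV] at this
    exact this.2 hN
  · rintro ⟨D', I', D'', I'', e, e', hc⟩
    rw [isOPair_iff, pr_inj] at e e'
    obtain ⟨rfl, rfl⟩ := e
    obtain ⟨rfl, rfl⟩ := e'
    exact h.not_sameCard hcrit hDη hDκ hηγ hc
  · refine ⟨D, I, _, _, _, isOPair_iff.2 rfl, isOPair_iff.2 rfl,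
      h.isElementary hcrit hφ hDV fun φ s hφV hsV => ?_⟩
    have h3 := hη.pr hφV hsV
    have h4 := hη.pr hIV h3
    have h5 := h.cls 10 _ (by omega) (hη.pr hDV h4)
    rw [h.map_pr _ _ hDV h4, h.map_pr _ _ hIV h3, h.map_pr _ _ hφV hsV] at h5
    simpa [baseClasses, satClasses] using h5

/-! ### Vopěnka's Principle yields extendible cardinals -/

/-- The least ordinal satisfying `P`. -/
noncomputable def least (P : M → Prop) : M := mk fun β => ∀ η, IsOrdinal η → P η → β ∊ η

instance dtm_least {P : (ℕ → M) → M → Prop} [h : Dfn fun v => P (fun i => v (i + 1)) (v 0)] :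
    DTm fun v => least (P v) := by
  have : Dfn fun v : ℕ → M => P (fun i => v (i + 2)) (v 0) :=
    (h.reindex fun i => Nat.casesOn i 0 fun k => k + 2).congr fun _ => Iff.rfl
  clear h
  unfold least
  infer_instance

theorem least_spec (P : M → Prop) [h : Dfn fun v : ℕ → M => P (v 0)] {α : M}
    (hα : IsOrdinal α) (hP : P α) : IsOrdinal (least P) ∧ P (least P) := by
  obtain ⟨β, hβ, hPβ, hmin⟩ := exists_least_ord P hα hP
  have : least P = β := (eq_mk fun γ => ⟨fun hγ η hη h =>
    (ord_not_mem hη hβ).1 (fun h' => hmin η h' h) γ hγ, fun h => h β hβ hPβ⟩).symm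
  rw [this]
  exact ⟨hβ, hPβ⟩

instance dfn_mem_pointed {n : ℕ} {C : ℕ → Set M} [h : ∀ k, DSet (C k)] {a b : (ℕ → M) → M}
    [DTm a] [DTm b] : Dfn fun v => a v ∈ pointed n C (b v) :=
  (inferInstance : Dfn fun v => a v ∈ tagged n C ∨ a v = b v)

/-- The least `η > α` such that `α` is not `η`-extendible for `A`. -/
noncomputable def extBound (A : Set M) (α : M) : M :=
  least fun η => α ∊ η ∧ ¬ IsExtendibleTo A η α

/-- A limit ordinal above `ξ` and above `extBound A α` for all `α ≤ ξ`. -/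
noncomputable def height (A : Set M) (ξ : M) : M :=
  least fun θ => IsLim θ ∧ om M ∊ θ ∧ ξ ∊ θ ∧ ∀ α, α ∊ sc ξ → extBound A α ∊ θ

/-- Satisfaction in `⟨V_η, ∈, A⟩` yields elementarity of restrictions, the graph fixes `extBound A
α` whenever `α` is fixed, and the closure class carries closure from `κ` to its image. -/
def extClasses (A : Set M) : ℕ → Set M
  | 0 => {x | Sat (lstd M) (V (fst x)) (vInt A (V (fst x))) (fst (snd x)) (snd (snd x))}
  | 1 => {x | snd x = extBound A (fst x)}
  | 2 => {x | ∀ α, α ∊ x → extBound A α ∊ x}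
  | _ => ∅

noncomputable def extStructure (A : Set M) (ξ : M) : M :=
  pr (V (height A ξ)) (vInt (codeClass (extClasses A) ξ) (V (height A ξ)))

section
variable {A : Set M} [hA : DSet A]

instance : DF1 (extBound A) := ⟨by unfold extBound; infer_instance⟩
instance : DF1 (height A) := ⟨by unfold height; infer_instance⟩

instance dset_extClasses (k : ℕ) : DSet (extClasses A k) := by
  match k with
  | 0 => exact ⟨⟨(inferInstance : Dfn fun v : ℕ → M =>
      Sat (lstd M) (V (fst (v 0))) (vInt A (V (fst (v 0)))) (fst (snd (v 0))) (snd (snd (v 0))))⟩⟩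
  | 1 => exact ⟨⟨(inferInstance : Dfn fun v : ℕ → M => snd (v 0) = extBound A (fst (v 0)))⟩⟩
  | 2 => exact ⟨⟨(inferInstance : Dfn fun v : ℕ → M => ∀ α, α ∊ v 0 → extBound A α ∊ v 0)⟩⟩
  | k + 3 => exact ⟨⟨dfn_const (p := False)⟩⟩

instance : DF1 (extStructure A) := ⟨by unfold extStructure vInt predRel; infer_instance⟩

theorem extBound_spec (hno : ∀ α, ¬ IsExtendibleFor A α) {α : M} (hα : IsOrdinal α) :
    IsOrdinal (extBound A α) ∧ α ∊ extBound A α ∧ ¬ IsExtendibleTo A (extBound A α) α := by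
  have : ∃ η, IsOrdinal η ∧ α ∊ η ∧ ¬ IsExtendibleTo A η α := by
    by_cases hc : IsCardinal α
    · by_contra! h
      exact hno α ⟨hc, h⟩
    -- A non-cardinal is not extendible to any height, so `α + 1` serves.
    · exact ⟨sc α, hα.sc, by simp, fun h => hc h.1⟩
  obtain ⟨η, hη, h⟩ := this
  exact least_spec (fun η => α ∊ η ∧ ¬ IsExtendibleTo A η α) hη h

theorem height_spec (hno : ∀ α, ¬ IsExtendibleFor A α) {ξ : M} (hξ : IsOrdinal ξ) :
    IsLim (height A ξ) ∧ om M ∊ height A ξ ∧ ξ ∊ height A ξ ∧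
      ∀ α, α ∊ sc ξ → extBound A α ∊ height A ξ := by
  obtain ⟨θ, hθ, hom, h⟩ := exists_lim_mem_V (pr (img (extBound A) (sc ξ)) ξ) ord_om
  obtain ⟨h1, h2⟩ := mem_V_of_pr hθ.1 h
  refine (least_spec (fun θ => IsLim θ ∧ om M ∊ θ ∧ ξ ∊ θ ∧ ∀ α, α ∊ sc ξ → extBound A α ∊ θ)
    hθ.1 ⟨hθ, hom, (ord_mem_V hθ.1 hξ).1 h2, fun α hα => ?_⟩).2
  exact (ord_mem_V hθ.1 (extBound_spec hno (hξ.sc.mem hα)).1).1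
    (V_trans hθ.1 h1 (mem_img.2 ⟨α, hα, rfl⟩))

/-- Different `ξ` may have the same `height`; the structure still determines `ξ` as the only ordinal
in its unary predicate. -/
theorem extStructure_inj (hno : ∀ α, ¬ IsExtendibleFor A α) {ξ ξ' : M} (hξ : IsOrdinal ξ)
    (hξ' : IsOrdinal ξ') (e : extStructure A ξ = extStructure A ξ') : ξ = ξ' := by
  obtain ⟨e1, e2⟩ := pr_inj.1 e
  rw [← e1] at e2
  have h1 : pr (num 1) (predRel (V (height A ξ)) (codeClass (extClasses A) ξ)) ∊
      vInt (codeClass (extClasses A) ξ) (V (height A ξ)) := pr_mem_vInt.2 (Or.inr ⟨rfl, rfl⟩)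
  rw [e2, pr_mem_vInt] at h1
  have e3 := h1.elim (fun h => absurd h.1.symm num_zero_ne_one) (fun h => h.2)
  have h2 : sing (pr (num 0) ξ) ∊ predRel (V (height A ξ)) (codeClass (extClasses A) ξ) := by
    refine mem_predRel.2 ⟨isFun_iff.2 ⟨num_one (M := M) ▸ isFunOn_sing, fun x hx => ?_⟩, ?_⟩
    · rw [num_one, mem_sing] at hx
      rw [hx, ap_sing]
      have := height_spec hno hξ
      exact this.1.ord this.2.2.1
    · rw [ap_sing]
      exact Or.inr rfl
  rw [e3, mem_predRel, ap_sing] at h2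
  exact h2.2.resolve_left (not_mem_tagged_of_ord hξ)

/-- The witness is the restriction of `J` to `V η`, with `ζ = J η`. -/
theorem ClassEmb.isExtendibleTo {θ θ' κ η : M} {J : M → M} [DF1 J]
    (h : ClassEmb (extClasses A) θ θ' J) (hκ : IsCrit θ J κ) (hη : η ∊ θ) (hκη : κ ∊ η)
    (hJ : η ∊ J κ) : IsExtendibleTo A η κ := by
  have oη := h.lim.1.mem hη
  have hηV := h.lim.ord hη
  have hκV := h.lim.ord hκ.1
  have oJη : IsOrdinal (J η) := (h.isOrdinal hηV).2 oη
  have hJκη : J κ ∊ J η := (h.mem _ _ hκV hηV).2 hκη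
  have hVη := h.lim.V_mem hη
  have lκ := h.lim_crit hκ
  -- The language `{ε, R}` lies in `V κ` because `κ` is a limit above `ω`; so do its formulas, which
  -- are therefore fixed.
  have hφ : ∀ φ, IsFormula (lstd M) φ → φ ∊ V κ := fun φ hf =>
    hf _ (formulaClosed_V lκ (h.om_mem_crit hκ)
      (lκ.upair (lκ.pr (lκ.num _) (lκ.num _)) (lκ.pr (lκ.num _) (lκ.num _))))
  have hel := h.isElementary (L := lstd M) (D := V η) (I := vInt A (V η))
    (I' := vInt A (V (J η))) hκ hφ hVη fun φ s hφV hsV => by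
      have h3 := h.lim.pr hφV hsV
      have h4 := h.cls 9 _ (by omega) (h.lim.pr hηV h3)
      rw [h.map_pr _ _ hηV h3, h.map_pr _ _ hφV hsV] at h4
      rw [h.map_V hη]
      simpa [baseClasses, extClasses] using h4
  rw [h.map_V hη] at hel
  have hsub := ord_subset_V oη
  refine ⟨h.isCardinal hκ, oη, hκη, lstd M, J η, V η, vInt A (V η), V (J η), vInt A (V (J η)),
    _, isLStd_iff.2 rfl, oJη, (isVStructure_iff oη).2 ⟨rfl, ⟨κ, hsub κ hκη⟩, rfl⟩,
    (isVStructure_iff oJη).2 ⟨rfl, ⟨J κ, ord_subset_V oJη _ hJκη⟩, rfl⟩, hel,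
    ⟨lκ.1, fun β hβ => ?_, J κ, ?_, (ne_of_mem hκ.2.2).symm⟩, J κ, ?_, hJ⟩
  · exact app_iff.2 (pr_mem_lam.2 ⟨hsub β (oη.trans hβ hκη), (hκ.2.1 β hβ).symm⟩)
  · exact app_iff.2 (pr_mem_lam.2 ⟨hsub κ hκη, rfl⟩)
  · exact app_iff.2 (pr_mem_lam.2 ⟨hsub κ hκη, rfl⟩)
end

theorem VopenkaPrinciple.extendiblePrinciple (hvp : VopenkaPrinciple M) :
    ExtendiblePrinciple M := by
  intro A hA
  have hd : DSet A := dset_iff.2 hA.1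
  by_contra! hno
  have hC : IsProperClass {N : M | ∃ ξ, IsOrdinal ξ ∧ N = extStructure A ξ} := by
    refine ⟨dset_iff.1 ⟨⟨(inferInstance : Dfn fun v : ℕ → M =>
      ∃ ξ, IsOrdinal ξ ∧ v 0 = extStructure A ξ)⟩⟩, ?_⟩
    rintro ⟨a, ha⟩
    exact not_isSetP_ord (isSetP_of_inj (IsOrdinal : M → Prop) (extStructure A) (b := a)
      (fun ξ hξ => (ha _).2 ⟨ξ, hξ, rfl⟩) fun ξ ξ' hξ hξ' e => extStructure_inj hno hξ hξ' e)
  obtain ⟨_, ⟨ξ, hξ, rfl⟩, _, ⟨ξ', hξ', rfl⟩, hne, D, I, D', I', j, e, e', hel⟩ :=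
    hvp (lstd M) (isLStd_iff.2 rfl) _ hC (by
      rintro _ ⟨ξ, hξ, rfl⟩
      exact ⟨_, _, isOPair_iff.2 rfl, isStructureOn_vInt ⟨_, (height_spec hno hξ).1.emp⟩⟩)
  rw [isOPair_iff, extStructure, pr_inj] at e e'
  obtain ⟨rfl, rfl⟩ := e
  obtain ⟨rfl, rfl⟩ := e'
  obtain ⟨hθ, hom, hξθ, hb⟩ := height_spec hno hξ
  have hθ' := (height_spec hno hξ').1.1
  have h := hel.classEmb hθ hom hθ' hξ hξ'
  have hξJ := hel.map_point hθ hom hθ' hξ hξ' hξθ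
  -- The structures differ and `j(ξ) = ξ'`, so `ξ` is moved and the critical point is at most `ξ`.
  -- By the choice of `height`, `extBound A α` is below `θ` for all `α ≤ κ`.
  obtain ⟨κ, hκ, hκξ⟩ := h.exists_crit hξθ fun e => hne (by rw [← hξJ, e])
  have oκ := hθ.1.mem hκ.1
  have hκV := hθ.ord hκ.1
  have hκξ' : κ ∊ sc ξ := mem_sc.2 ((ord_subset_iff oκ hξ).1 hκξ)
  by_cases hc : ∀ α, α ∊ κ → extBound A α ∊ κ
  -- Closure passes from `κ` to `j(κ)`. As `κ < j(κ)`, the bound `extBound A κ` is below `j(κ)`, and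
  -- the restriction of `j` shows the extendibility that this bound denies.
  · have h1 := (h.cls 11 κ (by omega) hκV).2 hc κ hκ.2.2
    obtain ⟨-, h2, h3⟩ := extBound_spec hno oκ
    exact h3 (h.isExtendibleTo hκ (hb κ hκξ') h2 h1)
  · push Not at hc
    obtain ⟨α, hα, hακ⟩ := hc
    have oα := oκ.mem hα
    have hαθ := hb α (hξ.sc.trans hα hκξ')
    have oE := hθ.1.mem hαθ
    have hαV := hθ.ord (hθ.1.trans hα hκ.1)
    have hEV := hθ.ord hαθ
    -- The bound is determined by `α`, which is fixed. A fixed ordinal at or above `κ` is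
    -- impossible: `κ` itself is moved, and above `κ` the Kunen-type argument applies.
    have h1 : ap j (extBound A α) = extBound A α := by
      have := h.cls 10 _ (by omega) (hθ.pr hαV hEV)
      rw [h.map_pr _ _ hαV hEV, hκ.2.1 α hα] at this
      simpa [baseClasses, extClasses] using this
    rcases (ord_subset_iff oκ oE).1 ((ord_not_mem oE oκ).1 hακ) with h' | h'
    · exact h.not_crit_mem hκ hEV h1 h'
    · rw [← h'] at h1
      exact ne_of_mem hκ.2.2 h1.symm

/-! ### Embeddings of ordinal structures yield Vopěnka's Principle -/

theorem comp_assoc {f g k a b : M} (hk : IsFun k a b) (hg : IsFunOn g b) :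
    comp f (comp g k) = comp (comp f g) k :=
  (isFunOn_comp (isFunOn_comp hk.1)).ext (isFunOn_comp hk.1) fun x hx => by
    rw [ap_comp (isFunOn_comp hk.1) hx, ap_comp hk.1 hx, ap_comp hk.1 hx,
      ap_comp hg (hk.ap_mem hx)]

/-- The condition relating `s` and `s'` forces `s' = comp j s`. -/
theorem isElementary_iff {L D I D' I' j : M} : IsElementary L D I D' I' j ↔ IsFun j D D' ∧
    ∀ φ s, IsFormula L φ → IsFun s (om M) D → (Sat L D I φ s ↔ Sat L D' I' φ (comp j s)) := by
  refine and_congr_right fun hj => ?_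
  simp only [isAssignment_iff, app_iff]
  constructor
  · intro h φ s hφ hs
    refine h φ s _ hφ hs (isFun_comp hj hs) fun i x y hx hy => ?_
    obtain ⟨hi, rfl⟩ := hs.1.pr_mem.1 hx
    obtain ⟨-, rfl⟩ := hj.1.pr_mem.1 hy
    exact (isFun_comp hj hs).1.pr_mem.2 ⟨hi, (ap_comp hs.1 hi).symm⟩
  · intro h φ s s' hφ hs hs' he
    have : s' = comp j s := hs'.1.ext (isFunOn_comp hs.1) fun i hi => by
      rw [ap_comp hs.1 hi]
      exact ((hs'.1.pr_mem.1 (he i _ _ (hs.1.ap_mem hi) (hj.1.ap_mem (hs.ap_mem hi)))).2).symm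
    rw [this]
    exact h φ s hφ hs

theorem IsElementary.comp {L D I D' I' D'' I'' j k : M} (hk : IsElementary L D' I' D'' I'' k)
    (hj : IsElementary L D I D' I' j) : IsElementary L D I D'' I'' (comp k j) := by
  rw [isElementary_iff] at *
  refine ⟨isFun_comp hk.1 hj.1, fun φ s hφ hs => ?_⟩
  rw [hj.2 φ s hφ hs, hk.2 φ _ hφ (isFun_comp hj.1 hs), comp_assoc hs hj.1.1]

theorem IsElementary.symm {L D I D' I' j : M} (hj : IsElementary L D I D' I' j)
    (hb : IsBijection j D D') : IsElementary L D' I' D I (inv j) := by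
  rw [isElementary_iff] at *
  refine ⟨hb.symm.1, fun φ s hφ hs => ?_⟩
  have hs' := isFun_comp hb.symm.1 hs
  rw [hj.2 φ _ hφ hs']
  have : SetModel.comp j (SetModel.comp (inv j) s) = s :=
    (isFunOn_comp hs'.1).ext hs.1 fun i hi => by
      rw [ap_comp hs'.1 hi, ap_comp hs.1 hi, (hb.ap_inv (hs.ap_mem hi)).2]
  rw [this]

/-- The structures `N` and `N'` are related by a bijective elementary embedding. -/
def IsCopy (L N N' : M) : Prop := ∃ D I D' I' h, IsOPair N D I ∧ IsOPair N' D' I' ∧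
  IsBijection h D D' ∧ IsElementary L D I D' I' h

instance : DP3 (IsCopy : M → M → M → Prop) := ⟨by unfold IsCopy; infer_instance⟩

open Classical in
-- Transport the relations along a bijection of the domain with an ordinal; formula induction makes
-- the bijection elementary.
theorem exists_copy {L N : M} (hN : IsStructure L N) :
    ∃ N', IsOrdStructure L N' ∧ IsCopy L N' N := by
  obtain ⟨D, I, e, ⟨x, hx⟩, S, hL, hI, hR⟩ := hN
  obtain rfl := isOPair_iff.1 e
  obtain ⟨α, g, hα, hg⟩ := exists_bijection_ord D
  have hh := hg.symm
  generalize inv g = h at hh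
  let I' : M := lam S fun r => sep (funs (ap L r) α) fun t => comp h t ∊ ap I r
  have hI' : IsFunOn I' S := isFunOn_lam
  have hm : ∀ r t, r ∊ S → (t ∊ ap I' r ↔ IsFun t (ap L r) α ∧ comp h t ∊ ap I r) := by
    intro r t hr
    rw [show ap I' r = _ from ap_lam hr, mem_sep, mem_funs]
  have hst : IsStructureOn L α I' := by
    refine ⟨⟨_, hg.1.ap_mem hx⟩, S, hL, hI', fun r n R hn hR t ht => ?_⟩
    rw [app_iff] at hn hR
    obtain ⟨hr, rfl⟩ := hL.pr_mem.1 hn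
    obtain ⟨-, rfl⟩ := hI'.pr_mem.1 hR
    exact ((hm r t hr).1 ht).1
  clear_value I'
  refine ⟨pr α I', ⟨α, I', isOPair_iff.2 rfl, hst, hα⟩, α, I', D, I, h, isOPair_iff.2 rfl,
    isOPair_iff.2 rfl, hh, isElementary_iff.2 ⟨hh.1, fun φ s hφ => ?_⟩⟩
  refine formula_induction (P := fun φ => ∀ s, IsFun s (om M) α →
    (Sat L α I' φ s ↔ Sat L D I φ (comp h s))) ?_ ?_ ?_ ?_ ?_ hφ s
  · intro i j hi hj s hs
    rw [sat_eq hs hi hj, sat_eq (isFun_comp hh.1 hs) hi hj, ap_comp hs.1 hi, ap_comp hs.1 hj]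
    exact ⟨fun e => by rw [e], (isBijection_iff.1 hh).2.1 _ _ (hs.ap_mem hi) (hs.ap_mem hj)⟩
  · intro r t hrt s hs
    obtain ⟨n, hrn, ht⟩ := isVarTuple_iff.1 hrt
    obtain ⟨hr, rfl⟩ := hL.pr_mem.1 hrn
    have hs' := isFun_comp hh.1 hs
    rw [sat_rel hs hrn ht, sat_rel hs' hrn ht]
    · simp only [hI'.pr_mem, hI.pr_mem, hr, true_and, exists_eq_left]
      rw [hm r _ hr, comp_assoc ht hs.1]
      simp only [isFun_comp hs ht, true_and]
    · exact fun R u hRu hu => ⟨_, (hR r _ R (app_iff.2 hrn) (app_iff.2 hRu) u hu).1⟩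
    · intro R u hRu hu
      rw [(hI'.pr_mem.1 hRu).2] at hu
      exact ⟨_, ((hm r u hr).1 hu).1.1⟩
  · intro a ha ih s hs
    rw [sat_neg hs ha, sat_neg (isFun_comp hh.1 hs) ha, ih s hs]
  · intro a b ha hb iha ihb s hs
    rw [sat_and hs ha hb, sat_and (isFun_comp hh.1 hs) ha hb, iha s hs, ihb s hs]
  · intro i a hi ha ih s hs
    have hs' := isFun_comp hh.1 hs
    rw [sat_ex hs hi ha, sat_ex hs' hi ha]
    have hu : ∀ x, x ∊ α → comp h (upd s i x) = upd (comp h s) i (ap h x) := fun x hx => by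
      have h1 := isFun_upd (i := i) hs hx
      refine (isFunOn_comp h1.1).ext (isFun_upd hs' (hh.1.ap_mem hx)).1 fun k hk => ?_
      rw [ap_comp h1.1 hk, ap_upd hk, ap_upd hk, ap_comp hs.1 hk]
      split_ifs <;> rfl
    constructor
    · rintro ⟨x, hx, h⟩
      rw [ih _ (isFun_upd hs hx), hu x hx] at h
      exact ⟨_, hh.1.ap_mem hx, h⟩
    · rintro ⟨y, hy, h⟩
      obtain ⟨x, hx, rfl⟩ := (isBijection_iff.1 hh).2.2 y hy
      rw [← hu x hx, ← ih _ (isFun_upd hs hx)] at h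
      exact ⟨x, hx, h⟩

theorem IsCopy.elemEmbeds {L N₁ N₂ N N' : M} (h : IsCopy L N₁ N) (h' : IsCopy L N₂ N')
    (he : ElemEmbeds L N₁ N₂) : ElemEmbeds L N N' := by
  obtain ⟨D₁, I₁, D, I, f, e1, e2, hf, hf'⟩ := h
  obtain ⟨D₂, I₂, D', I', g, e3, e4, hg, hg'⟩ := h'
  obtain ⟨D₃, I₃, D₄, I₄, j, e5, e6, hj⟩ := he
  rw [isOPair_iff] at *
  obtain ⟨rfl, rfl⟩ := pr_inj.1 (e1.symm.trans e5)
  obtain ⟨rfl, rfl⟩ := pr_inj.1 (e3.symm.trans e6)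
  exact ⟨D, I, D', I', _, isOPair_iff.2 e2, isOPair_iff.2 e4,
    hg'.comp (hj.comp (hf'.symm hf))⟩

theorem IsCopy.sameCard {L N₁ N₂ N : M} (h : IsCopy L N₁ N) (h' : IsCopy L N₂ N) :
    SameCardStructures N₁ N₂ := by
  obtain ⟨D₁, I₁, D, I, f, e1, e2, hf, -⟩ := h
  obtain ⟨D₂, I₂, D', I', g, e3, e4, hg, -⟩ := h'
  rw [isOPair_iff] at *
  obtain ⟨rfl, rfl⟩ := pr_inj.1 (e2.symm.trans e4)
  exact ⟨D₁, I₁, D₂, I₂, isOPair_iff.2 e1, isOPair_iff.2 e3, SameCard.trans ⟨f, hf⟩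
    (SameCard.symm ⟨g, hg⟩)⟩

/-- Pass to a copy and back. Applied to a common copy of two structures, it yields an embedding
between them. -/
theorem IsCopy.refl_embeds {L N : M} (h : IsStructure L N) : ElemEmbeds L N N := by
  obtain ⟨N', -, D', I', D, I, f, e1, e2, hf, hf'⟩ := exists_copy h
  exact ⟨D, I, D, I, _, e2, e2, hf'.comp (hf'.symm hf)⟩

/-- Using all ordinal copies at once avoids choosing one for each member of the class. -/
theorem vopenkaPrinciple_of_ordinal (hord : ∀ L : M, IsLStd L → OrdinalVopenka L) :
    VopenkaPrinciple M := by
  intro L hL C hC hs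
  have hd : DSet C := dset_iff.2 hC.1
  have hdA : Dfn fun v : ℕ → M => IsOrdStructure L (v 0) ∧ ∃ N, N ∈ C ∧ IsCopy L (v 0) N :=
    inferInstance
  by_cases hp : ∃ a, ∀ x, x ∊ a ↔ IsOrdStructure L x ∧ ∃ N, N ∈ C ∧ IsCopy L x N
  · obtain ⟨a, ha⟩ := hp
    by_contra! hcon
    -- If the copies form a set `a`, send `N` to the set of its copies in `a`. Were this injective,
    -- `C` would be a set; so two distinct members share a copy, which yields an embedding.
    refine hC.2 (isSetP_of_inj (fun x => x ∈ C) (fun N => sep a fun x => IsCopy L x N)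
      (b := pow a) (fun N _ => mem_pow.2 fun x hx => (mem_sep.1 hx).1) fun N N' hN hN' e => ?_)
    by_contra hne
    obtain ⟨x, hx, hxN⟩ := exists_copy (hs N hN)
    have h1 : x ∊ sep a fun x => IsCopy L x N := mem_sep.2 ⟨(ha x).2 ⟨hx, N, hN, hxN⟩, hxN⟩
    rw [e, mem_sep] at h1
    obtain ⟨D, I, hxe, hst, -⟩ := hx
    exact hcon N hN N' hN' hne (hxN.elemEmbeds h1.2 (IsCopy.refl_embeds ⟨D, I, hxe, hst⟩))
  · obtain ⟨N₁, ⟨-, N, hN, h1⟩, N₂, ⟨-, N', hN', h2⟩, hc, he⟩ := hord L hL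
      {x | IsOrdStructure L x ∧ ∃ N, N ∈ C ∧ IsCopy L x N} ⟨dset_iff.1 ⟨⟨hdA⟩⟩, hp⟩
      (fun N hN => hN.1)
    refine ⟨N, hN, N', hN', ?_, h1.elemEmbeds h2 he⟩
    -- Copies of a single structure have the same cardinality, so the originals are distinct.
    rintro rfl
    exact hc (h1.sameCard h2)

end SetModel

/-! ### The equivalence -/

theorem mainTheorem8 {M : Type u} [SetModel.LSet.Structure M] (hM : SetModel.IsModelZFC M) :
    List.TFAE
      [SetModel.VopenkaPrinciple M,
        SetModel.ExtendiblePrinciple M,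
        ∀ L : M, SetModel.IsLStd L → SetModel.OrdinalVopenka L,
        ∀ L : M, SetModel.IsLanguage L → SetModel.OrdinalVopenka L] := by
  have hZ : Fact (SetModel.IsModelZFC M) := ⟨hM⟩
  tfae_have 1 → 2 := fun h => h.extendiblePrinciple
  tfae_have 2 → 4 := fun h L hL => h.ordinalVopenka hL
  tfae_have 4 → 3 := fun h L hL => h L (SetModel.isLStd_iff.1 hL ▸ SetModel.isLanguage_lstd)
  tfae_have 3 → 1 := fun h => SetModel.vopenkaPrinciple_of_ordinal h
  tfae_finish
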